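/- **Setting.** Let $T>0$ and let $H\in C^2_c([0,T]\times T^*\mathbb R^d)$ (of class $C^2$ with compact support in $[0,T]\times T^*\mathbb R^d$), where $T^*\mathbb R^d=\mathbb R^d\times\mathbb R^d\ni(x,y)$ carries the Euclidean norm. Let $\varphi_s^t=(X_s^t,Y_s^t)$ be the flow from time $s$ to time $t$ of the Hamiltonian vector field $(\partial_yH,-\partial_xH)$, let $c_H=\sup_{[0,T]\times T^*\mathbb R^d}|D^2H_t|$ and $\delta_H=c_H^{-1}\ln 2$ ($=+\infty$ if $c_H=0$). For $0\le t-s<\delta_H$ the map $\alpha_s^t:(x,y)\mapsto(X_s^t(x,y),y)$ is a diffeomorphism, and one sets $$\phi_s^t(X,y)=\int_s^t\Big((Y^\tau-y)\cdot\dot X^\tau-H(\tau,X^\tau,Y^\tau)\Big)d\tau,\qquad (X^\tau,Y^\tau)=\varphi_s^\tau\circ(\alpha_s^t)^{-1}(X,y).$$ For a subdivision $s=t_0<\dots<t_N=t$ with all steps $<\delta_H$ (an *admissible* subdivision of $[s,t]$), a globally Lipschitz function $v\in C^{\mathrm{Lip}}(\mathbb R^d)$ and $x\in\mathbb R^d$,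 put, for $\eta=(x_i,y_i)_{0\le i<N}\in(T^*\mathbb R^d)^N$ and $x_N:=x$, $$S(x;\eta)=v(x_0)+\sum_{i<N}\phi_{t_i}^{t_{i+1}}(x_{i+1},y_i)+\sum_{i<N}(x_{i+1}-x_i)\cdot y_i .$$ The function $S(x;\cdot)$ differs by a Lipschitz function from the nondegenerate quadratic form $Q(\eta)=-x_{N-1}\cdot y_{N-1}+\sum_{i<N-1}(x_{i+1}-x_i)\cdot y_i$. Let $k$ be the Morse index of $Q$. The minmax of $S(x;\cdot)$ is $$\inf\max S(x;\cdot)=\inf_{\sigma}\ \max_{\eta\in|\sigma|}S(x;\eta),$$ where, for $a$ large, $\sigma$ runs over the relative singular cycles with $\mathbb Z/2$ coefficients of the pair $\big((T^*\mathbb R^d)^N,\{S(x;\cdot)\le -a\}\big)$ whose class is the generator (the non-zero element) of $H_k\cong\mathbb Z/2$, and $|\sigma|$ is the image of $\sigma$. The *minmax operator* $R_H^{s,t}$, $0\le s<t\le T$, is defined by $R_H^{s,t}v(x)=\inf\max S(x;\cdot)$. Denote by $\|\partial v\|$ the Lipschitz constant of $v\in C^{\mathrm{Lip}}(\mathbb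 R^d)$, by $\|\partial_xH\|$ the supremum of $|\partial_xH|$ over $[0,T]\times T^*\mathbb R^d$, and by $|f|_A$ the supremum of $|f|$ over a set $A$. **Proposition.** Let $v\in C^{\mathrm{Lip}}(\mathbb R^d)$. 1) For $0\le s<t\le T$ the number $R_H^{s,t}v(x)$ is well defined for every $x$ (for every admissible subdivision of $[s,t]$, the infimum is, for all sufficiently large $a$, that of a non-empty set of reals which is bounded from below, and its value depends neither on $a$ nor on the subdivision), $R_H^{s,t}$ maps $C^{\mathrm{Lip}}(\mathbb R^d)$ to $C^{\mathrm{Lip}}(\mathbb R^d)$, and $$\|\partial(R_H^{s,t}v)\|\le\|\partial v\|+\|\partial_xH\|\,|t-s|.$$ 2) For $0\le s<t_i\le T$, $i=1,2$, and every $x\in\mathbb R^d$, with $I$ the closed interval with end points $t_1,t_2$, $$|R_H^{s,t_1}v(x)-R_H^{s,t_2}v(x)|\le|t_1-t_2|\,\max_{\tau\in I,\ y\in Y}|H(\tau,x,y)|,\qquad Y=\{y:|y|\le\|\partial v\|+\|\partial_xH\|\max_i|t_i-s|\}.$$ 3) For $H^0,H^1\in C_c^2([0,T]\times T^*\mathbb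 R^d)$ and $0\le s<t\le T$, $$\sup_{x\in\mathbb R^d}|R_{H^0}^{s,t}v(x)-R_{H^1}^{s,t}v(x)|\le|t-s|\,\max_{\tau\in[s,t],\ x\in\mathbb R^d,\ y\in Y'}|(H^0-H^1)(\tau,x,y)|,$$ where $Y'=\{y:|y|\le\|\partial v\|+\max_i\|\partial_xH^i\|\,|t-s|\}$. 4) For every compact $K\subset\mathbb R^d$ and all $L_0,L_1\ge0$ there is a bounded set $\tilde K\subset\mathbb R^d$, depending only on $H$, $T$, $K$, $L_0$, $L_1$, such that for all $v^0,v^1\in C^{\mathrm{Lip}}(\mathbb R^d)$ with $\|\partial v^0\|=L_0$, $\|\partial v^1\|=L_1$ and all $0\le s<t\le T$, $$|R_H^{s,t}v^0-R_H^{s,t}v^1|_K\le|v^0-v^1|_{\tilde K}.$$ -/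

import Mathlib

open Set Filter Topology MeasureTheory
open scoped NNReal RealInnerProductSpace

namespace HamiltonJacobi

noncomputable section

/-! ### Norms and Lipschitz constants -/

/-- The sup norm of `f` on the set `A`: the supremum of `‖f a‖` over `a ∈ A`. -/
def supNorm {α F : Type*} [Norm F] (A : Set α) (f : α → F) : ℝ :=
  sSup ((fun a => ‖f a‖) '' A)

/-- `f` is globally Lipschitz. -/
def IsLip {X : Type*} [PseudoEMetricSpace X] (f : X → ℝ) : Prop :=
  ∃ C : ℝ≥0, LipschitzWith C f

/-- The Lipschitz constant of a globally Lipschitz function: the least admissible constant. -/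
def lipConst {X : Type*} [PseudoEMetricSpace X] (f : X → ℝ) : ℝ≥0 :=
  sInf {C : ℝ≥0 | LipschitzWith C f}

/-! ### Relative singular homology with coefficients in `ℤ/2` -/

/-- Singular `n`-chains of `V` with coefficients in `ℤ/2`. -/
abbrev Chain (V : Type*) [TopologicalSpace V] (n : ℕ) : Type _ :=
  C(stdSimplex ℝ (Fin (n + 1)), V) →₀ ZMod 2

section Homology

variable {V : Type*} [TopologicalSpace V]

/-- The `i`-th face of a singular `(n+1)`-simplex. -/
def face {n : ℕ} (i : Fin (n + 2)) (σ : C(stdSimplex ℝ (Fin (n + 2)), V)) :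
    C(stdSimplex ℝ (Fin (n + 1)), V) :=
  σ.comp ⟨stdSimplex.map i.succAbove, stdSimplex.continuous_map i.succAbove⟩

/-- The boundary operator; there are no signs, as the coefficients are in `ℤ/2`. -/
def boundary (n : ℕ) : Chain V (n + 1) →ₗ[ZMod 2] Chain V n :=
  Finsupp.lsum (ZMod 2) fun σ => ∑ i : Fin (n + 2), Finsupp.lsingle (face i σ)

/-- The image `|c|` of a chain: the union of the images of its simplices. -/
def carrier {n : ℕ} (c : Chain V n) : Set V :=
  ⋃ σ ∈ c.support, range σ

/-- `c` is a relative cycle of the pair `(V, A)`: its boundary is a chain of `A`. -/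
def IsRelCycle (A : Set V) : {n : ℕ} → Chain V n → Prop
  | 0, _ => True
  | n + 1, c => carrier (boundary n c) ⊆ A

/-- `c` is a relative boundary of the pair `(V, A)`: it vanishes in `H_n(V, A; ℤ/2)`. -/
def IsRelBoundary (A : Set V) {n : ℕ} (c : Chain V n) : Prop :=
  ∃ (b : Chain V (n + 1)) (e : Chain V n), carrier e ⊆ A ∧ c = boundary n b + e

end Homology

/-! ### The minmax of a function quadratic at infinity -/

section Minmax

variable {V : Type*} [AddCommGroup V] [Module ℝ V] [TopologicalSpace V]

/-- Descending cycles of `f` at the level `-a`: relative singular cycles `σ` of the pair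
`(V, {f ≤ -a})`, in the degree given by the Morse index of `Q`, whose class generates the homology.
When `f` is quadratic at infinity with nondegenerate quadratic form `Q` and `a` is large, this
homology group is `ℤ/2`, so that its generator is its unique non-zero element. -/
def IsDescendingCycle (Q : QuadraticForm ℝ V) (f : V → ℝ) (a : ℝ) (σ : Chain V (sigNeg Q)) : Prop :=
  IsRelCycle {η | f η ≤ -a} σ ∧ ¬ IsRelBoundary {η | f η ≤ -a} σ

/-- The set of the numbers `max_{|σ|} f`, where `σ` is a descending cycle at the level `-a`. -/
def maxValues (Q : QuadraticForm ℝ V) (f : V → ℝ) (a : ℝ) : Set ℝ :=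
  {m | ∃ σ : Chain V (sigNeg Q), IsDescendingCycle Q f a σ ∧ IsGreatest (f '' carrier σ) m}

/-- `r` is the minmax of `f`, namely the infimum of `max_{|σ|} f` over the descending cycles `σ`
of `(V, {f ≤ -a})` for all large enough `a`. (By `IsGLB` this includes that there are descending
cycles and that the numbers `max_{|σ|} f` are bounded from below.) -/
def IsMinmax (Q : QuadraticForm ℝ V) (f : V → ℝ) (r : ℝ) : Prop :=
  ∀ᶠ a : ℝ in atTop, IsGLB (maxValues Q f a) r

end Minmax

/-! ### Hamiltonian flow -/

/-- The configuration space `ℝᵈ`. -/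
abbrev Config (d : ℕ) : Type := EuclideanSpace ℝ (Fin d)

/-- The cotangent bundle `T^*ℝᵈ = ℝᵈ × ℝᵈ` with its Euclidean norm. -/
abbrev Phase (d : ℕ) : Type := EuclideanSpace ℝ (Fin d ⊕ Fin d)

variable {d : ℕ}

/-- The point `(x, y)` of `T^*ℝᵈ`. -/
def pt (x y : Config d) : Phase d := WithLp.toLp 2 (Sum.elim x y)

/-- The component `x` of `z = (x, y)`, as a linear map. -/
def xPart : Phase d →ₗ[ℝ] Config d where
  toFun z := WithLp.toLp 2 fun i => z (Sum.inl i)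
  map_add' _ _ := rfl
  map_smul' _ _ := rfl

/-- The component `y` of `z = (x, y)`, as a linear map. -/
def yPart : Phase d →ₗ[ℝ] Config d where
  toFun z := WithLp.toLp 2 fun i => z (Sum.inr i)
  map_add' _ _ := rfl
  map_smul' _ _ := rfl

/-- `H` is of class `C²` on `[0,T] × T^*ℝᵈ` and has compact support there. (The values of `H` at
times outside `[0,T]` play no role.) -/
def IsC2c (T : ℝ) (H : ℝ → Phase d → ℝ) : Prop :=
  ContDiffOn ℝ 2 (fun q : ℝ × Phase d => H q.1 q.2) (Icc 0 T ×ˢ univ) ∧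
    HasCompactSupport (fun q : Icc (0 : ℝ) T × Phase d => H q.1 q.2)

/-- The partial gradient `∂_x H(t, x, y)`, at `z = (x, y)`. -/
def gradX (H : ℝ → Phase d → ℝ) (t : ℝ) (z : Phase d) : Config d := xPart (gradient (H t) z)

/-- The partial gradient `∂_y H(t, x, y)`, at `z = (x, y)`. -/
def gradY (H : ℝ → Phase d → ℝ) (t : ℝ) (z : Phase d) : Config d := yPart (gradient (H t) z)

/-- `‖∂_x H‖`, the supremum of `|∂_x H|` over `[0,T] × T^*ℝᵈ`. -/
def normGradX (T : ℝ) (H : ℝ → Phase d → ℝ) : ℝ :=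
  supNorm (Icc 0 T ×ˢ univ) fun q : ℝ × Phase d => gradX H q.1 q.2

/-- `c_H`, the supremum over `[0,T] × T^*ℝᵈ` of the operator norm of the Hessian of `H_t`. -/
def hessBound (T : ℝ) (H : ℝ → Phase d → ℝ) : ℝ :=
  supNorm (Icc 0 T ×ˢ univ) fun q : ℝ × Phase d => fderiv ℝ (gradient (H q.1)) q.2

/-- The Hamiltonian vector field `X_{H_t} = (∂_y H, -∂_x H)`. -/
def hamField (H : ℝ → Phase d → ℝ) (t : ℝ) (z : Phase d) : Phase d :=
  pt (gradY H t z) (-gradX H t z)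

/-- `γ` is an integral curve of the Hamiltonian vector field on `[0,T]`. -/
def IsTrajectory (T : ℝ) (H : ℝ → Phase d → ℝ) (γ : ℝ → Phase d) : Prop :=
  ∀ τ ∈ Icc 0 T, HasDerivWithinAt γ (hamField H τ (γ τ)) (Icc (0 : ℝ) T) τ

/-- The Hamiltonian flow `φ_s^τ(z)`: the value at time `τ ∈ [0,T]` of the integral curve which is
at `z` at time `s ∈ [0,T]`. -/
def hamFlow (T : ℝ) (H : ℝ → Phase d → ℝ) (s τ : ℝ) (z : Phase d) : Phase d :=
  Classical.epsilon (fun γ : ℝ → Phase d => IsTrajectory T H γ ∧ γ s = z) τ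

/-! ### Generating functions and generating families -/

/-- The map `α_s^t : (x, y) ↦ (X_s^t(x, y), y)`, where `φ_s^t = (X_s^t, Y_s^t)`. -/
def alphaMap (T : ℝ) (H : ℝ → Phase d → ℝ) (s t : ℝ) (z : Phase d) : Phase d :=
  pt (xPart (hamFlow T H s t z)) (yPart z)

/-- The curve `τ ↦ φ_s^τ ((α_s^t)⁻¹ (X, y))`. -/
def genCurve (T : ℝ) (H : ℝ → Phase d → ℝ) (s t : ℝ) (X y : Config d) (τ : ℝ) : Phase d :=
  hamFlow T H s τ (Function.invFun (alphaMap T H s t) (pt X y))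

/-- The generating function
`φ_s^t(X, y) = ∫_s^t ((Y_s^τ - y) · Ẋ_s^τ - H(τ, X_s^τ, Y_s^τ)) dτ` of the flow `φ_s^t`,
evaluated along the curve above, whose velocity `Ẋ_s^τ` is the first component of the Hamiltonian
vector field. -/
def genFun (T : ℝ) (H : ℝ → Phase d → ℝ) (s t : ℝ) (X y : Config d) : ℝ :=
  ∫ τ in s..t,
    (⟪yPart (genCurve T H s t X y τ) - y, xPart (hamField H τ (genCurve T H s t X y τ))⟫
      - H τ (genCurve T H s t X y τ))

/-- The subdivisions `s = t_0 < t_1 < ⋯ < t_N = t` whose steps are all less than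
`δ_H = c_H⁻¹ log 2` (this being `+∞` when `c_H = 0`). -/
structure IsAdmissible (T : ℝ) (H : ℝ → Phase d → ℝ) (s t : ℝ) {N : ℕ} (p : Fin (N + 1) → ℝ) :
    Prop where
  strictMono : StrictMono p
  first : p 0 = s
  last : p (Fin.last N) = t
  step : ∀ i : Fin N, hessBound T H * (p i.succ - p i.castSucc) < Real.log 2

/-- The fibre `(T^*ℝᵈ)^N` of the generating family, with points `η = (x_i, y_i)_{0 ≤ i < N}`. -/
abbrev Fibre (d N : ℕ) : Type := Fin N → Phase d

/-- The points `x_0, …, x_{N-1}` of `η = (x_i, y_i)`, followed by `x_N := x`. -/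
def node {N : ℕ} (x : Config d) (η : Fibre d N) : Fin (N + 1) → Config d :=
  Fin.snoc (α := fun _ => Config d) (fun i => xPart (η i)) x

/-- The generating family
`S(x; η) = v(x_0) + ∑_{i<N} φ_{t_i}^{t_{i+1}}(x_{i+1}, y_i) + ∑_{i<N} (x_{i+1} - x_i) · y_i`,
with `x_N := x`, associated to the subdivision `p = (t_0, …, t_N)`. -/
def genFamily (T : ℝ) (H : ℝ → Phase d → ℝ) {N : ℕ} (p : Fin (N + 1) → ℝ) (v : Config d → ℝ)
    (x : Config d) (η : Fibre d N) : ℝ :=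
  v (node x η 0)
    + ∑ i : Fin N, genFun T H (p i.castSucc) (p i.succ) (node x η i.succ) (yPart (η i))
    + ∑ i : Fin N, ⟪node x η i.succ - node x η i.castSucc, yPart (η i)⟫

/-- The linear maps `η ↦ x_0, …, η ↦ x_{N-1}`, followed by `0`. -/
def nodeLin (d N : ℕ) : Fin (N + 1) → (Fibre d N →ₗ[ℝ] Config d) :=
  Fin.snoc (α := fun _ => Fibre d N →ₗ[ℝ] Config d)
    (fun i => xPart.comp (LinearMap.proj i)) 0

/-- The quadratic form `Q(η) = -x_{N-1} · y_{N-1} + ∑_{0 ≤ i < N-1} (x_{i+1} - x_i) · y_i`, that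
is, `∑_{i<N} (x_{i+1} - x_i) · y_i` with `x_N := 0`. -/
def quadForm (d N : ℕ) : QuadraticForm ℝ (Fibre d N) :=
  ∑ i : Fin N, LinearMap.BilinMap.toQuadraticMap
    ((innerₗ (Config d)).compl₁₂ (nodeLin d N i.succ - nodeLin d N i.castSucc)
      (yPart.comp (LinearMap.proj i)))

lemma nodeLin_apply {N : ℕ} (j : Fin (N + 1)) (η : Fibre d N) :
    nodeLin d N j η = node 0 η j := by
  refine Fin.lastCases ?_ (fun i => ?_) j
  · simp [nodeLin, node]
  · simp [nodeLin, node]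

lemma quadForm_apply {N : ℕ} (η : Fibre d N) :
    quadForm d N η = ∑ i : Fin N, ⟪node 0 η i.succ - node 0 η i.castSucc, yPart (η i)⟫ := by
  simp [quadForm, nodeLin_apply, inner_sub_left]

/-! ### The minmax operator -/

/-- `r` is the minmax of the generating family `S(x; ·)` for every admissible subdivision
of `[s,t]`. -/
def IsMinmaxValue (T : ℝ) (H : ℝ → Phase d → ℝ) (s t : ℝ) (v : Config d → ℝ) (x : Config d)
    (r : ℝ) : Prop :=
  ∀ (N : ℕ) (p : Fin (N + 1) → ℝ), IsAdmissible T H s t p →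
    IsMinmax (quadForm d N) (genFamily T H p v x) r

/-- The minmax operator `R_H^{s,t}`: `R_H^{s,t} v(x)` is the common value, over the admissible
subdivisions of `[s,t]`, of the minmax of the generating family `S(x; ·)`. -/
def minmaxOp (T : ℝ) (H : ℝ → Phase d → ℝ) (s t : ℝ) (v : Config d → ℝ) (x : Config d) : ℝ :=
  Classical.epsilon (IsMinmaxValue T H s t v x)

end

end HamiltonJacobi

open HamiltonJacobi

/-! The minmax is treated as a linking invariant. In suitable linear coordinates `Q` is `|w|² -
|u|²` on `ℝᵏ × ℝᵏ`. For `a` large, a relative cycle of `{f ≤ -a}` is trivial exactly when it is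
trivial modulo the complement of `{u = 0}` (`QuadLip.trivial_sublevel_iff`), a set that knows
neither `f` nor `a`. So non-trivial cycles must meet `{u = 0}`, where `f` is bounded below, and the
infimum is finite and independent of `a`. Non-trivial cycles are produced by suspending a point
(`exists_isLinking`); the homology group itself is never computed.

Two minmax values are compared by deforming cycles: if a deformation makes `f₁` at most `f₂ + δ` on
a given compact set, and at each stage either does not increase `f₁` or moves points by a bounded
amount, then the values satisfy `r₁ ≤ r₂ + δ` (`isMinmax_le_add`). Translating all the nodes bounds
the dependence on `x`. Moving the nodes so as to exploit large momenta shows that only momenta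
within `‖∂v‖ + ‖∂_xH‖ |t - s|` matter, up to any `ε` (`isMinmax_le_add_of_momenta`). Moving the
momenta shows that only bounded displacements of the nodes matter (`isMinmax_le_add_of_nodes`),
which localizes the dependence on `v`.

The minmax need not be differentiable in parameters, so sharp constants come from paths: a one-step
estimate with quadratic remainder sums to its linear part (`abs_sub_le_of_forall_local`). The
quadratic remainders rest on the expansion `dφ = (Y - y)·dX + (x_s - X)·dy - H_t dt + H_s ds` of the
generating function, obtained from Grönwall estimates (`Tame.exists_genFun_expansion`).

Independence of the subdivision has two ingredients. A step of length zero adds a nondegenerate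
pairing in new variables, and such a stabilization preserves the minmax (`IsModelMinmax.stab`), by
suspension in one direction and by slicing in the other. Between subdivisions with equally many
points, moving the points by `β` changes the minmax by `O(β²)` (`Tame.exists_subdivision_estimate`),
hence not at all. -/

namespace HamiltonJacobi

/-! ### Homology mod 2, algebraic part: cones and iterated subdivision. -/

noncomputable section

/-! ### Formal chains of tuples of points -/

/-- Formal chains of `m`-tuples of points of `K`, with coefficients in `ℤ/2`. -/
abbrev TupleChain (K : Type*) (m : ℕ) : Type _ := (Fin m → K) →₀ ZMod 2

namespace TupleChain

variable {K L : Type*}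

/-- The boundary of formal chains. -/
def bd {m : ℕ} : TupleChain K (m + 1) →ₗ[ZMod 2] TupleChain K m :=
  Finsupp.linearCombination (ZMod 2) fun w => ∑ i : Fin (m + 1), Finsupp.single (w ∘ i.succAbove) 1

/-- The cone with apex `b`. -/
def cone {m : ℕ} (b : K) : TupleChain K m →ₗ[ZMod 2] TupleChain K (m + 1) :=
  Finsupp.linearCombination (ZMod 2) fun w => Finsupp.single (Fin.cons b w : Fin (m + 1) → K) 1

/-- The direct image of formal chains. -/
def push {m : ℕ} (g : K → L) : TupleChain K m →ₗ[ZMod 2] TupleChain L m :=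
  Finsupp.linearCombination (ZMod 2) fun w => Finsupp.single (g ∘ w) 1

@[simp] lemma bd_single {m : ℕ} (w : Fin (m + 1) → K) :
    bd (Finsupp.single w (1 : ZMod 2)) = ∑ i : Fin (m + 1), Finsupp.single (w ∘ i.succAbove) 1 := by
  simp [bd]

@[simp] lemma cone_single {m : ℕ} (b : K) (w : Fin m → K) :
    cone b (Finsupp.single w (1 : ZMod 2)) = Finsupp.single (Fin.cons b w : Fin (m + 1) → K) 1 := by
  simp [cone]

@[simp] lemma push_single {m : ℕ} (g : K → L) (w : Fin m → K) :
    push g (Finsupp.single w (1 : ZMod 2)) = Finsupp.single (g ∘ w) 1 := by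
  simp [push]

lemma hom_ext {α M : Type*} [AddCommMonoid M] [Module (ZMod 2) M] {f g : (α →₀ ZMod 2) →ₗ[ZMod 2] M}
    (h : ∀ a, f (Finsupp.single a 1) = g (Finsupp.single a 1)) : f = g :=
  Finsupp.lhom_ext' fun a => LinearMap.ext_ring (h a)

lemma bd_push {m : ℕ} (g : K → L) (c : TupleChain K (m + 1)) : bd (push g c) = push g (bd c) := by
  have : bd ∘ₗ push (m := m + 1) g = push g ∘ₗ bd := by
    refine hom_ext fun w => ?_
    simp [Function.comp_assoc]
  exact LinearMap.congr_fun this c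

lemma push_cone {m : ℕ} (g : K → L) (b : K) (c : TupleChain K m) :
    push g (cone b c) = cone (g b) (push g c) := by
  have : push g ∘ₗ cone (m := m) b = cone (g b) ∘ₗ push g := by
    refine hom_ext fun w => ?_
    simp only [LinearMap.comp_apply, cone_single, push_single]
    congr 1
    funext i
    refine Fin.cases ?_ (fun j => ?_) i <;> simp
  exact LinearMap.congr_fun this c

lemma cons_comp_succAbove_succ {m : ℕ} (b : K) (w : Fin (m + 1) → K) (i : Fin (m + 1)) :
    (Fin.cons b w : Fin (m + 2) → K) ∘ i.succ.succAbove
      = (Fin.cons b (w ∘ i.succAbove) : Fin (m + 1) → K) := by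
  funext j
  refine Fin.cases ?_ (fun j => ?_) j <;> simp

lemma cons_comp_succAbove_zero {m : ℕ} (b : K) (w : Fin m → K) :
    (Fin.cons b w : Fin (m + 1) → K) ∘ (0 : Fin (m + 1)).succAbove = w := by
  funext j
  simp

/-- The face opposite to the apex returns `c`; the other faces are cones over the faces of `c`.
There are no signs mod 2. -/
lemma bd_cone {m : ℕ} (b : K) (c : TupleChain K (m + 1)) :
    bd (cone b c) = c + cone b (bd c) := by
  have : bd ∘ₗ cone (m := m + 1) b = LinearMap.id + cone b ∘ₗ bd := by
    refine hom_ext fun w => ?_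
    simp only [LinearMap.comp_apply, LinearMap.add_apply, LinearMap.id_apply, cone_single,
      bd_single, map_sum]
    rw [Fin.sum_univ_succ, cons_comp_succAbove_zero]
    simp only [cons_comp_succAbove_succ]
  exact LinearMap.congr_fun this c

/-- The empty tuple is kept, so the complex is augmented; nothing lies below it, hence no second
term. -/
lemma bd_cone_zero (b : K) (c : TupleChain K 0) : bd (cone b c) = c := by
  have : bd ∘ₗ cone (m := 0) b = LinearMap.id := by
    refine hom_ext fun w => ?_
    simp only [LinearMap.comp_apply, LinearMap.id_apply, cone_single, bd_single]
    rw [Fin.sum_univ_succ, cons_comp_succAbove_zero]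
    simp
  exact LinearMap.congr_fun this c

/-- Every tuple is the cone over its tail with apex its first entry, so the cone formula leaves two
equal terms, which cancel. -/
lemma bd_bd {m : ℕ} (c : TupleChain K (m + 2)) : bd (bd c) = 0 := by
  induction m with
  | zero =>
    have : bd ∘ₗ bd = (0 : TupleChain K 2 →ₗ[ZMod 2] _) := by
      refine hom_ext fun w => ?_
      have hw : Finsupp.single w (1 : ZMod 2) = cone (w 0) (Finsupp.single (Fin.tail w) 1) := by
        rw [cone_single, Fin.cons_self_tail]
      rw [hw, LinearMap.comp_apply, bd_cone, map_add, bd_cone_zero, ZModModule.add_self]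
      rfl
    exact LinearMap.congr_fun this c
  | succ m ih =>
    have : bd ∘ₗ bd = (0 : TupleChain K (m + 1 + 2) →ₗ[ZMod 2] _) := by
      refine hom_ext fun w => ?_
      have hw : Finsupp.single w (1 : ZMod 2) = cone (w 0) (Finsupp.single (Fin.tail w) 1) := by
        rw [cone_single, Fin.cons_self_tail]
      rw [hw, LinearMap.comp_apply, bd_cone, map_add, bd_cone, ih, map_zero, add_zero,
        ZModModule.add_self]
      rfl
    exact LinearMap.congr_fun this c

variable (β : ∀ m, (Fin (m + 1) → K) → K) (β' : ∀ m, (Fin (m + 1) → L) → L)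

/-- Subdivision by repeated cones with apex `β w`. -/
def sd : ∀ m, TupleChain K m →ₗ[ZMod 2] TupleChain K m
  | 0 => LinearMap.id
  | m + 1 => Finsupp.linearCombination (ZMod 2) fun w =>
      cone (β m w) (sd m (bd (Finsupp.single w 1)))

/-- The chain homotopy between the identity, at level `false`, and the subdivision, at
level `true`. -/
def sdHom : ∀ m, TupleChain K m →ₗ[ZMod 2] TupleChain (K × Bool) (m + 1)
  | 0 => 0
  | m + 1 => Finsupp.linearCombination (ZMod 2) fun w =>
      cone (β m w, true) (push (fun x => (x, false)) (Finsupp.single w 1)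
        + sdHom m (bd (Finsupp.single w 1)))

lemma sd_single {m : ℕ} (w : Fin (m + 1) → K) :
    sd β (m + 1) (Finsupp.single w 1) = cone (β m w) (sd β m (bd (Finsupp.single w 1))) := by
  simp [sd]

lemma sdHom_single {m : ℕ} (w : Fin (m + 1) → K) :
    sdHom β (m + 1) (Finsupp.single w 1) =
      cone (β m w, true) (push (fun x => (x, false)) (Finsupp.single w 1)
        + sdHom β m (bd (Finsupp.single w 1))) := by
  simp [sdHom]

lemma bd_sd {m : ℕ} (c : TupleChain K (m + 1)) : bd (sd β (m + 1) c) = sd β m (bd c) := by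
  induction m with
  | zero =>
    have : bd ∘ₗ sd β (0 + 1) = sd β 0 ∘ₗ bd := by
      refine hom_ext fun w => ?_
      rw [LinearMap.comp_apply, sd_single, bd_cone_zero]; rfl
    exact LinearMap.congr_fun this c
  | succ m ih =>
    have : bd ∘ₗ sd β (m + 1 + 1) = sd β (m + 1) ∘ₗ bd := by
      refine hom_ext fun w => ?_
      rw [LinearMap.comp_apply, sd_single, bd_cone, ih, bd_bd, map_zero, map_zero, add_zero]; rfl
    exact LinearMap.congr_fun this c

lemma bd_sdHom_zero (c : TupleChain K 0) : bd (sdHom β 0 c) = 0 := by simp [sdHom]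

/-- The empty tuple has no vertex to carry a level. This starts the induction in `bd_sdHom`. -/
lemma push_false_eq_push_true (c : TupleChain K 0) :
    push (fun x => (x, false)) c = push (fun x => (x, true)) c := by
  have : push (m := 0) (fun x : K => (x, false)) = push (fun x => (x, true)) :=
    hom_ext fun w => by
      simp only [push_single]
      congr 1
      exact Subsingleton.elim _ _
  exact LinearMap.congr_fun this c

lemma bd_sdHom {m : ℕ} (c : TupleChain K (m + 1)) :
    bd (sdHom β (m + 1) c) = push (fun x => (x, false)) c
      + push (fun x => (x, true)) (sd β (m + 1) c) + sdHom β m (bd c) := by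
  -- If the chain to be coned off in `sdHom` has the subdivided boundary at level `true` as its
  -- boundary, the cone formula gives the homotopy relation.
  have key : ∀ (m : ℕ) (w : Fin (m + 1) → K)
      (_ : bd (push (fun x => (x, false)) (Finsupp.single w 1)
        + sdHom β m (bd (Finsupp.single w 1)))
        = push (fun x => (x, true)) (sd β m (bd (Finsupp.single w (1 : ZMod 2))))),
      bd (sdHom β (m + 1) (Finsupp.single w 1)) = push (fun x => (x, false)) (Finsupp.single w 1)
        + push (fun x => (x, true)) (sd β (m + 1) (Finsupp.single w 1))
        + sdHom β m (bd (Finsupp.single w 1)) := by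
    intro m w h
    rw [sdHom_single, bd_cone, h, sd_single, push_cone]
    abel
  induction m with
  | zero =>
    have : bd ∘ₗ sdHom β (0 + 1) = push (fun x => (x, false))
        + push (fun x => (x, true)) ∘ₗ sd β (0 + 1) + sdHom β 0 ∘ₗ bd := by
      refine hom_ext fun w => ?_
      refine key 0 w ?_
      rw [map_add, bd_sdHom_zero, add_zero, bd_push, push_false_eq_push_true]; rfl
    exact LinearMap.congr_fun this c
  | succ m ih =>
    have : bd ∘ₗ sdHom β (m + 1 + 1) = push (fun x => (x, false))
        + push (fun x => (x, true)) ∘ₗ sd β (m + 1 + 1) + sdHom β (m + 1) ∘ₗ bd := by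
      refine hom_ext fun w => ?_
      refine key (m + 1) w ?_
      rw [map_add, ih, bd_bd, map_zero, add_zero, bd_push, ← add_assoc, ZModModule.add_self,
        zero_add]
    exact LinearMap.congr_fun this c

variable {β β'}

/-- Naturality only needs a map compatible with the choice of apices; affine maps are so for
barycentres, by `aff_bary`. -/
lemma sd_push (g : K → L) (hg : ∀ m w, g (β m w) = β' m (g ∘ w)) {m : ℕ} (c : TupleChain K m) :
    sd β' m (push g c) = push g (sd β m c) := by
  induction m with
  | zero => rfl
  | succ m ih =>
    have : sd β' (m + 1) ∘ₗ push g = push g ∘ₗ sd β (m + 1) := by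
      refine hom_ext fun w => ?_
      rw [LinearMap.comp_apply, LinearMap.comp_apply, sd_single, push_cone, ← ih, ← bd_push,
        push_single, sd_single, hg]
    exact LinearMap.congr_fun this c

lemma sdHom_push (g : K → L) (hg : ∀ m w, g (β m w) = β' m (g ∘ w)) {m : ℕ} (c : TupleChain K m) :
    sdHom β' m (push g c) = push (Prod.map g id) (sdHom β m c) := by
  induction m with
  | zero => simp [sdHom]
  | succ m ih =>
    have : sdHom β' (m + 1) ∘ₗ push g = push (Prod.map g id) ∘ₗ sdHom β (m + 1) := by
      refine hom_ext fun w => ?_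
      rw [LinearMap.comp_apply, LinearMap.comp_apply, sdHom_single, push_cone, map_add, ← ih,
        ← bd_push, push_single, push_single, push_single, sdHom_single, push_single,
        Prod.map_apply, hg]
      rfl
    exact LinearMap.congr_fun this c

end TupleChain

end

end HamiltonJacobi

/-! ### Singular chains: homotopies and subdivision, with control of the carriers. -/

namespace HamiltonJacobi

noncomputable section

/-! ### Affine simplices in a standard simplex -/

/-- The affine map between standard simplices with prescribed vertices. -/
def aff {m n : ℕ} (w : Fin m → stdSimplex ℝ (Fin n)) :
    C(stdSimplex ℝ (Fin m), stdSimplex ℝ (Fin n)) where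
  toFun t := ⟨fun j => ∑ i, t i * w i j, fun j => Finset.sum_nonneg fun i _ =>
      mul_nonneg (stdSimplex.zero_le t i) (stdSimplex.zero_le (w i) j), by
    rw [Finset.sum_comm]
    simp [← Finset.mul_sum]⟩
  continuous_toFun := by
    refine Continuous.subtype_mk (continuous_pi fun j => continuous_finsetSum _ fun i _ => ?_) _
    exact ((continuous_apply i).comp continuous_subtype_val).mul continuous_const

lemma aff_apply {m n : ℕ} (w : Fin m → stdSimplex ℝ (Fin n)) (t : stdSimplex ℝ (Fin m))
    (j : Fin n) : aff w t j = ∑ i, t i * w i j := rfl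

/-- The list of vertices of the standard simplex. -/
def vert (n : ℕ) (i : Fin n) : stdSimplex ℝ (Fin n) := stdSimplex.vertex i

lemma vert_apply (n : ℕ) (i j : Fin n) : vert n i j = if j = i then 1 else 0 := by
  simp [vert, Pi.single_apply]

lemma aff_vert {m n : ℕ} (w : Fin m → stdSimplex ℝ (Fin n)) (i : Fin m) :
    aff w (vert m i) = w i := by
  ext j
  simp [aff_apply, vert_apply]

lemma aff_vert_comp {m n : ℕ} (w : Fin m → stdSimplex ℝ (Fin n)) : aff w ∘ vert m = w :=
  funext (aff_vert w)

lemma aff_id (n : ℕ) : aff (vert n) = ContinuousMap.id _ := by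
  ext t j
  simp [aff_apply, vert_apply]

lemma aff_aff {l m n : ℕ} (w : Fin m → stdSimplex ℝ (Fin n)) (u : Fin l → stdSimplex ℝ (Fin m))
    (t : stdSimplex ℝ (Fin l)) : aff w (aff u t) = aff (aff w ∘ u) t := by
  ext j
  simp only [aff_apply, Function.comp, Finset.sum_mul, Finset.mul_sum]
  rw [Finset.sum_comm]
  simp only [mul_assoc]

lemma map_apply_eq {m n : ℕ} (f : Fin m → Fin n) (t : stdSimplex ℝ (Fin m)) :
    stdSimplex.map f t = aff (vert n ∘ f) t := by
  ext j
  simp only [stdSimplex.map_coe, FunOnFinite.linearMap_apply_apply, aff_apply, Function.comp,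
    vert_apply, mul_ite, mul_one, mul_zero, Finset.sum_ite, Finset.sum_const_zero, add_zero]
  refine Finset.sum_congr ?_ fun _ _ => rfl
  ext i
  simp [eq_comm]

/-- The barycentre of a tuple of points. -/
def bary {n : ℕ} (m : ℕ) (w : Fin (m + 1) → stdSimplex ℝ (Fin n)) : stdSimplex ℝ (Fin n) :=
  aff w stdSimplex.barycenter

lemma aff_bary {k n : ℕ} (u : Fin n → stdSimplex ℝ (Fin k)) (m : ℕ)
    (w : Fin (m + 1) → stdSimplex ℝ (Fin n)) : aff u (bary m w) = bary m (aff u ∘ w) :=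
  aff_aff _ _ _

/-- The level in `[0,1]` at the parameter `t`, of the affine function with values `0` and `1`
at the vertices. -/
def level {m : ℕ} (b : Fin m → Bool) : C(stdSimplex ℝ (Fin m), ℝ) where
  toFun t := ∑ i, t i * (if b i then 1 else 0)
  continuous_toFun := continuous_finsetSum _ fun i _ =>
    ((continuous_apply i).comp continuous_subtype_val).mul continuous_const

lemma level_apply {m : ℕ} (b : Fin m → Bool) (t : stdSimplex ℝ (Fin m)) :
    level b t = ∑ i, t i * (if b i then 1 else 0) := rfl

lemma level_mem {m : ℕ} (b : Fin m → Bool) (t : stdSimplex ℝ (Fin m)) :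
    level b t ∈ Icc (0 : ℝ) 1 := by
  rw [level_apply]
  constructor
  · exact Finset.sum_nonneg fun i _ => mul_nonneg (stdSimplex.zero_le t i) (by split_ifs <;> simp)
  · refine le_trans (Finset.sum_le_sum (g := t) fun i _ => ?_) (stdSimplex.sum_eq_one t).le
    have := stdSimplex.zero_le t i
    split_ifs <;> simp [this]

lemma level_false {m : ℕ} (t : stdSimplex ℝ (Fin m)) : level (fun _ => false) t = 0 := by
  simp [level_apply]

lemma level_true {m : ℕ} (t : stdSimplex ℝ (Fin m)) : level (fun _ => true) t = 1 := by
  simp [level_apply]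

lemma level_map {m n : ℕ} (b : Fin n → Bool) (f : Fin m → Fin n) (t : stdSimplex ℝ (Fin m)) :
    level b (stdSimplex.map f t) = level (b ∘ f) t := by
  rw [map_apply_eq]
  simp only [level_apply, aff_apply, Finset.sum_mul, Function.comp]
  rw [Finset.sum_comm]
  refine Finset.sum_congr rfl fun i _ => ?_
  rw [Finset.sum_eq_single (f i)]
  · simp [vert_apply]
  · intro j _ hj
    simp [vert_apply, hj]
  · simp

/-! ### Singular chains indexed by the number of vertices -/

/-- Augmented singular chains: `SChain V n` consists of the chains of simplices with `n` vertices,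
so that `SChain V (n + 1) = Chain V n`. -/
abbrev SChain (V : Type*) [TopologicalSpace V] (n : ℕ) : Type _ :=
  C(stdSimplex ℝ (Fin n), V) →₀ ZMod 2

namespace SChain

variable {X Y Z : Type*} [TopologicalSpace X] [TopologicalSpace Y] [TopologicalSpace Z]

/-- A face of a singular simplex. -/
def faceMap {n : ℕ} (i : Fin (n + 1)) (σ : C(stdSimplex ℝ (Fin (n + 1)), X)) :
    C(stdSimplex ℝ (Fin n), X) :=
  σ.comp ⟨stdSimplex.map i.succAbove, stdSimplex.continuous_map i.succAbove⟩

lemma faceMap_eq {n : ℕ} (i : Fin (n + 1)) (σ : C(stdSimplex ℝ (Fin (n + 1)), X)) :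
    faceMap i σ = σ.comp (aff (vert (n + 1) ∘ i.succAbove)) := by
  ext t
  simp [faceMap, map_apply_eq]

/-- The augmented boundary operator. -/
def bd {n : ℕ} : SChain X (n + 1) →ₗ[ZMod 2] SChain X n :=
  Finsupp.linearCombination (ZMod 2) fun σ => ∑ i : Fin (n + 1), Finsupp.single (faceMap i σ) 1

lemma bd_single {n : ℕ} (σ : C(stdSimplex ℝ (Fin (n + 1)), X)) :
    bd (Finsupp.single σ (1 : ZMod 2)) = ∑ i : Fin (n + 1), Finsupp.single (faceMap i σ) 1 := by
  simp [bd]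

lemma boundary_eq_bd (n : ℕ) (c : Chain X (n + 1)) : boundary n c = bd (n := n + 1) c := by
  have : boundary n = bd (X := X) (n := n + 1) := by
    refine TupleChain.hom_ext fun σ => ?_
    rw [bd_single]
    simp [boundary]
    rfl
  exact LinearMap.congr_fun this c

/-- The direct image of singular chains. -/
def push {n : ℕ} (f : C(X, Y)) : SChain X n →ₗ[ZMod 2] SChain Y n :=
  Finsupp.linearCombination (ZMod 2) fun σ => Finsupp.single (f.comp σ) 1

lemma push_single {n : ℕ} (f : C(X, Y)) (σ : C(stdSimplex ℝ (Fin n), X)) :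
    push f (Finsupp.single σ (1 : ZMod 2)) = Finsupp.single (f.comp σ) 1 := by
  simp [push]

lemma bd_push {n : ℕ} (f : C(X, Y)) (c : SChain X (n + 1)) : bd (push f c) = push f (bd c) := by
  have : bd ∘ₗ push (n := n + 1) f = push f ∘ₗ bd := by
    refine TupleChain.hom_ext fun w => ?_
    simp [push_single, bd_single, faceMap, ContinuousMap.comp_assoc]
  exact LinearMap.congr_fun this c

lemma push_push {n : ℕ} (g : C(Y, Z)) (f : C(X, Y)) (c : SChain X n) :
    push g (push f c) = push (g.comp f) c := by
  have : push (n := n) g ∘ₗ push f = push (g.comp f) := by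
    refine TupleChain.hom_ext fun w => ?_
    simp [push_single, ContinuousMap.comp_assoc]
  exact LinearMap.congr_fun this c

lemma push_id {n : ℕ} (c : SChain X n) : push (ContinuousMap.id X) c = c := by
  have : push (n := n) (ContinuousMap.id X) = LinearMap.id := by
    refine TupleChain.hom_ext fun w => ?_
    simp [push_single]
  exact LinearMap.congr_fun this c

/-! ### Carriers -/

/-- The image of a chain. -/
def carr {n : ℕ} (c : SChain X n) : Set X := ⋃ σ ∈ c.support, range σ

lemma mem_carr {n : ℕ} {c : SChain X n} {x : X} : x ∈ carr c ↔ ∃ σ ∈ c.support, x ∈ range σ := by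
  simp [carr]

lemma range_subset_carr {n : ℕ} {c : SChain X n} {σ : C(stdSimplex ℝ (Fin n), X)}
    (h : σ ∈ c.support) : range σ ⊆ carr c := fun _ hx => mem_carr.2 ⟨σ, h, hx⟩

lemma carr_subset_iff {n : ℕ} {c : SChain X n} {A : Set X} :
    carr c ⊆ A ↔ ∀ σ ∈ c.support, range σ ⊆ A := by
  simp [carr]

@[simp] lemma carr_zero {n : ℕ} : carr (0 : SChain X n) = ∅ := by simp [carr]

lemma carr_single {n : ℕ} (σ : C(stdSimplex ℝ (Fin n), X)) :
    carr (Finsupp.single σ (1 : ZMod 2)) = range σ := by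
  simp [carr]

lemma carr_add {n : ℕ} (c c' : SChain X n) : carr (c + c') ⊆ carr c ∪ carr c' := by
  classical
  refine carr_subset_iff.2 fun σ hσ => ?_
  rcases Finset.mem_union.1 (Finsupp.support_add hσ) with h | h
  · exact (range_subset_carr h).trans subset_union_left
  · exact (range_subset_carr h).trans subset_union_right

lemma carr_add_subset {n : ℕ} {c c' : SChain X n} {A : Set X} (h : carr c ⊆ A) (h' : carr c' ⊆ A) :
    carr (c + c') ⊆ A := (carr_add c c').trans (union_subset h h')

lemma isCompact_carr {n : ℕ} (c : SChain X n) : IsCompact (carr c) :=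
  c.support.finite_toSet.isCompact_biUnion fun σ _ => isCompact_range σ.continuous

lemma support_linearCombination {α β : Type*} (F : α → β →₀ ZMod 2) (c : α →₀ ZMod 2) {σ : β}
    (h : σ ∈ (Finsupp.linearCombination (ZMod 2) F c).support) :
    ∃ a ∈ c.support, σ ∈ (F a).support := by
  classical
  rw [Finsupp.linearCombination_apply] at h
  obtain ⟨a, ha, h⟩ := Finset.mem_biUnion.1 (Finsupp.support_finsetSum h)
  exact ⟨a, ha, Finsupp.support_smul h⟩

lemma carr_linearCombination {α : Type*} {n : ℕ} {F : α → SChain X n} {c : α →₀ ZMod 2}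
    {A : Set X} (h : ∀ a ∈ c.support, carr (F a) ⊆ A) :
    carr (Finsupp.linearCombination (ZMod 2) F c) ⊆ A := by
  refine carr_subset_iff.2 fun σ hσ => ?_
  obtain ⟨a, ha, h'⟩ := support_linearCombination F c hσ
  exact (range_subset_carr h').trans (h a ha)

lemma carr_bd {n : ℕ} (c : SChain X (n + 1)) : carr (bd c) ⊆ carr c := by
  refine carr_linearCombination fun σ hσ => ?_
  refine Subset.trans ?_ (range_subset_carr hσ)
  refine carr_subset_iff.2 fun τ hτ => ?_
  classical
  obtain ⟨i, -, h⟩ := Finset.mem_biUnion.1 (Finsupp.support_finsetSum hτ)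
  rw [Finsupp.support_single _ one_ne_zero, Finset.mem_singleton] at h
  subst h
  rw [faceMap, ContinuousMap.coe_comp]
  exact range_comp_subset_range _ _

lemma carr_push {n : ℕ} (f : C(X, Y)) (c : SChain X n) : carr (push f c) ⊆ f '' carr c := by
  refine carr_linearCombination fun σ hσ => ?_
  rw [carr_single, ContinuousMap.coe_comp, range_comp]
  exact image_mono (range_subset_carr hσ)

lemma carr_push_subset {n : ℕ} {f : C(X, Y)} {c : SChain X n} {A : Set Y}
    (h : ∀ x ∈ carr c, f x ∈ A) : carr (push f c) ⊆ A :=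
  (carr_push f c).trans (image_subset_iff.2 h)

lemma carr_eq_empty_of_zero (c : SChain X 0) : carr c = ∅ := by
  refine eq_empty_of_subset_empty (carr_subset_iff.2 fun σ _ => ?_)
  rintro _ ⟨t, -⟩
  exact absurd (stdSimplex.sum_eq_one t) (by simp)

/-! ### Subdivision and homotopies -/

lemma prodMk_apply (f : C(X, Y)) (g : C(X, Z)) (x : X) : f.prodMk g x = (f x, g x) := rfl

/-- The singular chain in `X` given by a simplex of `X` and a formal chain of its points. -/
def sub {n m : ℕ} (σ : C(stdSimplex ℝ (Fin n), X)) :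
    TupleChain (stdSimplex ℝ (Fin n)) m →ₗ[ZMod 2] SChain X m :=
  Finsupp.linearCombination (ZMod 2) fun w => Finsupp.single (σ.comp (aff w)) 1

/-- The singular chain in `Y` given by a simplex of `X`, a homotopy of maps from `X` to `Y`, and
a formal chain of the prism over the simplex. -/
def subHom {n m : ℕ} (h : C(X × ℝ, Y)) (σ : C(stdSimplex ℝ (Fin n), X)) :
    TupleChain (stdSimplex ℝ (Fin n) × Bool) m →ₗ[ZMod 2] SChain Y m :=
  Finsupp.linearCombination (ZMod 2) fun w =>
    Finsupp.single (h.comp ((σ.comp (aff (Prod.fst ∘ w))).prodMk (level (Prod.snd ∘ w)))) 1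

lemma sub_single {n m : ℕ} (σ : C(stdSimplex ℝ (Fin n), X)) (w : Fin m → stdSimplex ℝ (Fin n)) :
    sub σ (Finsupp.single w (1 : ZMod 2)) = Finsupp.single (σ.comp (aff w)) 1 := by
  simp [sub]

lemma subHom_single {n m : ℕ} (h : C(X × ℝ, Y)) (σ : C(stdSimplex ℝ (Fin n), X))
    (w : Fin m → stdSimplex ℝ (Fin n) × Bool) :
    subHom h σ (Finsupp.single w (1 : ZMod 2)) =
      Finsupp.single (h.comp ((σ.comp (aff (Prod.fst ∘ w))).prodMk (level (Prod.snd ∘ w)))) 1 := by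
  simp [subHom]

lemma sub_vert {n : ℕ} (σ : C(stdSimplex ℝ (Fin n), X)) :
    sub σ (Finsupp.single (vert n) (1 : ZMod 2)) = Finsupp.single σ 1 := by
  rw [sub_single, aff_id, ContinuousMap.comp_id]

lemma bd_subHom {n m : ℕ} (h : C(X × ℝ, Y)) (σ : C(stdSimplex ℝ (Fin n), X))
    (c : TupleChain (stdSimplex ℝ (Fin n) × Bool) (m + 1)) :
    bd (subHom h σ c) = subHom h σ (TupleChain.bd c) := by
  have : bd ∘ₗ subHom (m := m + 1) h σ = subHom h σ ∘ₗ TupleChain.bd := by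
    refine TupleChain.hom_ext fun w => ?_
    simp only [LinearMap.comp_apply, subHom_single, bd_single, TupleChain.bd_single, map_sum]
    refine Finset.sum_congr rfl fun i _ => ?_
    congr 1
    ext t
    simp only [faceMap, ContinuousMap.comp_apply, ContinuousMap.coe_mk, prodMk_apply,
      level_map]
    rw [map_apply_eq, aff_aff, ← Function.comp_assoc, aff_vert_comp]
    rfl
  exact LinearMap.congr_fun this c

lemma bd_sub {n m : ℕ} (σ : C(stdSimplex ℝ (Fin n), X))
    (c : TupleChain (stdSimplex ℝ (Fin n)) (m + 1)) :
    bd (sub σ c) = sub σ (TupleChain.bd c) := by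
  have : bd ∘ₗ sub (m := m + 1) σ = sub σ ∘ₗ TupleChain.bd := by
    refine TupleChain.hom_ext fun w => ?_
    simp only [LinearMap.comp_apply, sub_single, bd_single, TupleChain.bd_single, map_sum]
    refine Finset.sum_congr rfl fun i _ => ?_
    congr 1
    ext t
    simp only [faceMap, ContinuousMap.comp_apply, ContinuousMap.coe_mk]
    rw [map_apply_eq, aff_aff, ← Function.comp_assoc, aff_vert_comp]
  exact LinearMap.congr_fun this c

lemma sub_comp_aff {n m k : ℕ} (σ : C(stdSimplex ℝ (Fin n), X)) (u : Fin k → stdSimplex ℝ (Fin n))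
    (c : TupleChain (stdSimplex ℝ (Fin k)) m) :
    sub (σ.comp (aff u)) c = sub σ (TupleChain.push (aff u) c) := by
  have : sub (m := m) (σ.comp (aff u)) = sub σ ∘ₗ TupleChain.push (aff u) := by
    refine TupleChain.hom_ext fun w => ?_
    simp only [LinearMap.comp_apply, sub_single, TupleChain.push_single]
    congr 1
    ext t
    simp [aff_aff]
  exact LinearMap.congr_fun this c

lemma subHom_comp_aff {n m k : ℕ} (h : C(X × ℝ, Y)) (σ : C(stdSimplex ℝ (Fin n), X))
    (u : Fin k → stdSimplex ℝ (Fin n)) (c : TupleChain (stdSimplex ℝ (Fin k) × Bool) m) :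
    subHom h (σ.comp (aff u)) c = subHom h σ (TupleChain.push (Prod.map (aff u) id) c) := by
  have : subHom (m := m) h (σ.comp (aff u))
      = subHom h σ ∘ₗ TupleChain.push (Prod.map (aff u) id) := by
    refine TupleChain.hom_ext fun w => ?_
    simp only [LinearMap.comp_apply, subHom_single, TupleChain.push_single]
    congr 1
    ext t
    simp only [ContinuousMap.comp_apply, prodMk_apply, aff_aff]
    rfl
  exact LinearMap.congr_fun this c

/-- A slice of a homotopy. -/
def atTime (h : C(X × ℝ, Y)) (r : ℝ) : C(X, Y) :=
  h.comp ((ContinuousMap.id X).prodMk (ContinuousMap.const X r))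

@[simp] lemma atTime_apply (h : C(X × ℝ, Y)) (r : ℝ) (x : X) : atTime h r x = h (x, r) := rfl

lemma subHom_push_false {n m : ℕ} (h : C(X × ℝ, Y)) (σ : C(stdSimplex ℝ (Fin n), X))
    (c : TupleChain (stdSimplex ℝ (Fin n)) m) :
    subHom h σ (TupleChain.push (fun x => (x, false)) c) = push (atTime h 0) (sub σ c) := by
  have : subHom (m := m) h σ ∘ₗ TupleChain.push (fun x => (x, false))
      = push (atTime h 0) ∘ₗ sub σ := by
    refine TupleChain.hom_ext fun w => ?_
    simp only [LinearMap.comp_apply, subHom_single, TupleChain.push_single, sub_single, push_single]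
    congr 1
    ext t
    simp only [ContinuousMap.comp_apply, prodMk_apply, atTime_apply]
    rw [show (Prod.snd ∘ (fun x => (x, false)) ∘ w) = fun _ => false from rfl, level_false]
    rfl
  exact LinearMap.congr_fun this c

lemma subHom_push_true {n m : ℕ} (h : C(X × ℝ, Y)) (σ : C(stdSimplex ℝ (Fin n), X))
    (c : TupleChain (stdSimplex ℝ (Fin n)) m) :
    subHom h σ (TupleChain.push (fun x => (x, true)) c) = push (atTime h 1) (sub σ c) := by
  have : subHom (m := m) h σ ∘ₗ TupleChain.push (fun x => (x, true))
      = push (atTime h 1) ∘ₗ sub σ := by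
    refine TupleChain.hom_ext fun w => ?_
    simp only [LinearMap.comp_apply, subHom_single, TupleChain.push_single, sub_single, push_single]
    congr 1
    ext t
    simp only [ContinuousMap.comp_apply, prodMk_apply, atTime_apply]
    rw [show (Prod.snd ∘ (fun x => (x, true)) ∘ w) = fun _ => true from rfl, level_true]
    rfl
  exact LinearMap.congr_fun this c

/-- The barycentric subdivision operator. -/
def sd {n : ℕ} : SChain X n →ₗ[ZMod 2] SChain X n :=
  Finsupp.linearCombination (ZMod 2) fun σ => sub σ (TupleChain.sd bary n (Finsupp.single (vert n) 1))

/-- The operator induced by a homotopy `h`, linking `h₀` to the subdivision followed by `h₁`. -/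
def homOp {n : ℕ} (h : C(X × ℝ, Y)) : SChain X n →ₗ[ZMod 2] SChain Y (n + 1) :=
  Finsupp.linearCombination (ZMod 2) fun σ =>
    subHom h σ (TupleChain.sdHom bary n (Finsupp.single (vert n) 1))

lemma sd_single {n : ℕ} (σ : C(stdSimplex ℝ (Fin n), X)) :
    sd (Finsupp.single σ (1 : ZMod 2)) = sub σ (TupleChain.sd bary n (Finsupp.single (vert n) 1)) := by
  simp [sd]

lemma homOp_single {n : ℕ} (h : C(X × ℝ, Y)) (σ : C(stdSimplex ℝ (Fin n), X)) :
    homOp h (Finsupp.single σ (1 : ZMod 2)) =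
      subHom h σ (TupleChain.sdHom bary n (Finsupp.single (vert n) 1)) := by
  simp [homOp]

lemma sd_sub {n m : ℕ} (σ : C(stdSimplex ℝ (Fin n), X)) (c : TupleChain (stdSimplex ℝ (Fin n)) m) :
    sd (sub σ c) = sub σ (TupleChain.sd bary m c) := by
  have : sd ∘ₗ sub (m := m) σ = sub σ ∘ₗ TupleChain.sd bary m := by
    refine TupleChain.hom_ext fun w => ?_
    rw [LinearMap.comp_apply, LinearMap.comp_apply, sub_single, sd_single, sub_comp_aff,
      ← TupleChain.sd_push (β := bary) (β' := bary) _ (aff_bary w), TupleChain.push_single,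
      aff_vert_comp]
  exact LinearMap.congr_fun this c

lemma bd_sd {n : ℕ} (c : SChain X (n + 1)) : bd (sd c) = sd (bd c) := by
  have : bd ∘ₗ sd (X := X) (n := n + 1) = sd ∘ₗ bd := by
    refine TupleChain.hom_ext fun σ => ?_
    rw [LinearMap.comp_apply, LinearMap.comp_apply, sd_single, bd_sub, TupleChain.bd_sd, ← sd_sub,
      ← bd_sub, sub_vert]
  exact LinearMap.congr_fun this c

/-- The formal relation `TupleChain.bd_sdHom`, transported to each simplex. With a stationary
homotopy it shows that subdivision preserves classes; with a general one it compares the two ends,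
one of them subdivided. -/
lemma bd_homOp {n : ℕ} (h : C(X × ℝ, Y)) (c : SChain X (n + 1)) :
    bd (homOp h c) = push (atTime h 0) c + push (atTime h 1) (sd c) + homOp h (bd c) := by
  have : bd ∘ₗ homOp (n := n + 1) h
      = push (atTime h 0) + push (atTime h 1) ∘ₗ sd + homOp h ∘ₗ bd := by
    refine TupleChain.hom_ext fun σ => ?_
    rw [LinearMap.comp_apply, homOp_single, bd_subHom, TupleChain.bd_sdHom, map_add, map_add,
      subHom_push_false, subHom_push_true, sub_vert, ← sd_single]
    simp only [LinearMap.add_apply, LinearMap.comp_apply]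
    congr 1
    rw [bd_single, TupleChain.bd_single]
    simp only [map_sum]
    refine Finset.sum_congr rfl fun i _ => ?_
    rw [homOp_single, faceMap_eq, subHom_comp_aff,
      ← TupleChain.sdHom_push (β := bary) (β' := bary) _ (aff_bary _), TupleChain.push_single,
      aff_vert_comp]
  exact LinearMap.congr_fun this c

lemma bd_bd {n : ℕ} (c : SChain X (n + 2)) : bd (bd c) = 0 := by
  have : bd ∘ₗ bd = (0 : SChain X (n + 2) →ₗ[ZMod 2] SChain X n) := by
    refine TupleChain.hom_ext fun σ => ?_
    rw [LinearMap.comp_apply, ← sub_vert, bd_sub, bd_sub, TupleChain.bd_bd, map_zero]; rfl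
  exact LinearMap.congr_fun this c

lemma carr_sub {n m : ℕ} (σ : C(stdSimplex ℝ (Fin n), X))
    (c : TupleChain (stdSimplex ℝ (Fin n)) m) : carr (sub σ c) ⊆ range σ :=
  carr_linearCombination fun w _ => by
    rw [carr_single, ContinuousMap.coe_comp]
    exact range_comp_subset_range _ _

lemma carr_sd {n : ℕ} (c : SChain X n) : carr (sd c) ⊆ carr c :=
  carr_linearCombination fun σ hσ => (carr_sub σ _).trans (range_subset_carr hσ)

lemma carr_homOp {n : ℕ} (h : C(X × ℝ, Y)) (c : SChain X n) :
    carr (homOp h c) ⊆ h '' (carr c ×ˢ Icc 0 1) := by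
  refine carr_linearCombination fun σ hσ => carr_linearCombination fun w _ => ?_
  rw [carr_single]
  rintro _ ⟨t, rfl⟩
  exact ⟨_, ⟨range_subset_carr hσ (mem_range_self _), level_mem _ _⟩, rfl⟩

/-- A homotopy induces a chain homotopy, with control of the carriers. -/
lemma exists_homotopy {n : ℕ} (h : C(X × ℝ, Y)) (c : SChain X (n + 1)) :
    ∃ (b : SChain Y (n + 2)) (e : SChain Y (n + 1)),
      push (atTime h 0) c + push (atTime h 1) c = bd b + e ∧
      carr b ⊆ h '' (carr c ×ˢ Icc 0 1) ∧ carr e ⊆ h '' (carr (bd c) ×ˢ Icc 0 1) := by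
  -- The stationary homotopy at the end `h₁` links `h₁` to its own subdivision; adding its operator
  -- removes the subdivision from `bd_homOp`.
  set h' : C(X × ℝ, Y) := (atTime h 1).comp ContinuousMap.fst with hh'
  have h0 : atTime h' 0 = atTime h 1 := rfl
  have h1 : atTime h' 1 = atTime h 1 := rfl
  have sub' : ∀ {m : ℕ} (d : SChain X m), carr (homOp h' d) ⊆ h '' (carr d ×ˢ Icc 0 1) := by
    intro m d
    refine (carr_homOp h' d).trans ?_
    rintro _ ⟨⟨x, r⟩, ⟨hx, -⟩, rfl⟩
    exact ⟨(x, 1), ⟨hx, by simp⟩, rfl⟩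
  refine ⟨homOp h c + homOp h' c, homOp h (bd c) + homOp h' (bd c), ?_,
    carr_add_subset (carr_homOp h c) (sub' c), carr_add_subset (carr_homOp h _) (sub' _)⟩
  rw [map_add, bd_homOp, bd_homOp, h0, h1]
  have e1 := ZModModule.add_self (push (atTime h 1) (sd c))
  have e2 := ZModModule.add_self (homOp h (bd c))
  have e3 := ZModModule.add_self (homOp h' (bd c))
  calc push (atTime h 0) c + push (atTime h 1) c
      = push (atTime h 0) c + push (atTime h 1) c
        + (push (atTime h 1) (sd c) + push (atTime h 1) (sd c))
        + (homOp h (bd c) + homOp h (bd c)) + (homOp h' (bd c) + homOp h' (bd c)) := by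
          rw [e1, e2, e3]; simp
    _ = _ := by abel

/-- Subdividing a chain does not change its relative homology class. -/
lemma exists_sd_iterate {n : ℕ} (k : ℕ) (c : SChain X (n + 1)) :
    ∃ (b : SChain X (n + 2)) (e : SChain X (n + 1)),
      (sd^[k]) c + c = bd b + e ∧ carr b ⊆ carr c ∧ carr e ⊆ carr (bd c) := by
  induction k generalizing c with
  | zero => exact ⟨0, 0, by simp [ZModModule.add_self], by simp, by simp⟩
  | succ k ih =>
    obtain ⟨b, e, h, hb, he⟩ := ih (sd c)
    have himg : ∀ s : Set X, (ContinuousMap.fst : C(X × ℝ, X)) '' (s ×ˢ Icc (0 : ℝ) 1) ⊆ s := by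
      rintro s _ ⟨⟨x, r⟩, ⟨hx, -⟩, rfl⟩
      exact hx
    refine ⟨b + homOp ContinuousMap.fst c, e + homOp ContinuousMap.fst (bd c), ?_,
      carr_add_subset (hb.trans (carr_sd c)) ((carr_homOp _ _).trans (himg _)),
      carr_add_subset (he.trans (by rw [bd_sd]; exact carr_sd _))
        ((carr_homOp _ _).trans (himg _))⟩
    have h0 : ∀ r, atTime (ContinuousMap.fst : C(X × ℝ, X)) r = ContinuousMap.id X := fun r => rfl
    rw [map_add, bd_homOp, h0, h0, push_id, push_id, Function.iterate_succ_apply]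
    have e2 := ZModModule.add_self (homOp ContinuousMap.fst (bd c))
    have e3 := ZModModule.add_self (sd c)
    calc sd^[k] (sd c) + c = (sd^[k] (sd c) + sd c) + c + sd c := by
          rw [add_assoc, add_assoc, add_comm c, ← add_assoc (sd c), e3, zero_add]
      _ = bd b + e + c + sd c + (homOp ContinuousMap.fst (bd c) + homOp ContinuousMap.fst (bd c)) := by
          rw [h, e2, add_zero]
      _ = _ := by abel

lemma iterate_map_add {n : ℕ} (k : ℕ) (c c' : SChain X n) :
    sd^[k] (c + c') = sd^[k] c + sd^[k] c' := by
  induction k generalizing c c' with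
  | zero => rfl
  | succ k ih => simp

lemma bd_sd_iterate {n : ℕ} (k : ℕ) (c : SChain X (n + 1)) : bd (sd^[k] c) = sd^[k] (bd c) := by
  induction k generalizing c with
  | zero => rfl
  | succ k ih => simp [ih, bd_sd]

lemma carr_sd_iterate {n : ℕ} (k : ℕ) (c : SChain X n) : carr (sd^[k] c) ⊆ carr c := by
  induction k generalizing c with
  | zero => rfl
  | succ k ih => exact (ih _).trans (carr_sd c)

end SChain

end

end HamiltonJacobi

/-! ### Making simplices small by iterated subdivision. -/

namespace HamiltonJacobi

noncomputable section

namespace SChain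

variable {X Y Z : Type*} [TopologicalSpace X] [TopologicalSpace Y] [TopologicalSpace Z]

/-! ### Small chains -/

lemma support_map {α β : Type*} (f : (α →₀ ZMod 2) →ₗ[ZMod 2] β →₀ ZMod 2) (c : α →₀ ZMod 2) {b : β}
    (h : b ∈ (f c).support) : ∃ a ∈ c.support, b ∈ (f (Finsupp.single a 1)).support := by
  have hf : f = Finsupp.linearCombination (ZMod 2) fun a => f (Finsupp.single a 1) :=
    TupleChain.hom_ext fun a => by simp
  rw [hf] at h
  exact support_linearCombination _ _ h

lemma dist_aff_le {m n : ℕ} (w : Fin m → stdSimplex ℝ (Fin n)) (t : stdSimplex ℝ (Fin m))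
    (y : stdSimplex ℝ (Fin n)) {a : Fin m → ℝ} (h : ∀ i, dist (w i) y ≤ a i) :
    dist (aff w t) y ≤ ∑ i, t i * a i := by
  have ha : ∀ i, 0 ≤ a i := fun i => dist_nonneg.trans (h i)
  rw [Subtype.dist_eq]
  refine (dist_pi_le_iff (Finset.sum_nonneg fun i _ =>
    mul_nonneg (stdSimplex.zero_le t i) (ha i))).2 fun j => ?_
  have e : (aff w t).1 j - y.1 j = ∑ i, t i * ((w i).1 j - y.1 j) := by
    simp only [mul_sub, Finset.sum_sub_distrib, ← Finset.sum_mul, stdSimplex.sum_eq_one t, one_mul]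
    rfl
  rw [Real.dist_eq, e]
  refine (Finset.abs_sum_le_sum_abs _ _).trans (Finset.sum_le_sum fun i _ => ?_)
  rw [abs_mul, abs_of_nonneg (stdSimplex.zero_le t i)]
  refine mul_le_mul_of_nonneg_left ?_ (stdSimplex.zero_le t i)
  refine le_trans ?_ (h i)
  rw [← Real.dist_eq]
  exact dist_le_pi_dist (w i).1 y.1 j

lemma dist_aff_le' {m n : ℕ} (w : Fin m → stdSimplex ℝ (Fin n)) (t : stdSimplex ℝ (Fin m))
    (y : stdSimplex ℝ (Fin n)) {δ : ℝ} (h : ∀ i, dist (w i) y ≤ δ) : dist (aff w t) y ≤ δ := by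
  refine (dist_aff_le w t y h).trans ?_
  rw [← Finset.sum_mul, stdSimplex.sum_eq_one t, one_mul]

/-- In the barycentre `w i` itself has weight `1 / (m + 1)` and distance zero; the other `m`
vertices are within `δ`. -/
lemma dist_bary_le {m n : ℕ} (w : Fin (m + 1) → stdSimplex ℝ (Fin n)) {δ : ℝ}
    (h : ∀ i j, dist (w i) (w j) ≤ δ) (i : Fin (m + 1)) :
    dist (bary m w) (w i) ≤ m / (m + 1) * δ := by
  refine (dist_aff_le w _ (w i) (a := fun k => if k = i then 0 else δ) fun k => ?_).trans ?_
  · split_ifs with hk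
    · simp [hk]
    · exact h k i
  · have hb : ∀ k, (stdSimplex.barycenter : stdSimplex ℝ (Fin (m + 1))) k = ((m : ℝ) + 1)⁻¹ := by
      intro k
      have := stdSimplex.barycenter_apply (𝕜 := ℝ) k
      simp only [Fintype.card_fin, Nat.cast_add, Nat.cast_one] at this
      exact this
    simp only [hb, mul_ite, mul_zero]
    rw [Fin.sum_univ_succAbove _ i]
    simp only [if_true, Fin.succAbove_ne, if_false, zero_add, Finset.sum_const, Finset.card_univ,
      Fintype.card_fin, nsmul_eq_mul]
    exact le_of_eq (by ring)

lemma mem_support_cone {K : Type*} {m : ℕ} (b : K) (c : TupleChain K m) {u : Fin (m + 1) → K}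
    (h : u ∈ (TupleChain.cone b c).support) :
    ∃ u' ∈ c.support, u = (Fin.cons b u' : Fin (m + 1) → K) := by
  obtain ⟨u', hu', h'⟩ := support_map _ _ h
  rw [TupleChain.cone_single, Finsupp.support_single _ one_ne_zero, Finset.mem_singleton] at h'
  exact ⟨u', hu', h'⟩

lemma mem_support_bd_single {K : Type*} {m : ℕ} (w : Fin (m + 1) → K) {u : Fin m → K}
    (h : u ∈ (TupleChain.bd (Finsupp.single w (1 : ZMod 2))).support) :
    ∃ i : Fin (m + 1), u = w ∘ i.succAbove := by
  classical
  rw [TupleChain.bd_single] at h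
  obtain ⟨i, -, h⟩ := Finset.mem_biUnion.1 (Finsupp.support_finsetSum h)
  rw [Finsupp.support_single _ one_ne_zero, Finset.mem_singleton] at h
  exact ⟨i, h⟩

/-- The simplices of the subdivision of an affine simplex are contained in it and smaller. -/
lemma sd_single_fine (N : ℕ) {n m : ℕ} (hm : m ≤ N + 1) (w : Fin m → stdSimplex ℝ (Fin n)) {δ : ℝ}
    (hδ : 0 ≤ δ) (hw : ∀ i j, dist (w i) (w j) ≤ δ) {u : Fin m → stdSimplex ℝ (Fin n)}
    (hu : u ∈ (TupleChain.sd bary m (Finsupp.single w 1)).support) :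
    (∀ i j, dist (u i) (u j) ≤ N / (N + 1) * δ) ∧ ∀ i, u i ∈ range (aff w) := by
  induction m with
  | zero => exact ⟨fun i => i.elim0, fun i => i.elim0⟩
  | succ m ih =>
    rw [TupleChain.sd_single] at hu
    obtain ⟨u', hu', rfl⟩ := mem_support_cone _ _ hu
    obtain ⟨w', hw', hu'⟩ := support_map _ _ hu'
    obtain ⟨k, rfl⟩ := mem_support_bd_single w hw'
    obtain ⟨h1, h2⟩ := ih (by omega) _ (fun i j => hw _ _) hu'
    have hρ : 0 ≤ N / ((N : ℝ) + 1) * δ := by positivity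
    -- `m / (m + 1)` increases with `m`, so the factor belonging to `N` serves for all faces in the
    -- induction.
    have hmN : (m : ℝ) / (m + 1) * δ ≤ N / (N + 1) * δ := by
      refine mul_le_mul_of_nonneg_right ?_ hδ
      rw [div_le_div_iff₀ (by positivity) (by positivity)]
      have : (m : ℝ) ≤ N := by exact_mod_cast (by omega : m ≤ N)
      nlinarith
    have key : ∀ j, dist (u' j) (bary m w) ≤ N / (N + 1) * δ := by
      intro j
      obtain ⟨t, ht⟩ := h2 j
      rw [← ht]
      refine dist_aff_le' _ _ _ fun i => ?_
      rw [dist_comm]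
      exact (dist_bary_le w hw _).trans hmN
    refine ⟨fun i j => ?_, fun i => ?_⟩
    · refine Fin.cases ?_ (fun i => ?_) i
      · refine Fin.cases ?_ (fun j => ?_) j
        · simpa using hρ
        · simpa [dist_comm] using key j
      · refine Fin.cases ?_ (fun j => ?_) j
        · simpa using key i
        · simpa using h1 i j
    · refine Fin.cases ?_ (fun i => ?_) i
      · exact ⟨_, rfl⟩
      · obtain ⟨t, ht⟩ := h2 i
        refine ⟨aff (vert (m + 1) ∘ k.succAbove) t, ?_⟩
        rw [aff_aff, ← Function.comp_assoc, aff_vert_comp, Fin.cons_succ]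
        exact ht

lemma sd_iterate_fine {n : ℕ} (k : ℕ) {u : Fin (n + 1) → stdSimplex ℝ (Fin (n + 1))}
    (hu : u ∈ ((TupleChain.sd bary (n + 1))^[k] (Finsupp.single (vert (n + 1)) 1)).support) :
    ∀ i j, dist (u i) (u j) ≤ ((n : ℝ) / (n + 1)) ^ k := by
  induction k generalizing u with
  | zero =>
    rw [Function.iterate_zero_apply, Finsupp.support_single _ one_ne_zero,
      Finset.mem_singleton] at hu
    intro i j
    rw [pow_zero]
    exact (Metric.dist_le_diam_of_mem (bounded_stdSimplex _) (u i).2 (u j).2).trans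
      diam_stdSimplex_le
  | succ k ih =>
    rw [Function.iterate_succ_apply'] at hu
    obtain ⟨w, hw, hu⟩ := support_map _ _ hu
    intro i j
    rw [pow_succ']
    exact (sd_single_fine n le_rfl w (by positivity) (ih hw) hu).1 i j

lemma sd_iterate_sub {n m : ℕ} (σ : C(stdSimplex ℝ (Fin n), X))
    (c : TupleChain (stdSimplex ℝ (Fin n)) m) (k : ℕ) :
    sd^[k] (sub σ c) = sub σ ((TupleChain.sd bary m)^[k] c) := by
  induction k generalizing c with
  | zero => rfl
  | succ k ih => rw [Function.iterate_succ_apply, sd_sub, ih, Function.iterate_succ_apply]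

/-- Every simplex of the chain is contained in a member of the family. -/
def IsSmall {n : ℕ} (𝒰 : Set (Set X)) (c : SChain X n) : Prop :=
  ∀ σ ∈ c.support, ∃ U ∈ 𝒰, range σ ⊆ U

lemma support_sd_iterate {n : ℕ} (k : ℕ) (c : SChain X n) {τ : C(stdSimplex ℝ (Fin n), X)}
    (h : τ ∈ (sd^[k] c).support) :
    ∃ σ ∈ c.support, τ ∈ (sd^[k] (Finsupp.single σ (1 : ZMod 2))).support := by
  have e : ∀ d : SChain X n, sd^[k] d = ((sd : SChain X n →ₗ[ZMod 2] SChain X n) ^ k) d :=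
    fun d => (Module.End.pow_apply _ _ _).symm
  rw [e] at h
  simp only [e]
  exact support_map _ _ h

/-- Lebesgue number of the cover pulled back to the simplex. The conclusion holds for all large `k`,
so that one `k` can serve several chains. -/
lemma exists_isSmall_single {n : ℕ} {𝒰 : Set (Set X)} (ho : ∀ U ∈ 𝒰, IsOpen U)
    (σ : C(stdSimplex ℝ (Fin (n + 1)), X)) (hc : range σ ⊆ ⋃₀ 𝒰) :
    ∃ k₀, ∀ k ≥ k₀, IsSmall 𝒰 (sd^[k] (Finsupp.single σ (1 : ZMod 2))) := by
  obtain ⟨δ, hδ, h⟩ := lebesgue_number_lemma_of_metric_sUnion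
    (s := (univ : Set (stdSimplex ℝ (Fin (n + 1))))) (c := (σ ⁻¹' ·) '' 𝒰) isCompact_univ
    (by rintro _ ⟨U, hU, rfl⟩; exact (ho U hU).preimage σ.continuous)
    (by
      intro t _
      obtain ⟨U, hU, ht⟩ := hc (mem_range_self t)
      exact ⟨_, ⟨U, hU, rfl⟩, ht⟩)
  have hρ : (n : ℝ) / (n + 1) < 1 := by rw [div_lt_one (by positivity)]; linarith
  obtain ⟨k₀, hk₀⟩ := exists_pow_lt_of_lt_one hδ hρ
  refine ⟨k₀, fun k hk τ hτ => ?_⟩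
  rw [← sub_vert, sd_iterate_sub] at hτ
  obtain ⟨u, hu, hτ⟩ := support_map _ _ hτ
  rw [sub_single, Finsupp.support_single _ one_ne_zero, Finset.mem_singleton] at hτ
  obtain ⟨_, ⟨U, hU, rfl⟩, hb⟩ := h (u 0) (mem_univ _)
  refine ⟨U, hU, ?_⟩
  rw [hτ]
  rintro _ ⟨t, rfl⟩
  refine hb (Metric.mem_ball.2 (lt_of_le_of_lt (dist_aff_le' u t (u 0) fun i => ?_) hk₀))
  exact (sd_iterate_fine k hu i 0).trans (pow_le_pow_of_le_one (by positivity) hρ.le hk)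

lemma exists_isSmall {n : ℕ} {𝒰 : Set (Set X)} (ho : ∀ U ∈ 𝒰, IsOpen U)
    (c : SChain X (n + 1)) (hc : carr c ⊆ ⋃₀ 𝒰) : ∃ k₀, ∀ k ≥ k₀, IsSmall 𝒰 (sd^[k] c) := by
  choose! k hk using fun (σ : C(stdSimplex ℝ (Fin (n + 1)), X)) (hσ : σ ∈ c.support) =>
    exists_isSmall_single ho σ ((range_subset_carr hσ).trans hc)
  refine ⟨c.support.sup k, fun j hj τ hτ => ?_⟩
  obtain ⟨σ, hσ, hτ⟩ := support_sd_iterate j c hτ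
  exact hk σ hσ j ((Finset.le_sup hσ).trans hj) τ hτ

end SChain

end

end HamiltonJacobi

/-! ### Relative classes, suspension and slicing of cycles. -/

namespace HamiltonJacobi

noncomputable section

namespace SChain

variable {X Y Z : Type*} [TopologicalSpace X] [TopologicalSpace Y] [TopologicalSpace Z]

/-! ### Relative homology classes -/

/-- The chain vanishes in the homology of the pair `(X, A)`. -/
def Trivial (A : Set X) {n : ℕ} (c : SChain X (n + 1)) : Prop :=
  ∃ (b : SChain X (n + 2)) (e : SChain X (n + 1)), carr e ⊆ A ∧ c = bd b + e

variable {n : ℕ} {A B : Set X}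

lemma trivial_of_carr {c : SChain X (n + 1)} (h : carr c ⊆ A) : Trivial A c :=
  ⟨0, c, h, by simp⟩

lemma Trivial.add {c c' : SChain X (n + 1)} (h : Trivial A c) (h' : Trivial A c') :
    Trivial A (c + c') := by
  obtain ⟨b, e, he, rfl⟩ := h
  obtain ⟨b', e', he', rfl⟩ := h'
  exact ⟨b + b', e + e', carr_add_subset he he', by rw [map_add]; abel⟩

lemma add_add_self {M : Type*} [AddCommGroup M] [Module (ZMod 2) M] (x y : M) : x + (x + y) = y := by
  rw [← add_assoc, ZModModule.add_self, zero_add]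

lemma Trivial.of_add {c c' : SChain X (n + 1)} (h : Trivial A (c + c')) (h' : Trivial A c) :
    Trivial A c' := by
  have := h'.add h
  rwa [add_add_self] at this

lemma trivial_congr {c c' : SChain X (n + 1)} (h : Trivial A (c + c')) :
    Trivial A c ↔ Trivial A c' :=
  ⟨fun h' => h.of_add h', fun h' => (show Trivial A (c' + c) by rwa [add_comm]).of_add h'⟩

lemma Trivial.mono {c : SChain X (n + 1)} (h : Trivial A c) (hAB : A ⊆ B) : Trivial B c := by
  obtain ⟨b, e, he, rfl⟩ := h
  exact ⟨b, e, he.trans hAB, rfl⟩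

lemma Trivial.push {c : SChain X (n + 1)} (h : Trivial A c) (f : C(X, Y)) {B : Set Y}
    (hf : ∀ x ∈ A, f x ∈ B) : Trivial B (push f c) := by
  obtain ⟨b, e, he, rfl⟩ := h
  exact ⟨SChain.push f b, SChain.push f e, carr_push_subset fun x hx => hf x (he hx),
    by rw [map_add, bd_push]⟩

lemma trivial_push_iff {c : SChain X (n + 1)} (h : C(X × ℝ, Y)) {B : Set Y}
    (hB : ∀ x ∈ carr (bd c), ∀ r ∈ Icc (0 : ℝ) 1, h (x, r) ∈ B) :
    Trivial B (SChain.push (atTime h 0) c) ↔ Trivial B (SChain.push (atTime h 1) c) := by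
  obtain ⟨b, e, he, -, h2⟩ := exists_homotopy h c
  refine trivial_congr ⟨b, e, h2.trans ?_, he⟩
  rintro _ ⟨⟨x, r⟩, ⟨hx, hr⟩, rfl⟩
  exact hB x hx r hr

lemma trivial_push_iff_self {c : SChain X (n + 1)} (h : C(X × ℝ, X)) (h0 : ∀ x, h (x, 0) = x)
    (hA : ∀ x ∈ carr (bd c), ∀ r ∈ Icc (0 : ℝ) 1, h (x, r) ∈ A) :
    Trivial A (SChain.push (atTime h 1) c) ↔ Trivial A c := by
  have e : atTime h 0 = ContinuousMap.id X := ContinuousMap.ext h0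
  rw [← trivial_push_iff h hA, e, push_id]

lemma trivial_sd_iterate_iff {c : SChain X (n + 1)} (hc : carr (bd c) ⊆ A) (k : ℕ) :
    Trivial A (sd^[k] c) ↔ Trivial A c := by
  obtain ⟨b, e, he, -, h2⟩ := exists_sd_iterate k c
  exact trivial_congr ⟨b, e, h2.trans hc, he⟩

/-! ### Slices -/

open Classical in
/-- The part of a chain consisting of the simplices contained in `U`. -/
def part (U : Set X) {n : ℕ} : SChain X n →ₗ[ZMod 2] SChain X n where
  toFun c := c.filter fun σ : C(stdSimplex ℝ (Fin n), X) => range σ ⊆ U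
  map_add' _ _ := Finsupp.filter_add
  map_smul' _ _ := Finsupp.filter_smul

open Classical in
lemma mem_support_part {U : Set X} {n : ℕ} {c : SChain X n} {σ : C(stdSimplex ℝ (Fin n), X)} :
    σ ∈ (part U c).support ↔ σ ∈ c.support ∧ range σ ⊆ U := by
  change σ ∈ (c.filter fun σ : C(stdSimplex ℝ (Fin n), X) => range σ ⊆ U).support ↔ _
  rw [Finsupp.support_filter, Finset.mem_filter]

open Classical in
lemma mem_support_add_part {U : Set X} {n : ℕ} {c : SChain X n}
    {σ : C(stdSimplex ℝ (Fin n), X)} (h : σ ∈ (c + part U c).support) :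
    σ ∈ c.support ∧ ¬ range σ ⊆ U := by
  have e : c + part U c = c.filter fun σ : C(stdSimplex ℝ (Fin n), X) => ¬ range σ ⊆ U := by
    have h1 : part U c + (c.filter fun σ : C(stdSimplex ℝ (Fin n), X) => ¬ range σ ⊆ U) = c :=
      Finsupp.filter_add_filter_not c _
    nth_rewrite 1 [← h1]
    rw [add_comm, add_add_self]
  rwa [e, Finsupp.support_filter, Finset.mem_filter] at h

lemma carr_part {U : Set X} {n : ℕ} (c : SChain X n) : carr (part U c) ⊆ carr c ∩ U :=
  carr_subset_iff.2 fun _ hσ =>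
    subset_inter (range_subset_carr (mem_support_part.1 hσ).1) (mem_support_part.1 hσ).2

lemma part_eq_self {U : Set X} {n : ℕ} {c : SChain X n} (h : carr c ⊆ U) : part U c = c := by
  classical
  change (c.filter fun σ : C(stdSimplex ℝ (Fin n), X) => range σ ⊆ U) = c
  rw [Finsupp.filter_eq_self_iff]
  intro σ hσ
  exact (range_subset_carr (Finsupp.mem_support_iff.2 hσ)).trans h

/-- The slice of a chain along the boundary of `U`. -/
def slice (U : Set X) {n : ℕ} : SChain X (n + 1) →ₗ[ZMod 2] SChain X n :=
  bd ∘ₗ part U + part U ∘ₗ bd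

lemma slice_apply (U : Set X) {n : ℕ} (c : SChain X (n + 1)) :
    slice U c = bd (part U c) + part U (bd c) := rfl

/-- As the commutator of `bd` with `part U`, slicing is a chain map because `bd` squares to zero. -/
lemma bd_slice (U : Set X) {n : ℕ} (c : SChain X (n + 2)) : bd (slice U c) = slice U (bd c) := by
  simp [slice_apply, bd_bd]

lemma carr_slice (U : Set X) {n : ℕ} (c : SChain X (n + 1)) : carr (slice U c) ⊆ carr c :=
  carr_add_subset ((carr_bd _).trans ((carr_part c).trans inter_subset_left))
    ((carr_part _).trans (inter_subset_left.trans (carr_bd c)))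

/-- A simplex inside `U` contributes its boundary twice and one disjoint from `U` contributes
nothing; only simplices crossing the frontier of `U` survive. -/
lemma carr_slice_subset {U B : Set X} {n : ℕ} {c : SChain X (n + 1)}
    (h : ∀ σ ∈ c.support, range σ ⊆ U ∨ Disjoint (range σ) U ∨ range σ ⊆ B) :
    carr (slice U c) ⊆ B := by
  refine carr_subset_iff.2 fun τ hτ => ?_
  obtain ⟨σ, hσ, hτ⟩ := support_map _ _ hτ
  refine (range_subset_carr hτ).trans ?_
  have hs := carr_single σ
  rcases h σ hσ with h | h | h
  · rw [slice_apply, part_eq_self (hs.trans_subset h),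
      part_eq_self ((carr_bd _).trans (hs.trans_subset h)), ZModModule.add_self]
    simp
  · have : ∀ {m : ℕ} (d : SChain X m), carr d ⊆ range σ → carr (part U d) ⊆ ∅ := fun d hd x hx =>
      disjoint_left.1 h (hd ((carr_part d hx).1)) (carr_part d hx).2
    refine (carr_add_subset ((carr_bd _).trans (this _ hs.subset))
      (this _ ((carr_bd _).trans hs.subset))).trans (empty_subset _)
  · exact (carr_slice _ _).trans (hs.trans_subset h)

/-- The complement of `(X ∖ A) × {0}` in `X × ℝ`. -/
def suspSet (A : Set X) : Set (X × ℝ) := {y | y.1 ∈ A ∨ y.2 ≠ 0}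

/-- The upper half of `X × ℝ`. -/
def upper (X : Type*) : Set (X × ℝ) := {y | 0 < y.2}

/-- The projection of `X × ℝ`, as a continuous map. -/
abbrev proj (X : Type*) [TopologicalSpace X] : C(X × ℝ, X) := ContinuousMap.fst

/-- The cover of `X × ℝ` by an open set and the two half spaces. -/
def halfCover {E : Type*} (W : Set (E × ℝ)) : Set (Set (E × ℝ)) := {W, {y | 0 < y.2}, {y | y.2 < 0}}

lemma isOpen_halfCover {W : Set (X × ℝ)} (hW : IsOpen W) : ∀ U ∈ halfCover W, IsOpen U := by
  rintro U (rfl | rfl | rfl)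
  · exact hW
  · exact isOpen_lt continuous_const continuous_snd
  · exact isOpen_lt continuous_snd continuous_const

lemma subset_halfCover {E : Type*} {W B : Set (E × ℝ)} (h : ∀ y ∈ B, y.2 = 0 → y ∈ W) :
    B ⊆ ⋃₀ halfCover W := by
  intro y hy
  rcases lt_trichotomy y.2 0 with h1 | h1 | h1
  · exact ⟨_, Or.inr (Or.inr rfl), h1⟩
  · exact ⟨_, Or.inl rfl, h y hy h1⟩
  · exact ⟨_, Or.inr (Or.inl rfl), h1⟩

lemma carr_slice_of_isSmall {W : Set (X × ℝ)} {n : ℕ} {c : SChain (X × ℝ) (n + 1)}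
    (h : IsSmall (halfCover W) c) : carr (slice (upper X) c) ⊆ W := by
  refine carr_slice_subset fun σ hσ => ?_
  obtain ⟨U, rfl | rfl | rfl, hU⟩ := h σ hσ
  · exact Or.inr (Or.inr hU)
  · exact Or.inl hU
  · refine Or.inr (Or.inl (disjoint_left.2 fun y hy hy' => ?_))
    exact lt_asymm (show (0 : ℝ) < y.2 from hy') (hU hy)

/-- Suspension of a non-trivial relative cycle. -/
theorem exists_suspension (hA : IsOpen A) {σ : SChain X (n + 1)} (hσ : carr (bd σ) ⊆ A)
    (hn : ¬ Trivial A σ) {L : ℝ} (hL : 0 < L) :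
    ∃ b : SChain (X × ℝ) (n + 2), carr b ⊆ carr σ ×ˢ Icc (-L) L ∧
      carr (bd b) ⊆ (carr σ ×ˢ {-L, L}) ∪ (carr (bd σ) ×ˢ Icc (-L) L) ∧
      ¬ Trivial (suspSet A) b := by
  set h : C(X × ℝ, X × ℝ) := ⟨fun y => (y.1, (2 * y.2 - 1) * L), by fun_prop⟩ with hh
  have himg : ∀ s : Set X, h '' (s ×ˢ Icc (0 : ℝ) 1) ⊆ s ×ˢ Icc (-L) L := by
    rintro s _ ⟨⟨x, r⟩, ⟨hx, hr⟩, rfl⟩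
    refine ⟨hx, ?_, ?_⟩
    · change -L ≤ (2 * r - 1) * L
      nlinarith [hr.1, hr.2]
    · change (2 * r - 1) * L ≤ L
      nlinarith [hr.1, hr.2]
  obtain ⟨b, e, he, hb, he'⟩ := exists_homotopy h σ
  have hbd : bd b = push (atTime h 0) σ + push (atTime h 1) σ + e := by
    rw [he, add_assoc (bd b) e e, ZModModule.add_self e, add_zero]
  have h0 : ∀ x, atTime h 0 x = (x, -L) := fun x => by simp [hh]
  have h1 : ∀ x, atTime h 1 x = (x, L) := fun x => by simp [hh]; ring
  have c0 : carr (push (atTime h 0) σ) ⊆ carr σ ×ˢ {-L} :=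
    carr_push_subset fun x hx => by rw [h0]; exact ⟨hx, rfl⟩
  have c1 : carr (push (atTime h 1) σ) ⊆ carr σ ×ˢ {L} :=
    carr_push_subset fun x hx => by rw [h1]; exact ⟨hx, rfl⟩
  have ce : carr e ⊆ carr (bd σ) ×ˢ Icc (-L) L := he'.trans (himg _)
  refine ⟨b, hb.trans (himg _), ?_, ?_⟩
  · rw [hbd]
    refine carr_add_subset (carr_add_subset (c0.trans ?_) (c1.trans ?_)) (ce.trans
      subset_union_right)
    · exact (Set.prod_mono le_rfl (by simp)).trans subset_union_left
    · exact (Set.prod_mono le_rfl (by simp)).trans subset_union_left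
  · rintro ⟨β, ε, hε, hβ⟩
    -- If the prism `b` were `bd β + ε`, then after enough subdivisions each simplex of `ε` lies
    -- over `A` or on one side of level zero, so that the slice of `ε` at level zero lies over `A`.
    obtain ⟨k, hk⟩ := exists_isSmall (𝒰 := halfCover (Prod.fst ⁻¹' A))
      (isOpen_halfCover (hA.preimage continuous_fst)) ε
      (subset_halfCover fun y hy hy0 => (hε hy).resolve_right (by simpa using hy0))
    have hs := carr_slice_of_isSmall (hk k le_rfl)
    set U := upper X with hU
    have e1 : slice U (sd^[k] b) = bd (slice U (sd^[k] β)) + slice U (sd^[k] ε) := by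
      rw [hβ, iterate_map_add, map_add, ← bd_sd_iterate, bd_slice]
    have e2 : part U (bd (sd^[k] b)) = sd^[k] (push (atTime h 1) σ)
        + (part U (sd^[k] (push (atTime h 0) σ)) + part U (sd^[k] e)) := by
      have : part U (sd^[k] (push (atTime h 1) σ)) = sd^[k] (push (atTime h 1) σ) :=
        part_eq_self ((carr_sd_iterate k _).trans (c1.trans fun y hy => by
          have : y.2 = L := hy.2
          change 0 < y.2
          rwa [this]))
      rw [bd_sd_iterate, hbd, iterate_map_add, iterate_map_add, map_add, map_add, this]
      abel
    -- Solving the sliced equation for the upper lid, which is a copy of `σ`: it is a boundary up to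
    -- chains over `A`, so its projection to `X` makes `σ` trivial.
    have e3 : sd^[k] (push (atTime h 1) σ) = bd (part U (sd^[k] b) + slice U (sd^[k] β))
        + (slice U (sd^[k] ε) + part U (sd^[k] (push (atTime h 0) σ)) + part U (sd^[k] e)) := by
      have := e1
      rw [slice_apply, e2] at this
      rw [map_add]
      set x := sd^[k] (push (atTime h 1) σ)
      set p := bd (part U (sd^[k] b))
      set q := part U (sd^[k] (push (atTime h 0) σ))
      set r := part U (sd^[k] e)
      calc x = (p + (x + (q + r))) + (p + (q + r)) := by
            rw [show p + (x + (q + r)) + (p + (q + r)) = (p + (q + r)) + ((p + (q + r)) + x) by abel,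
              add_add_self]
        _ = _ := by rw [this]; abel
    have t1 : Trivial (Prod.fst ⁻¹' A) (sd^[k] (push (atTime h 1) σ)) := by
      refine ⟨_, _, carr_add_subset (carr_add_subset hs ?_) ?_, e3⟩
      · intro y hy
        have h1 := carr_part _ hy
        have h2 : y.2 = -L := (c0 (carr_sd_iterate k _ h1.1)).2
        have h3 : 0 < y.2 := h1.2
        linarith
      · intro y hy
        exact hσ (ce (carr_sd_iterate k _ (carr_part _ hy).1)).1
    rw [trivial_sd_iterate_iff] at t1
    · have t2 := t1.push (proj X) (B := A) fun y hy => hy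
      rw [push_push] at t2
      rw [show (proj X).comp (atTime h 1) = ContinuousMap.id X from
        ContinuousMap.ext fun x => by simp [hh], push_id] at t2
      exact hn t2
    · rw [bd_push]
      exact carr_push_subset fun x hx => by rw [h1]; exact hσ hx

/-- Slicing a non-trivial relative cycle of the suspension. -/
theorem exists_slice (hA : IsOpen A) {σ : SChain (X × ℝ) (n + 2)}
    (hσ : carr (bd σ) ⊆ suspSet A) (hn : ¬ Trivial (suspSet A) σ) {ε : ℝ} (hε : 0 < ε) :
    ∃ τ : SChain X (n + 1), (∀ x ∈ carr τ, ∃ p, |p| < ε ∧ (x, p) ∈ carr σ) ∧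
      (∀ x ∈ carr (bd τ), x ∈ A ∧ ∃ p, |p| < ε ∧ (x, p) ∈ carr (bd σ)) ∧ ¬ Trivial A τ := by
  set U := upper X with hU
  -- Two requirements on the subdivision: the slice of `bd σ` must lie over `A`, and the slice of
  -- `σ` must lie in the strip `|p| < ε`.
  obtain ⟨k₁, hk₁⟩ := exists_isSmall (𝒰 := halfCover (Prod.fst ⁻¹' A))
    (isOpen_halfCover (hA.preimage continuous_fst)) (bd σ)
    (subset_halfCover fun y hy hy0 => (hσ hy).resolve_right (by simpa using hy0))
  obtain ⟨k₂, hk₂⟩ := exists_isSmall (𝒰 := halfCover {y : X × ℝ | |y.2| < ε})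
    (isOpen_halfCover (isOpen_lt (by fun_prop) continuous_const)) σ
    (subset_halfCover fun y _ hy0 => by simpa [hy0] using hε)
  set k := max k₁ k₂
  set c := sd^[k] σ with hc
  have hbc : bd c = sd^[k] (bd σ) := bd_sd_iterate k σ
  have s1 : IsSmall (halfCover (Prod.fst ⁻¹' A)) (bd c) := by
    rw [hbc]; exact hk₁ k (le_max_left _ _)
  have s2 : carr (slice U c) ⊆ {y | |y.2| < ε} := carr_slice_of_isSmall (hk₂ k (le_max_right _ _))
  have s3 : carr (slice U (bd c)) ⊆ Prod.fst ⁻¹' A := carr_slice_of_isSmall s1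
  have hcσ : carr c ⊆ carr σ := carr_sd_iterate k σ
  have hbcσ : carr (bd c) ⊆ carr (bd σ) := by rw [hbc]; exact carr_sd_iterate k _
  refine ⟨push (proj X) (slice U c), ?_, ?_, ?_⟩
  · intro x hx
    obtain ⟨⟨x', p⟩, hy, rfl⟩ := carr_push _ _ hx
    exact ⟨p, s2 hy, hcσ (carr_slice _ _ hy)⟩
  · intro x hx
    rw [bd_push] at hx
    obtain ⟨⟨x', p⟩, hy, rfl⟩ := carr_push _ _ hx
    have hp := s2 (carr_bd _ hy)
    rw [bd_slice] at hy
    exact ⟨s3 hy, p, hp, hbcσ (carr_slice _ _ hy)⟩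
  · intro ht
    apply hn
    rw [← trivial_sd_iterate_iff hσ k, ← hc]
    set j : C(X, X × ℝ) := ⟨fun x => (x, 0), by fun_prop⟩
    -- the slice is homologous to its projection
    have hx : Trivial (Prod.fst ⁻¹' A) (slice U c) := by
      set h : C((X × ℝ) × ℝ, X × ℝ) := ⟨fun y => (y.1.1, (1 - y.2) * y.1.2), by fun_prop⟩ with hh
      rw [← trivial_push_iff_self h (fun y => by simp [hh])]
      · have : atTime h 1 = j.comp (proj X) := ContinuousMap.ext fun y => by simp [hh, j]
        rw [this, ← push_push]
        exact ht.push j fun x hx => hx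
      · intro y hy r _
        rw [bd_slice] at hy
        exact show y.1 ∈ A from s3 hy
    obtain ⟨β, ε', hε', hβ⟩ := hx
    -- If the boundary of a chain lies over `A` or on the side `s` of level zero, translating the
    -- chain towards that side keeps its boundary in `suspSet A` and finally takes its whole compact
    -- carrier off level zero.
    have translate : ∀ (s : ℝ) (z : SChain (X × ℝ) (n + 2)), s = 1 ∨ s = -1 →
        carr (bd z) ⊆ {y | y.1 ∈ A ∨ 0 < s * y.2} → Trivial (suspSet A) z := by
      intro s z hs hz
      have hs2 : s * s = 1 := by rcases hs with rfl | rfl <;> norm_num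
      obtain ⟨M, hM⟩ := ((isCompact_carr z).image (f := fun y : X × ℝ => s * y.2)
        (by fun_prop)).bddBelow
      set M' := max 0 (1 - M)
      have hM0 : 0 ≤ M' := le_max_left _ _
      have hM1 : 1 - M ≤ M' := le_max_right _ _
      set h : C((X × ℝ) × ℝ, X × ℝ) := ⟨fun y => (y.1.1, y.1.2 + y.2 * (s * M')), by fun_prop⟩
        with hh
      have hv : ∀ (y : X × ℝ) (r : ℝ), s * (h (y, r)).2 = s * y.2 + r * M' := by
        intro y r
        change s * (y.2 + r * (s * M')) = _
        linear_combination r * M' * hs2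
      have hsub : {y : X × ℝ | y.1 ∈ A ∨ 0 < s * y.2} ⊆ suspSet A := by
        rintro y (hy | hy)
        · exact Or.inl hy
        · refine Or.inr fun h0 => ?_
          simp [h0] at hy
      rw [← trivial_push_iff_self h (fun y => by simp [hh])]
      · refine trivial_of_carr (carr_push_subset fun y hy => hsub (Or.inr ?_))
        rw [atTime_apply, hv, one_mul]
        have : M ≤ s * y.2 := hM ⟨y, hy, rfl⟩
        linarith
      · intro y hy r hr
        refine hsub ?_
        rcases hz hy with h1 | h1
        · exact Or.inl h1
        · refine Or.inr ?_
          rw [hv]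
          have := mul_nonneg hr.1 hM0
          linarith
    -- The chain `β` closes the upper part along the cut, up to `ε'` over `A`. The closed upper part
    -- can be translated upwards and the remainder of `c`, closed by the same `β`, downwards; their
    -- sum is `c`.
    have hbz : bd (part U c + β) = part U (bd c) + ε' := by
      rw [slice_apply] at hβ
      rw [map_add]
      calc bd (part U c) + bd β = (bd (part U c) + part U (bd c)) + (part U (bd c) + bd β) := by
            rw [show bd (part U c) + part U (bd c) + (part U (bd c) + bd β)
              = part U (bd c) + (part U (bd c) + (bd (part U c) + bd β)) by abel, add_add_self]
        _ = _ := by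
            rw [hβ, show bd β + ε' + (part U (bd c) + bd β)
              = bd β + (bd β + (part U (bd c) + ε')) by abel, add_add_self]
    have t1 : Trivial (suspSet A) (part U c + β) := by
      refine translate 1 _ (Or.inl rfl) ?_
      rw [hbz]
      refine carr_add_subset (fun y hy => Or.inr ?_) (fun y hy => Or.inl (hε' hy))
      rw [one_mul]
      exact (carr_part _ hy).2
    have t2 : Trivial (suspSet A) (c + (part U c + β)) := by
      refine translate (-1) _ (Or.inr rfl) ?_
      rw [map_add, hbz, ← add_assoc]
      refine carr_add_subset (carr_subset_iff.2 fun τ hτ => ?_) (fun y hy => Or.inl (hε' hy))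
      obtain ⟨h1, h2⟩ := mem_support_add_part hτ
      obtain ⟨W, rfl | rfl | rfl, hW⟩ := s1 τ h1
      · exact fun y hy => Or.inl (hW hy)
      · exact absurd hW h2
      · intro y hy
        have : y.2 < 0 := hW hy
        exact Or.inr (by linarith)
    exact (show Trivial (suspSet A) (part U c + β + c) by
      rwa [add_comm (part U c + β) c]).of_add t1

end SChain

end

end HamiltonJacobi

/-! ### The minmax on the model space: linking, independence of the level, stabilization. -/

namespace HamiltonJacobi

noncomputable section

open SChain

/-! ### The model space -/

/-- The model `ℝᵏ × ℝᵏ ∋ (u, w)` of a space with a quadratic form of signature `(k, k)`. -/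
abbrev Model (k : ℕ) : Type := (Fin k → ℝ) × (Fin k → ℝ)

/-- The model quadratic form `|w|² - |u|²`. -/
def modelQ {k : ℕ} (z : Model k) : ℝ := ∑ i, z.2 i ^ 2 - ∑ i, z.1 i ^ 2

/-- Functions which differ from the model quadratic form by a Lipschitz function. -/
def QuadLip {k : ℕ} (f : Model k → ℝ) : Prop := IsLip fun z => f z - modelQ z

/-- The complement of the positive space `{u = 0}`. -/
def offPos (k : ℕ) : Set (Model k) := {z | z.1 ≠ 0}

/-- A neighbourhood of infinity in the negative directions. -/
def far (k : ℕ) (a : ℝ) : Set (Model k) := {z | a * (1 + ‖z.2‖) ≤ ‖z.1‖}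

lemma isOpen_offPos (k : ℕ) : IsOpen (offPos k) := isOpen_ne_fun continuous_fst continuous_const

lemma sq_norm_le_sum {k : ℕ} (u : Fin k → ℝ) : ‖u‖ ^ 2 ≤ ∑ i, u i ^ 2 := by
  have h0 : 0 ≤ ∑ i, u i ^ 2 := Finset.sum_nonneg fun i _ => sq_nonneg _
  rw [← Real.le_sqrt (norm_nonneg _) h0]
  refine (pi_norm_le_iff_of_nonneg (Real.sqrt_nonneg _)).2 fun i => ?_
  refine Real.le_sqrt_of_sq_le ?_
  rw [Real.norm_eq_abs, sq_abs]
  exact Finset.single_le_sum (f := fun i => u i ^ 2) (fun i _ => sq_nonneg _) (Finset.mem_univ i)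

lemma sum_le_sq_norm {k : ℕ} (u : Fin k → ℝ) : ∑ i, u i ^ 2 ≤ k * ‖u‖ ^ 2 := by
  have : ∀ i ∈ Finset.univ, u i ^ 2 ≤ ‖u‖ ^ 2 := fun i _ => by
    rw [← sq_abs, ← Real.norm_eq_abs]
    exact pow_le_pow_left₀ (norm_nonneg _) (norm_le_pi_norm u i) 2
  simpa using Finset.sum_le_sum this

lemma continuous_modelQ (k : ℕ) : Continuous (modelQ (k := k)) := by
  unfold modelQ; fun_prop

lemma QuadLip.continuous {k : ℕ} {f : Model k → ℝ} (h : QuadLip f) : Continuous f := by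
  obtain ⟨C, hC⟩ := h
  refine (hC.continuous.add (continuous_modelQ k)).congr fun z => ?_
  simp

/-- Multiplication of `u` by a scalar. -/
def scaleU {k : ℕ} (ρ : ℝ) (z : Model k) : Model k := (ρ • z.1, z.2)

/-- The behaviour at infinity of a function which is quadratic at infinity. -/
lemma QuadLip.exists_bounds {k : ℕ} {f : Model k → ℝ} (h : QuadLip f) :
    ∃ R a₀ : ℝ, 0 ≤ R ∧ (∀ ρ z, 1 ≤ ρ → R ≤ ‖z.1‖ → f (scaleU ρ z) ≤ f z) ∧
      (∀ z, f z ≤ -a₀ → R + 1 ≤ ‖z.1‖) ∧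
      (∀ a, ∃ a', ∀ b ≥ a', ∀ z ∈ far k b, f z ≤ -a) := by
  obtain ⟨C, hC⟩ := h
  set l : Model k → ℝ := fun z => f z - modelQ z with hl
  have hf : ∀ z, f z = modelQ z + l z := fun z => by simp [hl]
  have hlip : ∀ z z', |l z - l z'| ≤ C * ‖z - z'‖ := fun z z' => by
    have := hC.dist_le_mul z z'
    rwa [Real.dist_eq, dist_eq_norm] at this
  have hl0 : ∀ z, |l z| ≤ |l 0| + C * (‖z.1‖ + ‖z.2‖) := fun z => by
    have h1 := hlip z 0
    rw [sub_zero] at h1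
    have h2 : ‖z‖ ≤ ‖z.1‖ + ‖z.2‖ := max_le_add_of_nonneg (norm_nonneg _) (norm_nonneg _)
    have h3 := mul_le_mul_of_nonneg_left h2 C.2
    have h4 := abs_sub_abs_le_abs_sub (l z) (l 0)
    change (C : ℝ) * _ ≤ C * _ at h3
    linarith
  have hC0 : (0 : ℝ) ≤ C := C.2
  have hk0 : (0 : ℝ) ≤ k := Nat.cast_nonneg k
  -- For `‖u‖ ≥ C` the gain `(ρ² - 1)‖u‖²` of the quadratic form beats the Lipschitz loss `C(ρ -
  -- 1)‖u‖`, so `R = C`. The other constant exceeds `-f` wherever `‖u‖ < C + 1`; its term `C² / 4`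
  -- comes from completing the square in `‖w‖`.
  refine ⟨C, k * (C + 1) ^ 2 + |l 0| + C * (C + 1) + C ^ 2 / 4 + 1, hC0, ?_, ?_, ?_⟩
  · intro ρ z hρ hz
    have h1 := hlip (scaleU ρ z) z
    have h2 : ‖scaleU ρ z - z‖ = (ρ - 1) * ‖z.1‖ := by
      have : scaleU ρ z - z = ((ρ - 1) • z.1, 0) := by
        ext i <;> simp [scaleU]; ring
      rw [this, Prod.norm_mk, norm_zero, max_eq_left (norm_nonneg _), norm_smul,
        Real.norm_of_nonneg (by linarith)]
    have h3 : modelQ (scaleU ρ z) = modelQ z - (ρ ^ 2 - 1) * ∑ i, z.1 i ^ 2 := by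
      simp only [modelQ, scaleU, Pi.smul_apply, smul_eq_mul, mul_pow, ← Finset.mul_sum]
      ring
    have h4 := sq_norm_le_sum z.1
    have h5 : (ρ ^ 2 - 1) * ‖z.1‖ ^ 2 ≤ (ρ ^ 2 - 1) * ∑ i, z.1 i ^ 2 :=
      mul_le_mul_of_nonneg_left h4 (by nlinarith)
    have h6 : C * ((ρ - 1) * ‖z.1‖) ≤ (ρ ^ 2 - 1) * ‖z.1‖ ^ 2 := by
      have : (0 : ℝ) ≤ (ρ - 1) * ‖z.1‖ * ((ρ + 1) * ‖z.1‖ - C) := by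
        refine mul_nonneg (mul_nonneg (by linarith) (norm_nonneg _)) ?_
        nlinarith [norm_nonneg z.1]
      nlinarith
    rw [h2] at h1
    have := (abs_le.1 h1).2
    rw [hf, hf z, h3]
    linarith
  · intro z hz
    by_contra! hlt
    have h1 := (abs_le.1 (hl0 z)).1
    have h2 := sq_norm_le_sum z.2
    have h3 := sum_le_sq_norm z.1
    have h4 : (k : ℝ) * ‖z.1‖ ^ 2 ≤ k * (C + 1) ^ 2 :=
      mul_le_mul_of_nonneg_left (pow_le_pow_left₀ (norm_nonneg _) hlt.le 2) hk0
    have h5 : C * ‖z.1‖ ≤ C * (C + 1) := mul_le_mul_of_nonneg_left hlt.le hC0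
    have h6 : 0 ≤ (‖z.2‖ - C / 2) ^ 2 := sq_nonneg _
    have h7 : f z = ∑ i, z.2 i ^ 2 - ∑ i, z.1 i ^ 2 + l z := hf z
    nlinarith
  · intro a
    -- With `W = 1 + ‖w‖` the condition gives `‖u‖ - C ≥ (k + |l 0| + C + |a| + 1) W`, so `-‖u‖² +
    -- C‖u‖` outweighs `k W²`, the Lipschitz term in `w` and the constants.
    refine ⟨C + k + |l 0| + C + |a| + 1, fun a' ha' z hz => ?_⟩
    change a' * (1 + ‖z.2‖) ≤ ‖z.1‖ at hz
    have h1 := (abs_le.1 (hl0 z)).2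
    have h2 := sq_norm_le_sum z.1
    have h3 := sum_le_sq_norm z.2
    set W := 1 + ‖z.2‖ with hW
    have hW1 : 1 ≤ W := by have := norm_nonneg z.2; linarith
    have hzW : ‖z.2‖ ≤ W := by linarith
    have ha0 := abs_nonneg a
    have hl0' := abs_nonneg (l 0)
    have h4 : (k : ℝ) * ‖z.2‖ ^ 2 ≤ k * W ^ 2 :=
      mul_le_mul_of_nonneg_left (pow_le_pow_left₀ (norm_nonneg _) hzW 2) hk0
    have h5 : C * ‖z.2‖ ≤ C * W := mul_le_mul_of_nonneg_left hzW hC0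
    have ha'1 : 1 ≤ a' := by linarith
    have h6 : W ≤ ‖z.1‖ := le_trans (by nlinarith) hz
    have h7 : (k + |l 0| + C + |a| + 1) * W ≤ ‖z.1‖ - C := by nlinarith
    have h8 : (k + |l 0| + C + |a| + 1) * W * W ≤ (‖z.1‖ - C) * ‖z.1‖ :=
      mul_le_mul h7 h6 (by linarith) (le_trans (by positivity) h7)
    have hWW : W ≤ W * W := by nlinarith
    have h9 : (|l 0| + C + |a| + 1) * W ≤ (|l 0| + C + |a| + 1) * (W * W) :=
      mul_le_mul_of_nonneg_left hWW (by linarith)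
    have h10 : |l 0| + |a| + 1 ≤ (|l 0| + |a| + 1) * W := by nlinarith
    have h11 : f z = ∑ i, z.2 i ^ 2 - ∑ i, z.1 i ^ 2 + l z := hf z
    have h12 := le_abs_self a
    have h12' := neg_abs_le a
    nlinarith

lemma subset_far {k : ℕ} {s : Set (Model k)} (hs : IsCompact s) (h : s ⊆ offPos k) (a : ℝ) :
    ∃ ρ₀ : ℝ, ∀ ρ ≥ ρ₀, ∀ z ∈ s, scaleU ρ z ∈ far k a := by
  have hpos : ∀ z ∈ s, ‖z.1‖ ≠ 0 := fun z hz => norm_ne_zero_iff.2 (h hz)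
  obtain ⟨D, hD⟩ := (hs.image_of_continuousOn (f := fun z => a * (1 + ‖z.2‖) / ‖z.1‖)
    (ContinuousOn.div (by fun_prop) (by fun_prop) hpos)).bddAbove
  refine ⟨max D 0, fun ρ hρ z hz => ?_⟩
  have h1 : a * (1 + ‖z.2‖) / ‖z.1‖ ≤ ρ := (hD ⟨z, hz, rfl⟩).trans ((le_max_left _ _).trans hρ)
  have h2 : 0 < ‖z.1‖ := lt_of_le_of_ne (norm_nonneg _) (hpos z hz).symm
  change a * (1 + ‖z.2‖) ≤ ‖ρ • z.1‖
  rw [norm_smul, Real.norm_of_nonneg ((le_max_right _ _).trans hρ)]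
  rwa [div_le_iff₀ h2] at h1

lemma sublevel_subset_offPos {k : ℕ} {f : Model k → ℝ} {R a₀ a : ℝ} (hR : 0 ≤ R)
    (h3 : ∀ z, f z ≤ -a₀ → R + 1 ≤ ‖z.1‖) (ha : a₀ ≤ a) : {z | f z ≤ -a} ⊆ offPos k := by
  intro z hz h0
  have := h3 z (le_trans hz (by linarith))
  rw [h0, norm_zero] at this
  linarith

/-- Relative cycles whose homology class is non-trivial off the positive space. -/
def IsLinking {k : ℕ} (σ : SChain (Model k) (k + 1)) : Prop :=
  carr (bd σ) ⊆ offPos k ∧ ¬ Trivial (offPos k) σ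

/-- A chain avoiding `{u = 0}` has compact carrier, so multiplying `u` by a large factor sends it
into `far`, below `-a`. Meanwhile the boundary of `σ`, already below `-a`, only goes further down.
The test set `offPos` no longer depends on `f` or `a`. -/
lemma QuadLip.trivial_sublevel_iff {k : ℕ} {f : Model k → ℝ} (h : QuadLip f) :
    ∃ a₀ : ℝ, ∀ a ≥ a₀, {z | f z ≤ -a} ⊆ offPos k ∧
      ∀ {n : ℕ} (σ : SChain (Model k) (n + 1)), carr (bd σ) ⊆ {z | f z ≤ -a} →
        (Trivial {z | f z ≤ -a} σ ↔ Trivial (offPos k) σ) := by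
  obtain ⟨R, a₀, hR, h2, h3, h4⟩ := h.exists_bounds
  refine ⟨a₀, fun a ha => ?_⟩
  have hsub := sublevel_subset_offPos hR h3 ha
  refine ⟨hsub, fun {n} σ hσ => ⟨fun ht => ht.mono hsub, fun ⟨b, e, he, hbe⟩ => ?_⟩⟩
  obtain ⟨a', ha'⟩ := h4 a
  obtain ⟨ρ₀, hρ₀⟩ := subset_far (isCompact_carr e) he a'
  set s := max 0 (ρ₀ - 1) with hs
  have hs0 : 0 ≤ s := le_max_left _ _
  have hs1 : ρ₀ ≤ 1 + s := by have := le_max_right 0 (ρ₀ - 1); linarith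
  set g : C(Model k × ℝ, Model k) := ⟨fun y => scaleU (1 + y.2 * s) y.1, by
    unfold scaleU; fun_prop⟩ with hg
  rw [← trivial_push_iff_self g (fun z => by simp [hg, scaleU])]
  · refine ⟨push (atTime g 1) b, push (atTime g 1) e, carr_push_subset fun z hz => ?_, ?_⟩
    · refine ha' a' le_rfl _ ?_
      change scaleU (1 + 1 * s) z ∈ far k a'
      exact hρ₀ _ (by linarith) z hz
    · rw [hbe, map_add, bd_push]
  · intro z hz r hr
    have hz' : f z ≤ -a := hσ hz
    refine (h2 (1 + r * s) z ?_ ?_).trans hz'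
    · have := mul_nonneg hr.1 hs0
      linarith
    · have := h3 z (by linarith)
      linarith

/-- The boundary of a linking cycle may be pushed to infinity without increasing `f`. -/
lemma QuadLip.exists_far {k : ℕ} {f : Model k → ℝ} (h : QuadLip f) :
    ∃ a₀ : ℝ, ∀ a ≥ a₀, ∀ σ : SChain (Model k) (k + 1), carr (bd σ) ⊆ {z | f z ≤ -a} →
      ¬ Trivial (offPos k) σ → ∀ a', ∃ σ' : SChain (Model k) (k + 1),
        carr (bd σ') ⊆ far k a' ∧ ¬ Trivial (offPos k) σ' ∧
        ∀ z ∈ carr σ', ∃ z₀ ∈ carr σ, f z ≤ f z₀ := by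
  obtain ⟨R, a₀, hR, h2, h3, h4⟩ := h.exists_bounds
  refine ⟨a₀, fun a ha σ hσ hn a' => ?_⟩
  have hsub := sublevel_subset_offPos hR h3 ha
  obtain ⟨ρ₀, hρ₀⟩ := subset_far (isCompact_carr (bd σ)) (hσ.trans hsub) a'
  set s := max 0 (ρ₀ - 1) with hs
  have hs0 : 0 ≤ s := le_max_left _ _
  have hs1 : ρ₀ ≤ 1 + s := by have := le_max_right 0 (ρ₀ - 1); linarith
  -- A cut-off: scaling acts fully where `‖u‖ ≥ R + 1`, in particular on the boundary, and not at
  -- all where `‖u‖ ≤ R`, where it might increase `f`.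
  set χ : Model k → ℝ := fun z => max 0 (min 1 (‖z.1‖ - R)) with hχ
  have hχ0 : ∀ z, 0 ≤ χ z := fun z => le_max_left _ _
  set g : C(Model k × ℝ, Model k) := ⟨fun y => scaleU (1 + y.2 * (s * χ y.1)) y.1, by
    unfold scaleU; fun_prop⟩ with hg
  have hgz : ∀ z r, g (z, r) = scaleU (1 + r * (s * χ z)) z := fun z r => rfl
  refine ⟨push (atTime g 1) σ, ?_, ?_, fun z hz => ?_⟩
  · rw [bd_push]
    refine carr_push_subset fun z hz => ?_
    have hz' : f z ≤ -a := hσ hz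
    have h5 := h3 z (by linarith)
    have : χ z = 1 := by
      simp only [hχ]
      rw [min_eq_left (by linarith), max_eq_right zero_le_one]
    rw [atTime_apply, hgz, this]
    exact hρ₀ _ (by linarith) z hz
  · rw [trivial_push_iff_self g (fun z => by simp [hgz, scaleU])]
    · exact hn
    · intro z hz r hr
      rw [hgz]
      have hz' : z.1 ≠ 0 := hsub (hσ hz)
      have := mul_nonneg hr.1 (mul_nonneg hs0 (hχ0 z))
      exact smul_ne_zero (by linarith) hz'
  · obtain ⟨z₀, hz₀, rfl⟩ := carr_push _ _ hz
    refine ⟨z₀, hz₀, ?_⟩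
    rw [atTime_apply, hgz]
    rcases le_total R ‖z₀.1‖ with hle | hle
    · refine h2 _ _ ?_ hle
      have := mul_nonneg hs0 (hχ0 z₀)
      linarith
    · have : χ z₀ = 0 := by
        simp only [hχ]
        exact max_eq_left ((min_le_right _ _).trans (by linarith))
      simp [this, scaleU]

/-! ### Existence of linking cycles -/

/-- Insertion of two new coordinates, the second one being zero. -/
def insertCoord (k : ℕ) : C(Model k × ℝ, Model (k + 1)) :=
  ⟨fun y => (Fin.cons y.2 y.1.1, Fin.cons 0 y.1.2), by
    refine Continuous.prodMk (continuous_pi fun i => ?_) (continuous_pi fun i => ?_) <;>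
    · refine Fin.cases ?_ (fun j => ?_) i <;> simp only [Fin.cons_zero, Fin.cons_succ] <;>
        fun_prop⟩

/-- The coordinates of `M (k + 1)`, except for the first one of `w`. -/
def dropCoord (k : ℕ) : C(Model (k + 1), Model k × ℝ) :=
  ⟨fun z => ((Fin.tail z.1, Fin.tail z.2), z.1 0), by unfold Fin.tail; fun_prop⟩

lemma insertCoord_apply {k : ℕ} (y : Model k × ℝ) :
    insertCoord k y = (Fin.cons y.2 y.1.1, Fin.cons 0 y.1.2) := rfl

lemma dropCoord_apply {k : ℕ} (z : Model (k + 1)) :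
    dropCoord k z = ((Fin.tail z.1, Fin.tail z.2), z.1 0) := rfl

lemma dropCoord_insertCoord (k : ℕ) :
    (dropCoord k).comp (insertCoord k) = ContinuousMap.id _ := by
  ext1 y
  simp [dropCoord_apply, insertCoord_apply]

lemma insertCoord_mem {k : ℕ} {y : Model k × ℝ} (hy : y ∈ suspSet (offPos k)) :
    insertCoord k y ∈ offPos (k + 1) := by
  intro h0
  have hc : ∀ i, (Fin.cons y.2 y.1.1 : Fin (k + 1) → ℝ) i = 0 := fun i => congrFun h0 i
  rcases hy with hy | hy
  · exact hy (funext fun i => by simpa using hc i.succ)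
  · exact hy (by simpa using hc 0)

lemma dropCoord_mem {k : ℕ} {z : Model (k + 1)} (hz : z ∈ offPos (k + 1)) :
    dropCoord k z ∈ suspSet (offPos k) := by
  by_cases h0 : z.1 0 = 0
  · refine Or.inl fun h => hz (funext fun i => ?_)
    refine Fin.cases h0 (fun j => ?_) i
    exact congrFun h j
  · exact Or.inr h0

lemma not_trivial_push_insertCoord {k n : ℕ} {b : SChain (Model k × ℝ) (n + 1)}
    (h : ¬ Trivial (suspSet (offPos k)) b) : ¬ Trivial (offPos (k + 1)) (push (insertCoord k) b) := by
  intro ht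
  have := ht.push (dropCoord k) (B := suspSet (offPos k)) fun z hz => dropCoord_mem hz
  rw [push_push, dropCoord_insertCoord, push_id] at this
  exact h this

/-- Dropping and reinserting only annihilates the first coordinate of `w`; the linear homotopy to
the identity does not touch `u`, hence preserves `offPos`. -/
lemma not_trivial_push_dropCoord {k n : ℕ} {σ : SChain (Model (k + 1)) (n + 1)}
    (hσ : carr (bd σ) ⊆ offPos (k + 1)) (h : ¬ Trivial (offPos (k + 1)) σ) :
    ¬ Trivial (suspSet (offPos k)) (push (dropCoord k) σ) := by
  intro ht
  have h1 := ht.push (insertCoord k) (B := offPos (k + 1)) fun y hy => insertCoord_mem hy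
  rw [push_push] at h1
  set g : C(Model (k + 1) × ℝ, Model (k + 1)) :=
    ⟨fun y => (y.1.1, fun i => if i = 0 then (1 - y.2) * y.1.2 0 else y.1.2 i), by
      refine Continuous.prodMk (by fun_prop) (continuous_pi fun i => ?_)
      split_ifs <;> fun_prop⟩ with hg
  apply h
  rw [← trivial_push_iff_self g]
  · convert h1 using 2
    congr 1
    ext1 z
    refine Prod.ext ?_ ?_
    · simp [hg, insertCoord_apply, dropCoord_apply]
    · funext i
      refine Fin.cases ?_ (fun j => ?_) i <;>
        simp [hg, insertCoord_apply, dropCoord_apply, Fin.tail]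
  · intro z
    refine Prod.ext rfl (funext fun i => ?_)
    simp only [hg, ContinuousMap.coe_mk, sub_zero, one_mul]
    split_ifs with hi
    · rw [hi]
    · rfl
  · intro z hz r _
    exact show z.1 ≠ 0 from hσ hz

/-- The singular point, as a chain, is not a boundary. -/
lemma not_trivial_point {X : Type*} [TopologicalSpace X] (σ : C(stdSimplex ℝ (Fin 1), X)) :
    ¬ Trivial ∅ (Finsupp.single σ (1 : ZMod 2)) := by
  rintro ⟨b, e, he, hbe⟩
  have he0 : e = 0 := by
    by_contra hne
    obtain ⟨τ, hτ⟩ := Finsupp.support_nonempty_iff.2 hne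
    exact (range_subset_carr hτ).trans he (mem_range_self (vert 1 0))
  rw [he0, add_zero] at hbe
  -- In the augmented complex the boundary of a point is the empty simplex, which is not zero.
  have h0 : bd (Finsupp.single σ (1 : ZMod 2)) = 0 := by rw [hbe, SChain.bd_bd]
  rw [SChain.bd_single, Fin.sum_univ_one] at h0
  exact one_ne_zero (Finsupp.single_eq_zero.1 h0)

/-- A point for `k = 0`, suspended once for each further coordinate of `u`: in effect a disc of the
negative space modulo its boundary sphere. -/
lemma exists_isLinking (k : ℕ) : ∃ σ : SChain (Model k) (k + 1), IsLinking σ := by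
  induction k with
  | zero =>
    have h0 : offPos 0 = ∅ := by
      refine eq_empty_of_forall_notMem fun z hz => hz (Subsingleton.elim _ _)
    refine ⟨Finsupp.single (ContinuousMap.const _ 0) 1, ?_, ?_⟩
    · rw [carr_eq_empty_of_zero]; exact empty_subset _
    · rw [h0]; exact not_trivial_point _
  | succ k ih =>
    obtain ⟨σ, hσ, hn⟩ := ih
    obtain ⟨b, -, h2, h3⟩ := exists_suspension (isOpen_offPos k) hσ hn one_pos
    refine ⟨push (insertCoord k) b, ?_, not_trivial_push_insertCoord h3⟩
    rw [bd_push]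
    refine carr_push_subset fun y hy => insertCoord_mem ?_
    rcases h2 hy with h | h
    · refine Or.inr fun h0 => ?_
      have := h.2
      rw [h0] at this
      simp at this
    · exact Or.inl (hσ h.1)

/-! ### The minmax in the model space -/

/-- The maxima of `f` over the descending cycles of the level `-a`. -/
def modelMax {k : ℕ} (f : Model k → ℝ) (a : ℝ) : Set ℝ :=
  {m | ∃ σ : SChain (Model k) (k + 1), carr (bd σ) ⊆ {z | f z ≤ -a} ∧
    ¬ Trivial {z | f z ≤ -a} σ ∧ IsGreatest (f '' carr σ) m}

/-- `r` is the minmax of `f`. -/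
def IsModelMinmax {k : ℕ} (f : Model k → ℝ) (r : ℝ) : Prop :=
  ∀ᶠ a : ℝ in atTop, IsGLB (modelMax f a) r

lemma far_subset_offPos {k : ℕ} {a : ℝ} (ha : 0 < a) : far k a ⊆ offPos k := by
  intro z hz h0
  change a * (1 + ‖z.2‖) ≤ ‖z.1‖ at hz
  rw [h0, norm_zero] at hz
  have := norm_nonneg z.2
  nlinarith

lemma nonempty_carr {k n : ℕ} {σ : SChain (Model k) (n + 1)} {A : Set (Model k)}
    (h : ¬ Trivial A σ) : (carr σ).Nonempty := by
  by_contra he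
  exact h (trivial_of_carr ((not_nonempty_iff_eq_empty.1 he).subset.trans (empty_subset _)))

lemma exists_isGreatest {k n : ℕ} {f : Model k → ℝ} (hf : Continuous f)
    {σ : SChain (Model k) (n + 1)} {A : Set (Model k)} (h : ¬ Trivial A σ) :
    ∃ m, IsGreatest (f '' carr σ) m :=
  ((isCompact_carr σ).image hf).exists_isGreatest ((nonempty_carr h).image f)

/-- Collects what linking gives at every large level. A non-trivial cycle must meet `{u = 0}`, where
`f > -a₀`; non-triviality can be tested off the positive space; and the boundary can be sent to
infinity without raising the maximum. -/
lemma QuadLip.exists_modelMax {k : ℕ} {f : Model k → ℝ} (h : QuadLip f) :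
    ∃ a₀ : ℝ, ∀ a ≥ a₀, (∀ m ∈ modelMax f a, -a₀ ≤ m) ∧
      (∀ σ : SChain (Model k) (k + 1), carr (bd σ) ⊆ {z | f z ≤ -a} → ¬ Trivial (offPos k) σ →
        ∃ m ∈ modelMax f a, IsGreatest (f '' carr σ) m) ∧
      ∀ m ∈ modelMax f a, ∀ a', ∃ σ : SChain (Model k) (k + 1),
        carr (bd σ) ⊆ far k a' ∧ ¬ Trivial (offPos k) σ ∧ ∀ z ∈ carr σ, f z ≤ m := by
  obtain ⟨R, b₀, hR, h2, h3, h4⟩ := h.exists_bounds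
  obtain ⟨a₁, h1⟩ := h.trivial_sublevel_iff
  obtain ⟨a₂, h2⟩ := h.exists_far
  refine ⟨max b₀ (max a₁ a₂), fun a ha => ?_⟩
  have hb : b₀ ≤ a := (le_max_left _ _).trans ha
  have ha1 : a₁ ≤ a := (le_max_left _ _).trans ((le_max_right _ _).trans ha)
  have ha2 : a₂ ≤ a := (le_max_right _ _).trans ((le_max_right _ _).trans ha)
  obtain ⟨hsub, hiff⟩ := h1 a ha1
  refine ⟨?_, ?_, ?_⟩
  · rintro m ⟨σ, hσ, hn, hm⟩
    rw [hiff σ hσ] at hn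
    have : ¬ carr σ ⊆ offPos k := fun hc => hn (trivial_of_carr hc)
    obtain ⟨z, hz, hz0⟩ := not_subset.1 this
    have hz0 : z.1 = 0 := not_not.1 hz0
    have h5 : f z ≤ m := hm.2 ⟨z, hz, rfl⟩
    have h6 : -b₀ < f z := by
      by_contra! hle
      have := h3 z hle
      rw [hz0, norm_zero] at this
      linarith
    have := le_max_left b₀ (max a₁ a₂)
    linarith
  · intro σ hσ hn
    obtain ⟨m, hm⟩ := exists_isGreatest h.continuous hn
    exact ⟨m, ⟨σ, hσ, fun ht => hn ((hiff σ hσ).1 ht), hm⟩, hm⟩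
  · rintro m ⟨σ, hσ, hn, hm⟩ a'
    rw [hiff σ hσ] at hn
    obtain ⟨σ', h5, h6, h7⟩ := h2 a ha2 σ hσ hn a'
    refine ⟨σ', h5, h6, fun z hz => ?_⟩
    obtain ⟨z₀, hz₀, hle⟩ := h7 z hz
    exact hle.trans (hm.2 ⟨z₀, hz₀, rfl⟩)

/-- A cycle for one level, its boundary sent far enough, is a cycle for any other large level with
no larger maximum. So the value sets of two levels have the same infimum; a linking cycle scaled to
infinity shows that they are not empty. -/
lemma QuadLip.exists_isModelMinmax {k : ℕ} {f : Model k → ℝ} (h : QuadLip f) :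
    ∃ r, IsModelMinmax f r := by
  obtain ⟨a₀, h₀⟩ := h.exists_modelMax
  obtain ⟨-, -, -, -, -, h4⟩ := h.exists_bounds
  have hne : ∀ a ≥ a₀, (modelMax f a).Nonempty := by
    intro a ha
    obtain ⟨a', ha'⟩ := h4 a
    obtain ⟨σ, hσ, hn⟩ := exists_isLinking k
    obtain ⟨ρ₀, hρ₀⟩ := subset_far (isCompact_carr (bd σ)) hσ a'
    set s := max 0 (ρ₀ - 1) with hs
    have hs0 : 0 ≤ s := le_max_left _ _
    have hs1 : ρ₀ ≤ 1 + s := by have := le_max_right 0 (ρ₀ - 1); linarith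
    set g : C(Model k × ℝ, Model k) := ⟨fun y => scaleU (1 + y.2 * s) y.1, by
      unfold scaleU; fun_prop⟩ with hg
    obtain ⟨m, hm, -⟩ := (h₀ a ha).2.1 (push (atTime g 1) σ) (by
      rw [bd_push]
      refine carr_push_subset fun z hz => ha' a' le_rfl _ ?_
      change scaleU (1 + 1 * s) z ∈ far k a'
      exact hρ₀ _ (by linarith) z hz) (by
      rw [trivial_push_iff_self g (fun z => by simp [hg, scaleU])]
      · exact hn
      · intro z hz r hr
        have hz' : z.1 ≠ 0 := hσ hz
        have := mul_nonneg hr.1 hs0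
        exact smul_ne_zero (by linarith) hz')
    exact ⟨m, hm⟩
  have hdom : ∀ a ≥ a₀, ∀ b ≥ a₀, ∀ m ∈ modelMax f a, ∃ m' ∈ modelMax f b, m' ≤ m := by
    intro a ha b hb m hm
    obtain ⟨a', ha'⟩ := h4 b
    obtain ⟨σ, h5, h6, h7⟩ := (h₀ a ha).2.2 m hm a'
    obtain ⟨m', hm', hg⟩ := (h₀ b hb).2.1 σ (fun z hz => ha' a' le_rfl z (h5 hz)) h6
    refine ⟨m', hm', ?_⟩
    obtain ⟨z, hz, rfl⟩ := hg.1
    exact h7 z hz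
  have hbdd : ∀ a ≥ a₀, BddBelow (modelMax f a) := fun a ha => ⟨-a₀, (h₀ a ha).1⟩
  refine ⟨sInf (modelMax f a₀), eventually_atTop.2 ⟨a₀, fun a ha => ?_⟩⟩
  have : sInf (modelMax f a₀) = sInf (modelMax f a) := by
    refine le_antisymm (le_csInf (hne a ha) fun m hm => ?_)
      (le_csInf (hne _ le_rfl) fun m hm => ?_)
    · obtain ⟨m', hm', hle⟩ := hdom a ha a₀ le_rfl m hm
      exact (csInf_le (hbdd _ le_rfl) hm').trans hle
    · obtain ⟨m', hm', hle⟩ := hdom a₀ le_rfl a ha m hm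
      exact (csInf_le (hbdd a ha) hm').trans hle
  rw [this]
  exact isGLB_csInf (hne a ha) (hbdd a ha)

/-- Almost minimizing cycles, with boundary arbitrarily far. -/
lemma IsModelMinmax.exists_cycle {k : ℕ} {f : Model k → ℝ} {r : ℝ} (h : IsModelMinmax f r)
    (hf : QuadLip f) {ε : ℝ} (hε : 0 < ε) (a' : ℝ) :
    ∃ σ : SChain (Model k) (k + 1), carr (bd σ) ⊆ far k a' ∧ ¬ Trivial (offPos k) σ ∧
      ∀ z ∈ carr σ, f z ≤ r + ε := by
  obtain ⟨a₀, h₀⟩ := hf.exists_modelMax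
  obtain ⟨a, ha, ha₀⟩ := (h.and (eventually_ge_atTop a₀)).exists
  have : ¬ r + ε ∈ lowerBounds (modelMax f a) := fun hl => by
    have := ha.2 hl
    linarith
  simp only [lowerBounds, mem_ofPred_eq, not_forall] at this
  obtain ⟨m, hm, hlt⟩ := this
  obtain ⟨σ, h5, h6, h7⟩ := (h₀ a ha₀).2.2 m hm a'
  exact ⟨σ, h5, h6, fun z hz => (h7 z hz).trans (not_le.1 hlt).le⟩

lemma IsModelMinmax.le_of_cycle {k : ℕ} {f : Model k → ℝ} {r : ℝ} (h : IsModelMinmax f r)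
    (hf : QuadLip f) :
    ∃ a₀ : ℝ, ∀ a ≥ a₀, ∀ (σ : SChain (Model k) (k + 1)) (m : ℝ), carr (bd σ) ⊆ {z | f z ≤ -a} →
      ¬ Trivial (offPos k) σ → (∀ z ∈ carr σ, f z ≤ m) → r ≤ m := by
  obtain ⟨a₀, h₀⟩ := hf.exists_modelMax
  obtain ⟨a₁, h₁⟩ := eventually_atTop.1 h
  refine ⟨max a₀ a₁, fun a ha σ m h2 h3 h4 => ?_⟩
  obtain ⟨m', hm', hg⟩ := (h₀ a ((le_max_left _ _).trans ha)).2.1 σ h2 h3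
  refine ((h₁ a ((le_max_right _ _).trans ha)).1 hm').trans ?_
  obtain ⟨z, hz, rfl⟩ := hg.1
  exact h4 z hz

/-- Comparison of two minmax values by means of a deformation. -/
theorem IsModelMinmax.le_add {k : ℕ} {f₁ f₂ : Model k → ℝ} {r₁ r₂ δ : ℝ}
    (h₁ : IsModelMinmax f₁ r₁) (h₂ : IsModelMinmax f₂ r₂) (hf₁ : QuadLip f₁) (hf₂ : QuadLip f₂)
    (a : ℝ) (hG : ∀ (K : Set (Model k)) (B : ℝ), IsCompact K → ∃ G : C(Model k × ℝ, Model k),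
      (∀ z, G (z, 0) = z) ∧ (∀ z ∈ K, f₁ (G (z, 1)) ≤ max (f₂ z + δ) (-B)) ∧
      ∀ z, f₁ z ≤ -a → f₂ z ≤ -a → a ≤ ‖z.1‖ → ∀ r ∈ Icc (0 : ℝ) 1, G (z, r) ∈ offPos k) :
    r₁ ≤ r₂ + δ := by
  refine le_of_forall_pos_le_add fun ε hε => ?_
  obtain ⟨a₀, h₀⟩ := h₁.le_of_cycle hf₁
  obtain ⟨-, -, -, -, -, hfar₁⟩ := hf₁.exists_bounds
  obtain ⟨-, -, -, -, -, hfar₂⟩ := hf₂.exists_bounds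
  -- `B ≥ a₀` keeps the deformed boundary in the sublevel, and `B ≥ 1 - r₁` excludes the alternative
  -- `r₁ ≤ -B`.
  set B := max a₀ (-r₁ + 1)
  obtain ⟨b₁, hb₁⟩ := hfar₁ a
  obtain ⟨b₂, hb₂⟩ := hfar₂ (max a (a₀ + δ))
  set b := max (max b₁ b₂) (max a 0) with hb
  have hbb₁ : b₁ ≤ b := (le_max_left _ _).trans (le_max_left _ _)
  have hbb₂ : b₂ ≤ b := (le_max_right _ _).trans (le_max_left _ _)
  have hba : a ≤ b := (le_max_left _ _).trans (le_max_right _ _)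
  have hb0 : 0 ≤ b := (le_max_right _ _).trans (le_max_right _ _)
  obtain ⟨σ, h5, h6, h7⟩ := h₂.exists_cycle hf₂ hε b
  obtain ⟨G, hG0, hG1, hG2⟩ := hG (carr σ) B (isCompact_carr σ)
  have h8 := h₀ a₀ le_rfl (push (atTime G 1) σ) (max (r₂ + δ + ε) (-B)) ?_ ?_ ?_
  · rcases le_max_iff.1 h8 with h9 | h9
    · exact h9
    · have := le_max_right a₀ (-r₁ + 1)
      linarith
  · rw [bd_push]
    refine carr_push_subset fun z hz => ?_
    have h9 : f₂ z ≤ -(max a (a₀ + δ)) := hb₂ b hbb₂ z (h5 hz)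
    have h10 := le_max_right a (a₀ + δ)
    have h11 := le_max_left a₀ (-r₁ + 1)
    exact (hG1 z (carr_bd σ hz)).trans (max_le (by linarith) (by linarith))
  · rw [trivial_push_iff_self G hG0]
    · exact h6
    · intro z hz r hr
      have h9 : f₂ z ≤ -(max a (a₀ + δ)) := hb₂ b hbb₂ z (h5 hz)
      have h10 := le_max_left a (a₀ + δ)
      refine hG2 z (hb₁ b hbb₁ z (h5 hz)) (by linarith) ?_ r hr
      have h11 : b * (1 + ‖z.2‖) ≤ ‖z.1‖ := h5 hz
      have := mul_nonneg hb0 (norm_nonneg z.2)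
      linarith
  · intro z hz
    obtain ⟨z₀, hz₀, rfl⟩ := carr_push _ _ hz
    refine (hG1 z₀ hz₀).trans (max_le_max_right _ ?_)
    have := h7 z₀ hz₀
    linarith

/-! ### Stabilization -/

/-- Adding the quadratic form `w² - u²` in two new variables. -/
def stab {k : ℕ} (f : Model k → ℝ) (z : Model (k + 1)) : ℝ :=
  f (Fin.tail z.1, Fin.tail z.2) + (z.2 0 ^ 2 - z.1 0 ^ 2)

lemma QuadLip.stab {k : ℕ} {f : Model k → ℝ} (h : QuadLip f) : QuadLip (stab f) := by
  obtain ⟨C, hC⟩ := h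
  refine ⟨C, ?_⟩
  have hg : LipschitzWith 1 fun z : Model (k + 1) => ((Fin.tail z.1, Fin.tail z.2) : Model k) := by
    refine LipschitzWith.of_dist_le_mul fun z z' => ?_
    rw [NNReal.coe_one, one_mul, Prod.dist_eq, Prod.dist_eq]
    refine max_le_max ?_ ?_ <;> refine (dist_pi_le_iff dist_nonneg).2 fun i => ?_
    · exact dist_le_pi_dist z.1 z'.1 i.succ
    · exact dist_le_pi_dist z.2 z'.2 i.succ
  have := hC.comp hg
  rw [mul_one] at this
  convert this using 1
  funext z
  simp only [HamiltonJacobi.stab, modelQ, Function.comp, Fin.sum_univ_succ, Fin.tail]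
  ring

theorem IsModelMinmax.stab {k : ℕ} {f : Model k → ℝ} {r : ℝ} (h : IsModelMinmax f r)
    (hf : QuadLip f) : IsModelMinmax (stab f) r := by
  obtain ⟨r', h'⟩ := hf.stab.exists_isModelMinmax
  suffices r = r' by rwa [this]
  refine le_antisymm (le_of_forall_pos_le_add fun ε hε => ?_)
    (le_of_forall_pos_le_add fun ε hε => ?_)
  -- For `r ≤ r'`, an almost optimal cycle of `stab f` is sliced near `u₀ = 0` and the new
  -- coordinates are forgotten; dropping `w₀²` does not increase values, and dropping `-u₀²`
  -- increases them by at most `η`.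
  · obtain ⟨a₀, h₀⟩ := h.le_of_cycle hf
    obtain ⟨-, -, -, -, -, h4⟩ := hf.stab.exists_bounds
    -- `η ≤ 1` is spent on the boundary, chosen below `-(a₀ + 1)`, and `η ≤ ε / 2` on the maximum.
    set η := min 1 (ε / 2) with hη
    have hη0 : 0 < η := lt_min one_pos (by linarith)
    have hη2 : ∀ p : ℝ, |p| < η → p ^ 2 ≤ η := fun p hp => by
      have h1 : η ≤ 1 := min_le_left _ _
      have := abs_nonneg p
      rw [← sq_abs]
      nlinarith
    obtain ⟨a', ha'⟩ := h4 (a₀ + 1)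
    obtain ⟨σ, h5, h6, h7⟩ := h'.exists_cycle hf.stab (half_pos hε) (max a' 1)
    have hσ : carr (bd σ) ⊆ offPos (k + 1) :=
      h5.trans (far_subset_offPos (lt_of_lt_of_le one_pos (le_max_right _ _)))
    have hval : ∀ z : Model (k + 1), f (dropCoord k z).1 - (dropCoord k z).2 ^ 2
        ≤ HamiltonJacobi.stab f z := fun z => by
      simp only [dropCoord_apply, HamiltonJacobi.stab]
      have := sq_nonneg (z.2 0)
      linarith
    obtain ⟨τ, h8, h9, h10⟩ := exists_slice (isOpen_offPos k) (σ := push (dropCoord k) σ) (by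
      rw [bd_push]
      exact carr_push_subset fun z hz => dropCoord_mem (hσ hz))
      (not_trivial_push_dropCoord hσ h6) hη0
    refine h₀ a₀ le_rfl τ _ (fun x hx => ?_) h10 (fun x hx => ?_)
    · obtain ⟨-, p, hp, hxp⟩ := h9 x hx
      rw [bd_push] at hxp
      obtain ⟨z, hz, hzx⟩ := carr_push _ _ hxp
      have h11 := hval z
      have h12 := ha' _ (le_max_left _ _) z (h5 hz)
      rw [hzx] at h11
      have h13 := hη2 p hp
      have h14 : η ≤ 1 := min_le_left _ _
      change f x ≤ -a₀
      dsimp only at h11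
      linarith
    · obtain ⟨p, hp, hxp⟩ := h8 x hx
      obtain ⟨z, hz, hzx⟩ := carr_push _ _ hxp
      have h11 := hval z
      have h12 := h7 z hz
      rw [hzx] at h11
      have h13 := hη2 p hp
      have h14 : η ≤ ε / 2 := min_le_right _ _
      dsimp only at h11
      linarith
  -- For `r' ≤ r`, an almost optimal cycle of `f` is suspended: at height `p` the value is `f - p²`,
  -- so the maximum does not grow.
  · obtain ⟨a₀, h₀⟩ := h'.le_of_cycle hf.stab
    obtain ⟨-, -, -, -, -, h4⟩ := hf.exists_bounds
    obtain ⟨a', ha'⟩ := h4 a₀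
    obtain ⟨σ, h5, h6, h7⟩ := h.exists_cycle hf hε (max a' 1)
    have hσ : carr (bd σ) ⊆ offPos k :=
      h5.trans (far_subset_offPos (lt_of_lt_of_le one_pos (le_max_right _ _)))
    -- High enough for the two lids, where the value is at most `r + ε - L²`, to lie below `-a₀`.
    set L := 1 + |r + ε + a₀| with hL
    have hL0 : 0 < L := by positivity
    have hL2 : r + ε + a₀ ≤ L ^ 2 := by
      have := le_abs_self (r + ε + a₀)
      have := abs_nonneg (r + ε + a₀)
      nlinarith
    obtain ⟨b, h8, h9, h10⟩ := exists_suspension (isOpen_offPos k) hσ h6 hL0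
    have hval : ∀ y : Model k × ℝ, HamiltonJacobi.stab f (insertCoord k y) = f y.1 - y.2 ^ 2 := by
      intro y
      simp [insertCoord_apply, HamiltonJacobi.stab]
      ring
    refine h₀ a₀ le_rfl (push (insertCoord k) b) _ ?_ (not_trivial_push_insertCoord h10) ?_
    · rw [bd_push]
      refine carr_push_subset fun y hy => ?_
      change HamiltonJacobi.stab f (insertCoord k y) ≤ -a₀
      rw [hval]
      rcases h9 hy with h | h
      · have h11 := h7 _ h.1
        have h12 : y.2 ^ 2 = L ^ 2 := by
          rcases h.2 with h | h
          · rw [h]; ring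
          · rw [h]
        linarith
      · have h11 := ha' _ (le_max_left _ _) _ (h5 h.1)
        have := sq_nonneg y.2
        linarith
    · intro z hz
      obtain ⟨y, hy, rfl⟩ := carr_push _ _ hz
      rw [hval]
      have := h7 _ (h8 hy).1
      have := sq_nonneg y.2
      linarith

end

end HamiltonJacobi

/-! ### From the model space to quadratic forms on other spaces; iterated stabilization. -/

namespace HamiltonJacobi

noncomputable section

open SChain

/-! ### Transfer of the minmax to the model space -/

section Transfer

variable {V : Type*} [TopologicalSpace V]

lemma isRelCycle_iff {A : Set V} {n : ℕ} (c : Chain V n) :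
    IsRelCycle A c ↔ carr (SChain.bd (n := n) c) ⊆ A := by
  cases n with
  | zero =>
    rw [carr_eq_empty_of_zero]
    exact iff_of_true trivial (empty_subset _)
  | succ n =>
    rw [← boundary_eq_bd]
    rfl

lemma isRelBoundary_iff {A : Set V} {n : ℕ} (c : Chain V n) :
    IsRelBoundary A c ↔ SChain.Trivial (n := n) A c := by
  constructor
  · rintro ⟨b, e, he, h⟩
    exact ⟨b, e, he, by rw [h, boundary_eq_bd]⟩
  · rintro ⟨b, e, he, h⟩
    exact ⟨b, e, he, by rw [h, boundary_eq_bd]⟩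

variable [AddCommGroup V] [Module ℝ V]

/-- The type of the chains depends on `sigNeg Q`; naming it `k` by a substitution avoids
transporting chains between degrees. -/
lemma maxValues_eq {Q : QuadraticForm ℝ V} {k : ℕ} (hk : sigNeg Q = k) (f : V → ℝ) (a : ℝ) :
    maxValues Q f a = {m | ∃ σ : SChain V (k + 1), carr (SChain.bd σ) ⊆ {z | f z ≤ -a} ∧
      ¬ SChain.Trivial {z | f z ≤ -a} σ ∧ IsGreatest (f '' carr σ) m} := by
  subst hk
  ext m
  constructor
  · rintro ⟨σ, ⟨h1, h2⟩, h3⟩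
    exact ⟨σ, (isRelCycle_iff σ).1 h1, fun h => h2 ((isRelBoundary_iff σ).2 h), h3⟩
  · rintro ⟨σ, h1, h2, h3⟩
    exact ⟨σ, ⟨(isRelCycle_iff σ).2 h1, fun h => h2 ((isRelBoundary_iff σ).1 h)⟩, h3⟩

lemma sigNeg_eq {V : Type*} [AddCommGroup V] [Module ℝ V] {Q : QuadraticForm ℝ V} {k : ℕ} (e : V ≃ₗ[ℝ] Model k)
    (hQ : ∀ v, Q v = modelQ (e v)) : sigNeg Q = k := by
  set e' := e.trans (LinearEquiv.sumArrowLequivProdArrow (Fin k) (Fin k) ℝ ℝ).symm with he'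
  have hequiv : QuadraticMap.Equivalent Q (QuadraticMap.weightedSumSquares ℝ
      (Sum.elim (fun _ => -1) fun _ => 1 : Fin k ⊕ Fin k → ℝ)) := by
    refine ⟨⟨e', fun v => ?_⟩⟩
    rw [QuadraticMap.weightedSumSquares_apply, Fintype.sum_sum_type, hQ]
    simp only [Sum.elim_inl, Sum.elim_inr, modelQ, he']
    have h1 : ∀ i, e' v (Sum.inl i) = (e v).1 i := fun i => rfl
    have h2 : ∀ i, e' v (Sum.inr i) = (e v).2 i := fun i => rfl
    simp only [AddHom.toFun_eq_coe, LinearMap.coe_toAddHom, LinearEquiv.coe_coe]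
    simp only [← he', h1, h2, smul_eq_mul, neg_mul, one_mul, Finset.sum_neg_distrib]
    have h3 : ∀ x : ℝ, x * x = x ^ 2 := fun x => (sq x).symm
    simp only [h3]
    ring
  rw [QuadraticForm.sigNeg_of_equiv_weightedSumSquares hequiv]
  have : {i : Fin k ⊕ Fin k | (Sum.elim (fun _ => -1) fun _ => 1 : Fin k ⊕ Fin k → ℝ) i < 0}
      = range Sum.inl := by
    ext i
    rcases i with i | i <;> simp
  rw [this, ← image_univ, ncard_image_of_injective _ Sum.inl_injective, ncard_univ]
  simp

/-- A linear homeomorphism and its inverse carry cycles to cycles, preserve triviality modulo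
corresponding sublevels, and transport carriers exactly. -/
lemma isMinmax_iff {Q : QuadraticForm ℝ V} {k : ℕ} (e : V ≃L[ℝ] Model k)
    (hQ : ∀ v, Q v = modelQ (e v)) (f : V → ℝ) (r : ℝ) :
    IsMinmax Q f r ↔ IsModelMinmax (f ∘ e.symm) r := by
  have hk : sigNeg Q = k := sigNeg_eq e.toLinearEquiv hQ
  refine eventually_congr (Eventually.of_forall fun a => ?_)
  suffices maxValues Q f a = modelMax (f ∘ e.symm) a by rw [this]
  rw [maxValues_eq hk]
  set E : C(V, Model k) := ⟨e, e.continuous⟩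
  set E' : C(Model k, V) := ⟨e.symm, e.symm.continuous⟩
  have h1 : E'.comp E = ContinuousMap.id V := ContinuousMap.ext fun v => e.symm_apply_apply v
  have h2 : E.comp E' = ContinuousMap.id _ := ContinuousMap.ext fun v => e.apply_symm_apply v
  have hA : ∀ v ∈ {v | f v ≤ -a}, E v ∈ {z | (f ∘ e.symm) z ≤ -a} := fun v hv => by
    change f (e.symm (e v)) ≤ -a
    rwa [e.symm_apply_apply]
  have hA' : ∀ z ∈ {z | (f ∘ e.symm) z ≤ -a}, E' z ∈ {v | f v ≤ -a} := fun z hz => hz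
  have c1 : ∀ {n : ℕ} (σ : SChain V n), carr (push E σ) = E '' carr σ := fun σ => by
    refine (carr_push _ _).antisymm ?_
    rintro _ ⟨v, hv, rfl⟩
    have : push E' (push E σ) = σ := by rw [push_push, h1, push_id]
    rw [← this] at hv
    obtain ⟨z, hz, rfl⟩ := carr_push _ _ hv
    have h3 : E (E' z) = z := e.apply_symm_apply z
    rwa [h3]
  have c2 : ∀ {n : ℕ} (σ : SChain (Model k) n), carr (push E' σ) = E' '' carr σ := fun σ => by
    refine (carr_push _ _).antisymm ?_
    rintro _ ⟨v, hv, rfl⟩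
    have : push E (push E' σ) = σ := by rw [push_push, h2, push_id]
    rw [← this] at hv
    obtain ⟨z, hz, rfl⟩ := carr_push _ _ hv
    have h3 : E' (E z) = z := e.symm_apply_apply z
    rwa [h3]
  ext m
  constructor
  · rintro ⟨σ, h3, h4, h5⟩
    refine ⟨push E σ, ?_, fun ht => h4 ?_, ?_⟩
    · rw [bd_push]
      exact carr_push_subset fun v hv => hA v (h3 hv)
    · have := ht.push E' hA'
      rwa [push_push, h1, push_id] at this
    · rw [c1, ← image_comp]
      convert h5 using 2 with v
      exact congrArg f (e.symm_apply_apply v)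
  · rintro ⟨σ, h3, h4, h5⟩
    refine ⟨push E' σ, ?_, fun ht => h4 ?_, ?_⟩
    · rw [bd_push]
      exact carr_push_subset fun v hv => hA' v (h3 hv)
    · have := ht.push E hA
      rwa [push_push, h2, push_id] at this
    · rw [c2, ← image_comp]
      exact h5

end Transfer

/-! ### Iterated stabilization -/

section Extension

variable {V : Type*} [NormedAddCommGroup V] [NormedSpace ℝ V]

/-- The coordinates obtained from `e` by adding one pair of variables. -/
def addPair {k d : ℕ} (e : (V × (Fin d → ℝ) × (Fin d → ℝ)) ≃L[ℝ] Model (k + d)) :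
    (V × (Fin (d + 1) → ℝ) × (Fin (d + 1) → ℝ)) ≃L[ℝ] Model (k + (d + 1)) where
  toFun x := (Fin.cons (x.2.1 0) (e (x.1, Fin.tail x.2.1, Fin.tail x.2.2)).1,
    Fin.cons (x.2.2 0) (e (x.1, Fin.tail x.2.1, Fin.tail x.2.2)).2)
  invFun z := ((e.symm (Fin.tail z.1, Fin.tail z.2)).1,
    Fin.cons (z.1 0) (e.symm (Fin.tail z.1, Fin.tail z.2)).2.1,
    Fin.cons (z.2 0) (e.symm (Fin.tail z.1, Fin.tail z.2)).2.2)
  left_inv x := by simp [Fin.tail_cons]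
  right_inv z := by simp [Fin.tail_cons]
  map_add' x y := by
    have h : ((x + y).1, Fin.tail (x + y).2.1, Fin.tail (x + y).2.2)
      = (x.1, Fin.tail x.2.1, Fin.tail x.2.2) + (y.1, Fin.tail y.2.1, Fin.tail y.2.2) := rfl
    rw [h, map_add]
    refine Prod.ext ?_ ?_ <;> funext i <;> refine Fin.cases ?_ (fun j => ?_) i <;> simp
  map_smul' c x := by
    have h : ((c • x).1, Fin.tail (c • x).2.1, Fin.tail (c • x).2.2)
      = c • (x.1, Fin.tail x.2.1, Fin.tail x.2.2) := rfl
    rw [h, map_smul]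
    refine Prod.ext ?_ ?_ <;> funext i <;> refine Fin.cases ?_ (fun j => ?_) i <;> simp
  continuous_toFun := by
    have h : Continuous fun x : V × (Fin (d + 1) → ℝ) × (Fin (d + 1) → ℝ) =>
        e (x.1, Fin.tail x.2.1, Fin.tail x.2.2) := by
      refine e.continuous.comp ?_
      unfold Fin.tail
      fun_prop
    refine Continuous.prodMk (continuous_pi fun i => ?_) (continuous_pi fun i => ?_) <;>
      refine Fin.cases ?_ (fun j => ?_) i <;> simp only [Fin.cons_zero, Fin.cons_succ] <;> fun_prop
  continuous_invFun := by
    have h : Continuous fun z : Model (k + (d + 1)) =>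
        e.symm (Fin.tail (n := k + d) z.1, Fin.tail (n := k + d) z.2) := by
      refine e.symm.continuous.comp ?_
      unfold Fin.tail
      fun_prop
    refine Continuous.prodMk (by fun_prop) (Continuous.prodMk (continuous_pi fun i => ?_)
      (continuous_pi fun i => ?_)) <;>
      refine Fin.cases ?_ (fun j => ?_) i <;> simp only [Fin.cons_zero, Fin.cons_succ] <;> fun_prop

lemma modelQ_cons {k : ℕ} (p m : ℝ) (u w : Fin k → ℝ) :
    modelQ ((Fin.cons p u, Fin.cons m w) : Model (k + 1)) = modelQ (u, w) + (m ^ 2 - p ^ 2) := by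
  simp only [modelQ, Fin.sum_univ_succ, Fin.cons_zero, Fin.cons_succ]
  ring

lemma exists_frame_pi {k : ℕ} (e : V ≃L[ℝ] Model k) (d : ℕ) :
    ∃ e' : (V × (Fin d → ℝ) × (Fin d → ℝ)) ≃L[ℝ] Model (k + d),
      (∀ x, modelQ (e' x) = modelQ (e x.1) + (∑ i, x.2.2 i ^ 2 - ∑ i, x.2.1 i ^ 2)) ∧
      ∀ (f : V → ℝ) (r : ℝ), QuadLip (f ∘ e.symm) → IsModelMinmax (f ∘ e.symm) r →
        QuadLip ((fun x => f x.1 + (∑ i, x.2.2 i ^ 2 - ∑ i, x.2.1 i ^ 2)) ∘ e'.symm) ∧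
        IsModelMinmax ((fun x => f x.1 + (∑ i, x.2.2 i ^ 2 - ∑ i, x.2.1 i ^ 2)) ∘ e'.symm) r := by
  induction d with
  | zero =>
    set e' : (V × (Fin 0 → ℝ) × (Fin 0 → ℝ)) ≃L[ℝ] Model (k + 0) :=
      { toFun := fun x => e x.1
        invFun := fun z => (e.symm z, 0, 0)
        left_inv := fun x => by
          refine Prod.ext (by simp) (Prod.ext (Subsingleton.elim _ _) (Subsingleton.elim _ _))
        right_inv := fun z => by simp
        map_add' := fun x y => by simp
        map_smul' := fun x y => by simp
        continuous_toFun := by fun_prop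
        continuous_invFun := by
          have : Continuous fun z => e.symm z := e.symm.continuous
          fun_prop }
    refine ⟨e', fun x => ?_, fun f r h1 h2 => ?_⟩
    · simp [e']
    · have : (fun x : V × (Fin 0 → ℝ) × (Fin 0 → ℝ) =>
          f x.1 + (∑ i, x.2.2 i ^ 2 - ∑ i, x.2.1 i ^ 2)) ∘ e'.symm = f ∘ e.symm := by
        funext z
        simp only [Function.comp, Finset.univ_eq_empty, Finset.sum_empty, sub_zero, add_zero]
        rfl
      rw [this]
      exact ⟨h1, h2⟩
  | succ d ih =>
    obtain ⟨e', h1, h2⟩ := ih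
    refine ⟨addPair e', fun x => ?_, fun f r h3 h4 => ?_⟩
    · have := h1 (x.1, Fin.tail x.2.1, Fin.tail x.2.2)
      have hval : addPair e' x = (Fin.cons (x.2.1 0) (e' (x.1, Fin.tail x.2.1, Fin.tail x.2.2)).1,
        Fin.cons (x.2.2 0) (e' (x.1, Fin.tail x.2.1, Fin.tail x.2.2)).2) := rfl
      rw [hval]
      refine (modelQ_cons _ _ _ _).trans ?_
      rw [Prod.mk.eta, this, Fin.sum_univ_succ (n := d), Fin.sum_univ_succ (n := d)]
      simp only [Fin.tail]
      ring
    · obtain ⟨h5, h6⟩ := h2 f r h3 h4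
      have : (fun x : V × (Fin (d + 1) → ℝ) × (Fin (d + 1) → ℝ) =>
          f x.1 + (∑ i, x.2.2 i ^ 2 - ∑ i, x.2.1 i ^ 2)) ∘ (addPair e').symm
          = stab ((fun x => f x.1 + (∑ i, x.2.2 i ^ 2 - ∑ i, x.2.1 i ^ 2)) ∘ e'.symm) := by
        funext z
        have hval : (addPair e').symm z = ((e'.symm (Fin.tail z.1, Fin.tail z.2)).1,
          Fin.cons (z.1 0) (e'.symm (Fin.tail z.1, Fin.tail z.2)).2.1,
          Fin.cons (z.2 0) (e'.symm (Fin.tail z.1, Fin.tail z.2)).2.2) := rfl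
        simp only [Function.comp, hval, stab, Fin.sum_univ_succ (n := d), Fin.cons_zero,
          Fin.cons_succ]
        ring
      rw [this]
      exact ⟨h5.stab, h6.stab h5⟩

/-- Polarization `x·y = |(x + y)/2|² - |(x - y)/2|²` turns the pairing into `d` pairs of model
variables, so adding it in new variables is a `d`-fold stabilization. -/
lemma exists_frame_config {k : ℕ} (e : V ≃L[ℝ] Model k) (d : ℕ) :
    ∃ e' : (V × Config d × Config d) ≃L[ℝ] Model (k + d),
      (∀ x, modelQ (e' x) = modelQ (e x.1) + ⟪x.2.1, x.2.2⟫) ∧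
      ∀ (f : V → ℝ) (r : ℝ), QuadLip (f ∘ e.symm) → IsModelMinmax (f ∘ e.symm) r →
        IsModelMinmax ((fun x => f x.1 + ⟪x.2.1, x.2.2⟫) ∘ e'.symm) r := by
  obtain ⟨e', h1, h2⟩ := exists_frame_pi e d
  set g : (V × Config d × Config d) ≃ₗ[ℝ] (V × (Fin d → ℝ) × (Fin d → ℝ)) :=
    { toFun := fun x => (x.1, fun i => (x.2.1 i - x.2.2 i) / 2, fun i => (x.2.1 i + x.2.2 i) / 2)
      invFun := fun x => (x.1, WithLp.toLp 2 fun i => x.2.2 i + x.2.1 i,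
        WithLp.toLp 2 fun i => x.2.2 i - x.2.1 i)
      left_inv := fun x => by
        refine Prod.ext rfl (Prod.ext ?_ ?_) <;> ext i <;> simp <;> ring
      right_inv := fun x => by
        refine Prod.ext rfl (Prod.ext ?_ ?_) <;> ext i <;> simp
      map_add' := fun x y => by
        refine Prod.ext rfl (Prod.ext ?_ ?_) <;> ext i <;> simp <;> ring
      map_smul' := fun c x => by
        refine Prod.ext rfl (Prod.ext ?_ ?_) <;> ext i <;> simp <;> ring } with hg
  set G : (V × Config d × Config d) ≃L[ℝ] (V × (Fin d → ℝ) × (Fin d → ℝ)) :=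
    { g with
      continuous_toFun := by
        change Continuous fun x : V × Config d × Config d =>
          (x.1, (fun i => (x.2.1 i - x.2.2 i) / 2), fun i => (x.2.1 i + x.2.2 i) / 2)
        fun_prop
      continuous_invFun := by
        change Continuous fun x : V × (Fin d → ℝ) × (Fin d → ℝ) =>
          (x.1, (WithLp.toLp 2 fun i => x.2.2 i + x.2.1 i : Config d),
            (WithLp.toLp 2 fun i => x.2.2 i - x.2.1 i : Config d))
        fun_prop } with hG
  have hGx : ∀ x, G x = (x.1, (fun i => (x.2.1 i - x.2.2 i) / 2),
    fun i => (x.2.1 i + x.2.2 i) / 2) := fun x => rfl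
  have hinner : ∀ x : V × Config d × Config d, ∑ i, (G x).2.2 i ^ 2 - ∑ i, (G x).2.1 i ^ 2
      = ⟪x.2.1, x.2.2⟫ := fun x => by
    rw [hGx, PiLp.inner_apply, ← Finset.sum_sub_distrib]
    refine Finset.sum_congr rfl fun i _ => ?_
    simp
    ring
  refine ⟨G.trans e', fun x => ?_, fun f r h3 h4 => ?_⟩
  · rw [ContinuousLinearEquiv.trans_apply, h1, hinner]
    rfl
  · convert (h2 f r h3 h4).2 using 1
    funext z
    simp only [Function.comp]
    rw [← hinner]
    have : G ((G.trans e').symm z) = e'.symm z := G.apply_symm_apply _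
    rw [this]
    congr 2

end Extension

end

end HamiltonJacobi

/-! ### Generating families: coordinates, behaviour at infinity, comparison of minmax values. -/

namespace HamiltonJacobi

noncomputable section

variable {d : ℕ}

/-! ### Components of points of the cotangent bundle -/

@[simp] lemma xPart_pt (x y : Config d) : xPart (pt x y) = x := rfl

@[simp] lemma yPart_pt (x y : Config d) : yPart (pt x y) = y := rfl

@[simp] lemma pt_parts (z : Phase d) : pt (xPart z) (yPart z) = z := by
  ext i
  rcases i with i | i <;> rfl

lemma phase_ext {z z' : Phase d} (hx : xPart z = xPart z') (hy : yPart z = yPart z') : z = z' := by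
  rw [← pt_parts z, hx, hy, pt_parts]

lemma inner_phase (z z' : Phase d) : ⟪z, z'⟫ = ⟪xPart z, xPart z'⟫ + ⟪yPart z, yPart z'⟫ := by
  simp only [PiLp.inner_apply, Fintype.sum_sum_type]
  rfl

lemma norm_sq_phase (z : Phase d) : ‖z‖ ^ 2 = ‖xPart z‖ ^ 2 + ‖yPart z‖ ^ 2 := by
  rw [← real_inner_self_eq_norm_sq, inner_phase, real_inner_self_eq_norm_sq,
    real_inner_self_eq_norm_sq]

lemma norm_xPart_le (z : Phase d) : ‖xPart z‖ ≤ ‖z‖ :=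
  le_of_sq_le_sq (by rw [norm_sq_phase z]; nlinarith [sq_nonneg ‖yPart z‖]) (norm_nonneg _)

lemma norm_yPart_le (z : Phase d) : ‖yPart z‖ ≤ ‖z‖ :=
  le_of_sq_le_sq (by rw [norm_sq_phase z]; nlinarith [sq_nonneg ‖xPart z‖]) (norm_nonneg _)

lemma norm_le_add (z : Phase d) : ‖z‖ ≤ ‖xPart z‖ + ‖yPart z‖ := by
  refine le_of_sq_le_sq ?_ (by positivity)
  rw [norm_sq_phase]
  nlinarith [mul_nonneg (norm_nonneg (xPart z)) (norm_nonneg (yPart z))]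

@[fun_prop]
lemma continuous_xPart : Continuous (xPart : Phase d → Config d) :=
  (xPart (d := d)).continuous_of_finiteDimensional

@[fun_prop]
lemma continuous_yPart : Continuous (yPart : Phase d → Config d) :=
  (yPart (d := d)).continuous_of_finiteDimensional

@[fun_prop]
lemma continuous_pt {α : Type*} [TopologicalSpace α] {f g : α → Config d} (hf : Continuous f)
    (hg : Continuous g) : Continuous fun a => pt (f a) (g a) := by
  unfold pt
  refine (PiLp.continuous_toLp 2 _).comp (continuous_pi fun i => ?_)
  rcases i with i | i
  · exact (PiLp.continuous_apply 2 _ i).comp hf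
  · exact (PiLp.continuous_apply 2 _ i).comp hg

lemma pt_add (x y x' y' : Config d) : pt (x + x') (y + y') = pt x y + pt x' y' := by
  refine phase_ext ?_ ?_ <;> simp

lemma pt_smul (c : ℝ) (x y : Config d) : pt (c • x) (c • y) = c • pt x y := by
  refine phase_ext ?_ ?_ <;> simp

/-! ### Nodes -/

lemma node_last {N : ℕ} (x : Config d) (η : Fibre d N) : node x η (Fin.last N) = x := by
  simp [node]

lemma node_castSucc {N : ℕ} (x : Config d) (η : Fibre d N) (i : Fin N) :
    node x η i.castSucc = xPart (η i) := by
  simp [node]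

lemma node_zero {N : ℕ} (x : Config d) (η : Fibre d (N + 1)) : node x η 0 = xPart (η 0) :=
  node_castSucc x η 0

lemma node_succ {N : ℕ} (x : Config d) (η : Fibre d (N + 1)) (j : Fin (N + 1)) :
    node x η j.succ = node x (Fin.tail η) j := by
  refine Fin.lastCases ?_ (fun i => ?_) j
  · rw [Fin.succ_last, node_last, node_last]
  · rw [Fin.succ_castSucc, node_castSucc, node_castSucc]
    rfl

lemma node_eq {N : ℕ} (x : Config d) (η : Fibre d N) (j : Fin (N + 1)) :
    node x η j = nodeLin d N j η + if j = Fin.last N then x else 0 := by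
  rw [nodeLin_apply]
  refine Fin.lastCases ?_ (fun i => ?_) j
  · simp [node_last]
  · simp [node_castSucc, (Fin.castSucc_lt_last i).ne]

@[fun_prop]
lemma continuous_node {N : ℕ} (x : Config d) (j : Fin (N + 1)) :
    Continuous fun η : Fibre d N => node x η j := by
  simp only [node_eq]
  exact (nodeLin d N j).continuous_of_finiteDimensional.add continuous_const

/-! ### Lipschitz functions -/

section Lip

variable {E : Type*} [NormedAddCommGroup E]

lemma isLip_iff {f : E → ℝ} : IsLip f ↔ ∃ C : ℝ, ∀ x y, |f x - f y| ≤ C * ‖x - y‖ := by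
  constructor
  · rintro ⟨C, hC⟩
    refine ⟨C, fun x y => ?_⟩
    have := hC.dist_le_mul x y
    rwa [Real.dist_eq, dist_eq_norm] at this
  · rintro ⟨C, hC⟩
    refine ⟨C.toNNReal, LipschitzWith.of_dist_le_mul fun x y => ?_⟩
    rw [Real.dist_eq, dist_eq_norm]
    exact (hC x y).trans (mul_le_mul_of_nonneg_right (Real.le_coe_toNNReal C) (norm_nonneg _))

lemma IsLip.add {f g : E → ℝ} (hf : IsLip f) (hg : IsLip g) : IsLip fun x => f x + g x :=
  let ⟨C, hC⟩ := hf
  let ⟨D, hD⟩ := hg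
  ⟨C + D, hC.add hD⟩

lemma isLip_sum {ι : Type*} (s : Finset ι) {f : ι → E → ℝ} (hf : ∀ i ∈ s, IsLip (f i)) :
    IsLip fun x => ∑ i ∈ s, f i x := by
  classical
  induction s using Finset.induction_on with
  | empty => exact ⟨0, by simp⟩
  | insert i s hi ih =>
    simp only [Finset.sum_insert hi]
    exact (hf i (Finset.mem_insert_self i s)).add
      (ih fun j hj => hf j (Finset.mem_insert_of_mem hj))

lemma IsLip.comp {E' : Type*} [NormedAddCommGroup E'] {f : E' → ℝ} (hf : IsLip f) {g : E → E'}
    {C : ℝ≥0} (hg : LipschitzWith C g) : IsLip fun x => f (g x) :=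
  let ⟨D, hD⟩ := hf
  ⟨D * C, hD.comp hg⟩

lemma isLip_linear [NormedSpace ℝ E] [FiniteDimensional ℝ E] (L : E →ₗ[ℝ] ℝ) : IsLip L :=
  ⟨_, (LinearMap.toContinuousLinearMap L).lipschitz⟩

lemma exists_lipschitz_linear [NormedSpace ℝ E] [FiniteDimensional ℝ E] {E' : Type*}
    [NormedAddCommGroup E'] [NormedSpace ℝ E'] (L : E →ₗ[ℝ] E') : ∃ C : ℝ≥0, LipschitzWith C L :=
  ⟨_, (LinearMap.toContinuousLinearMap L).lipschitz⟩

end Lip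

lemma exists_lipschitz_node {N : ℕ} (x : Config d) (j : Fin (N + 1)) :
    ∃ C : ℝ≥0, LipschitzWith C fun η : Fibre d N => node x η j := by
  obtain ⟨C, hC⟩ := exists_lipschitz_linear (nodeLin d N j)
  refine ⟨C, ?_⟩
  simp only [node_eq]
  simpa only [add_zero] using hC.add (LipschitzWith.const (if j = Fin.last N then x else 0))

lemma exists_lipschitz_yPart {N : ℕ} (i : Fin N) :
    ∃ C : ℝ≥0, LipschitzWith C fun η : Fibre d N => yPart (η i) :=
  exists_lipschitz_linear (yPart.comp (LinearMap.proj i : Fibre d N →ₗ[ℝ] Phase d))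

/-! ### Families -/

/-- The generating family built from arbitrary functions of `(x_{i+1}, y_i)`. -/
def famS {N : ℕ} (F : Fin N → Config d → Config d → ℝ) (v : Config d → ℝ) (x : Config d)
    (η : Fibre d N) : ℝ :=
  v (node x η 0) + ∑ i : Fin N, F i (node x η i.succ) (yPart (η i))
    + ∑ i : Fin N, ⟪node x η i.succ - node x η i.castSucc, yPart (η i)⟫

/-- The difference with the quadratic form is Lipschitz. -/
def IsQuadLip {N : ℕ} (f : Fibre d N → ℝ) : Prop := IsLip fun η => f η - quadForm d N η

/-- Replacing the last node `0` of the quadratic form by `x` adds only a linear term in the last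
momentum; everything else is Lipschitz by assumption. -/
lemma isQuadLip_famS {N : ℕ} {F : Fin N → Config d → Config d → ℝ}
    (hF : ∀ i, IsLip fun q : Config d × Config d => F i q.1 q.2) {v : Config d → ℝ} (hv : IsLip v)
    (x : Config d) : IsQuadLip (famS F v x) := by
  set c : Fin (N + 1) → Config d := fun j => if j = Fin.last N then x else 0 with hc
  have key : ∀ η, famS F v x η - quadForm d N η = v (node x η 0)
      + (∑ i : Fin N, F i (node x η i.succ) (yPart (η i))
        + ∑ i : Fin N, ⟪c i.succ - c i.castSucc, yPart (η i)⟫) := by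
    intro η
    rw [famS, quadForm_apply, add_sub_assoc, add_assoc, ← Finset.sum_sub_distrib]
    congr 2
    refine Finset.sum_congr rfl fun i _ => ?_
    rw [← inner_sub_left]
    congr 1
    simp only [node_eq, hc]
    simp only [(Fin.castSucc_lt_last i).ne, if_false]
    split_ifs <;> abel
  unfold IsQuadLip
  simp only [key]
  obtain ⟨C, hC⟩ := exists_lipschitz_node x (0 : Fin (N + 1))
  refine (hv.comp hC).add ((isLip_sum _ fun i _ => ?_).add (isLip_sum _ fun i _ => ?_))
  · obtain ⟨C, hC⟩ := exists_lipschitz_node x i.succ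
    obtain ⟨D, hD⟩ := exists_lipschitz_yPart (d := d) i
    exact (hF i).comp (hC.prodMk hD)
  · exact isLip_linear ((innerₗ (Config d) (c i.succ - c i.castSucc)).comp
      (yPart.comp (LinearMap.proj i : Fibre d N →ₗ[ℝ] Phase d)))

/-! ### Coordinates on the fibre -/

/-- Splitting off the first pair `(x_1 - x_0, y_0)`. -/
def splitFirst (d N : ℕ) : Fibre d (N + 1) ≃ₗ[ℝ] Fibre d N × Config d × Config d where
  toFun η := (Fin.tail η, nodeLin d N 0 (Fin.tail η) - xPart (η 0), yPart (η 0))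
  invFun a := Fin.cons (pt (nodeLin d N 0 a.1 - a.2.1) a.2.2) a.1
  left_inv η := by
    funext i
    refine Fin.cases ?_ (fun j => ?_) i
    · simp
    · simp [Fin.tail]
  right_inv a := by simp
  map_add' η η' := by
    have : Fin.tail (η + η') = Fin.tail η + Fin.tail η' := rfl
    refine Prod.ext rfl (Prod.ext ?_ ?_)
    · simp only [this, map_add, Pi.add_apply, Prod.snd_add, Prod.fst_add]; abel
    · simp
  map_smul' c η := by
    have : Fin.tail (c • η) = c • Fin.tail η := rfl
    refine Prod.ext rfl (Prod.ext ?_ ?_)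
    · simp only [this, map_smul, Pi.smul_apply, RingHom.id_apply, Prod.smul_snd, Prod.smul_fst,
        smul_sub]
    · simp

/-- The differences `x_{i+1} - x_i`, with last node `0`, and the `y_i` are linear coordinates in
which the form is a sum of `N` pairings; hence a frame of balanced signature. -/
lemma exists_frame (d N : ℕ) : ∃ (k : ℕ) (e : Fibre d N ≃L[ℝ] Model k),
    ∀ η, quadForm d N η = modelQ (e η) := by
  induction N with
  | zero =>
    refine ⟨0, (LinearEquiv.ofFinrankEq (Fibre d 0) (Model 0)
      (by rw [Module.finrank_zero_of_subsingleton, Module.finrank_zero_of_subsingleton])).toContinuousLinearEquiv,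
      fun η => ?_⟩
    rw [quadForm_apply]
    simp [modelQ]
  | succ N ih =>
    obtain ⟨k, e, he⟩ := ih
    obtain ⟨e', h1, -⟩ := exists_frame_config e d
    refine ⟨k + d, (splitFirst d N).toContinuousLinearEquiv.trans e', fun η => ?_⟩
    rw [ContinuousLinearEquiv.trans_apply, h1]
    change _ = modelQ (e (Fin.tail η)) + ⟪nodeLin d N 0 (Fin.tail η) - xPart (η 0), yPart (η 0)⟫
    rw [← he, quadForm_apply, quadForm_apply, Fin.sum_univ_succ, add_comm]
    congr 1
    · refine Finset.sum_congr rfl fun i _ => ?_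
      rw [node_succ, ← Fin.succ_castSucc, node_succ]
      rfl
    · rw [node_succ, nodeLin_apply]
      congr 2

lemma isQuadLip_iff {N k : ℕ} {e : Fibre d N ≃L[ℝ] Model k}
    (he : ∀ η, quadForm d N η = modelQ (e η)) {f : Fibre d N → ℝ} (hf : IsQuadLip f) :
    QuadLip (f ∘ e.symm) := by
  have h : (fun z => (f ∘ e.symm) z - modelQ z)
      = fun z => f (e.symm z) - quadForm d N (e.symm z) := by
    funext z
    simp [he]
  unfold QuadLip
  rw [h]
  exact hf.comp e.symm.lipschitz

lemma IsQuadLip.exists_isMinmax {N : ℕ} {f : Fibre d N → ℝ} (hf : IsQuadLip f) :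
    ∃ r, IsMinmax (quadForm d N) f r := by
  obtain ⟨k, e, he⟩ := exists_frame d N
  obtain ⟨r, hr⟩ := (isQuadLip_iff he hf).exists_isModelMinmax
  exact ⟨r, (isMinmax_iff e he f r).2 hr⟩

lemma isMinmax_unique {N : ℕ} {f : Fibre d N → ℝ} {r r' : ℝ} (h : IsMinmax (quadForm d N) f r)
    (h' : IsMinmax (quadForm d N) f r') : r = r' := by
  obtain ⟨a, ha, ha'⟩ := (h.and h').exists
  exact ha.unique ha'

/-- Comparison of minmax values by means of deformations which either decrease the first function
or move points by a bounded amount. -/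
theorem isMinmax_le_add {N : ℕ} {f₁ f₂ : Fibre d N → ℝ} {r₁ r₂ δ : ℝ}
    (h₁ : IsMinmax (quadForm d N) f₁ r₁) (h₂ : IsMinmax (quadForm d N) f₂ r₂) (hf₁ : IsQuadLip f₁)
    (hf₂ : IsQuadLip f₂) (D : ℝ) (hG : ∀ (K : Set (Fibre d N)) (B : ℝ), IsCompact K →
      ∃ G : C(Fibre d N × ℝ, Fibre d N), (∀ η, G (η, 0) = η) ∧
      (∀ η ∈ K, f₁ (G (η, 1)) ≤ max (f₂ η + δ) (-B)) ∧
      ∀ η, ∀ r ∈ Icc (0 : ℝ) 1, f₁ (G (η, r)) ≤ f₁ η ∨ ‖G (η, r) - η‖ ≤ D) :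
    r₁ ≤ r₂ + δ := by
  obtain ⟨k, e, he⟩ := exists_frame d N
  have hq₁ := isQuadLip_iff he hf₁
  obtain ⟨a₀, ha₀⟩ := hq₁.trivial_sublevel_iff
  obtain ⟨C, hC⟩ : ∃ C : ℝ≥0, LipschitzWith C e := ⟨_, e.lipschitz⟩
  -- A point with `‖u‖ ≥ C D + 1` cannot reach `{u = 0}` when moved by at most `D`, since `e` is
  -- `C`-Lipschitz. A point deep in the sublevel of `f₁` cannot reach it while `f₁` stays at most
  -- its initial value.
  refine ((isMinmax_iff e he f₁ r₁).1 h₁).le_add ((isMinmax_iff e he f₂ r₂).1 h₂) hq₁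
    (isQuadLip_iff he hf₂) (max a₀ (C * D + 1)) fun K B hK => ?_
  obtain ⟨G, h0, h1, h2⟩ := hG (e.symm '' K) B (hK.image e.symm.continuous)
  refine ⟨⟨fun z => e (G (e.symm z.1, z.2)), ?_⟩, fun z => ?_, fun z hz => ?_,
    fun z hz1 _ hz3 r hr => ?_⟩
  · exact e.continuous.comp (G.continuous.comp
      ((e.symm.continuous.comp continuous_fst).prodMk continuous_snd))
  · simp [h0]
  · simpa using h1 _ ⟨z, hz, rfl⟩
  · rcases h2 (e.symm z) r hr with h | h
    · refine (ha₀ _ (le_max_left a₀ (C * D + 1))).1 ?_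
      change f₁ (e.symm (e (G (e.symm z, r)))) ≤ _
      rw [e.symm_apply_apply]
      exact h.trans hz1
    · intro h0'
      change (e (G (e.symm z, r))).1 = 0 at h0'
      have h3 := hC.dist_le_mul (G (e.symm z, r)) (e.symm z)
      rw [e.apply_symm_apply, dist_eq_norm, dist_eq_norm] at h3
      have h4 : ‖(e (G (e.symm z, r)) - z).1‖ ≤ ‖e (G (e.symm z, r)) - z‖ := norm_fst_le _
      rw [Prod.fst_sub, h0', zero_sub, norm_neg] at h4
      have h5 := mul_le_mul_of_nonneg_left h C.2
      have h6 := le_max_right a₀ (C * D + 1)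
      change (C : ℝ) * _ ≤ C * _ at h5
      linarith

/-! ### Insertion of a trivial step -/

/-- The coordinates `(x_0, y_1), (x_i, y_i)_{i ≥ 2}` and `x_1 - x_0`, `y_0 - y_1`. -/
def splitStep (d N : ℕ) : Fibre d (N + 2) ≃ₗ[ℝ] Fibre d (N + 1) × Config d × Config d where
  toFun η := (Fin.cons (pt (xPart (η 0)) (yPart (η 1))) (Fin.tail (Fin.tail η)),
    xPart (η 1) - xPart (η 0), yPart (η 0) - yPart (η 1))
  invFun a := Fin.cons (pt (xPart (a.1 0)) (yPart (a.1 0) + a.2.2))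
    (Fin.cons (pt (xPart (a.1 0) + a.2.1) (yPart (a.1 0))) (Fin.tail a.1))
  left_inv η := by
    funext i
    refine Fin.cases ?_ (fun j => Fin.cases ?_ (fun j => ?_) j) i
    · simp
    · simp
    · simp [Fin.tail]
  right_inv a := by
    refine Prod.ext ?_ (Prod.ext ?_ ?_)
    · funext i
      refine Fin.cases ?_ (fun j => ?_) i
      · simp
      · simp [Fin.tail]
    · simp
    · simp
  map_add' η η' := by
    refine Prod.ext ?_ (Prod.ext ?_ ?_)
    · funext i
      refine Fin.cases ?_ (fun j => ?_) i
      · simp [pt_add]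
      · simp [Fin.tail]
    · simp; abel
    · simp; abel
  map_smul' c η := by
    refine Prod.ext ?_ (Prod.ext ?_ ?_)
    · funext i
      refine Fin.cases ?_ (fun j => ?_) i
      · simp [pt_smul]
      · simp [Fin.tail]
    · simp [smul_sub]
    · simp [smul_sub]

lemma splitStep_apply {N : ℕ} (η : Fibre d (N + 2)) : splitStep d N η =
    (Fin.cons (pt (xPart (η 0)) (yPart (η 1))) (Fin.tail (Fin.tail η)),
      xPart (η 1) - xPart (η 0), yPart (η 0) - yPart (η 1)) := rfl

/-- When the first function vanishes, `(x₁ - x₀)·y₀ + (x₂ - x₁)·y₁` regroups as `(x₂ - x₀)·y₁ + (x₁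
- x₀)·(y₀ - y₁)`, and the last pairing involves two otherwise absent variables. -/
lemma famS_splitStep {N : ℕ} (F : Fin (N + 1) → Config d → Config d → ℝ) (v : Config d → ℝ)
    (x : Config d) (η : Fibre d (N + 2)) :
    famS (Fin.cons (fun _ _ => 0) F : Fin (N + 2) → Config d → Config d → ℝ) v x η
      = famS F v x (splitStep d N η).1
        + ⟪(splitStep d N η).2.1, (splitStep d N η).2.2⟫ := by
  rw [splitStep_apply]
  set η' : Fibre d (N + 1) := Fin.cons (pt (xPart (η 0)) (yPart (η 1))) (Fin.tail (Fin.tail η))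
    with hη'
  have n1 : ∀ j : Fin (N + 1), node x η j.succ.succ = node x η' j.succ := fun j => by
    rw [node_succ, node_succ, node_succ, hη', Fin.tail_cons]
  have n0 : node x η' 0 = xPart (η 0) := by rw [node_zero]; simp [hη']
  have y0 : yPart (η' 0) = yPart (η 1) := by simp [hη']
  have y1 : ∀ i : Fin N, η' i.succ = η i.succ.succ := fun i => by simp [hη', Fin.tail]
  have m1 : node x η 1 = xPart (η 1) := by
    rw [← Fin.succ_zero_eq_one, node_succ, node_zero]; rfl
  simp only [famS, Fin.sum_univ_succ (n := N + 1), Fin.sum_univ_succ (n := N), Fin.cons_zero,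
    Fin.cons_succ, n1, ← Fin.succ_castSucc, Fin.castSucc_zero, Fin.succ_zero_eq_one, n0, node_zero,
    y0, y1, m1]
  simp only [inner_sub_left, inner_sub_right]
  ring

/-- A zero step is therefore a stabilization. This is what makes the number of points of a
subdivision irrelevant. -/
theorem isMinmax_famS_cons {N : ℕ} {F : Fin (N + 1) → Config d → Config d → ℝ}
    (hF : ∀ i, IsLip fun q : Config d × Config d => F i q.1 q.2) {v : Config d → ℝ} (hv : IsLip v)
    {x : Config d} {r : ℝ} (h : IsMinmax (quadForm d (N + 1)) (famS F v x) r) :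
    IsMinmax (quadForm d (N + 2))
      (famS (Fin.cons (fun _ _ => 0) F : Fin (N + 2) → Config d → Config d → ℝ) v x) r := by
  obtain ⟨k, e, he⟩ := exists_frame d (N + 1)
  obtain ⟨e', h1, h2⟩ := exists_frame_config e d
  have h3 := h2 _ r (isQuadLip_iff he (isQuadLip_famS hF hv x)) ((isMinmax_iff e he _ r).1 h)
  set E := (splitStep d N).toContinuousLinearEquiv.trans e' with hE
  have hQ : ∀ η, quadForm d (N + 2) η = modelQ (E η) := fun η => by
    have h0 : ∀ (M : ℕ) (η : Fibre d M), quadForm d M η = famS (fun _ _ _ => 0) (fun _ => 0) 0 η :=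
      fun M η => by simp [famS, quadForm_apply]
    have hc : (fun _ _ _ => 0 : Fin (N + 2) → Config d → Config d → ℝ)
        = Fin.cons (fun _ _ => 0) fun _ _ _ => 0 := by
      funext i
      refine Fin.cases ?_ (fun j => ?_) i <;> rfl
    rw [h0, hc, famS_splitStep, ← h0, he, hE, ContinuousLinearEquiv.trans_apply, h1]
    rfl
  rw [isMinmax_iff E hQ]
  convert h3 using 1
  funext z
  simp only [Function.comp, famS_splitStep]
  have : splitStep d N (E.symm z) = e'.symm z := (splitStep d N).apply_symm_apply _
  rw [this]

end

end HamiltonJacobi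

/-! ### Paths of minmax values, and deformations of generating families. -/

namespace HamiltonJacobi

noncomputable section

variable {d : ℕ}

/-! ### Local estimates imply global ones -/

/-- Over `n` equal pieces the quadratic errors add up to `C / n`, which tends to zero. This replaces
differentiation along a path of minmax values, which need not be differentiable. -/
lemma abs_sub_le_of_forall_local {g : ℝ → ℝ} {B C ρ : ℝ} (hρ : 0 < ρ)
    (hg : ∀ a ∈ Icc (0 : ℝ) 1, ∀ b ∈ Icc (0 : ℝ) 1, a ≤ b → b - a ≤ ρ →
      |g b - g a| ≤ B * (b - a) + C * (b - a) ^ 2) : |g 1 - g 0| ≤ B := by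
  have key : ∀ n : ℕ, 1 / ρ ≤ n → 0 < n → |g 1 - g 0| ≤ B + C * (1 / n) := by
    intro n hn hn0
    have hn' : (0 : ℝ) < n := by exact_mod_cast hn0
    have hstep : ∀ k ∈ Finset.range n, |g ((k + 1 : ℕ) / n) - g ((k : ℕ) / n)|
        ≤ B * (1 / n) + C * (1 / n) ^ 2 := by
      intro k hk
      have hk' : ((k + 1 : ℕ) : ℝ) ≤ n := by exact_mod_cast Finset.mem_range.1 hk
      have e : ((k + 1 : ℕ) : ℝ) / n - (k : ℕ) / n = 1 / n := by push_cast; ring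
      have h1 : (1 : ℝ) / n ≤ ρ := by
        rw [div_le_iff₀ hρ] at hn
        rw [div_le_iff₀ hn']
        linarith
      have := hg (k / n) ⟨by positivity, (div_le_one hn').2 (by push_cast at hk'; linarith)⟩
        ((k + 1 : ℕ) / n) ⟨by positivity, (div_le_one hn').2 hk'⟩
        (by push_cast; gcongr; linarith) (by rw [e]; exact h1)
      rwa [e] at this
    have h2 := Finset.sum_range_sub (fun k : ℕ => g ((k : ℕ) / n)) n
    simp only [Nat.cast_zero, zero_div, div_self hn'.ne'] at h2
    rw [← h2]
    refine (Finset.abs_sum_le_sum_abs _ _).trans ((Finset.sum_le_sum hstep).trans (le_of_eq ?_))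
    rw [Finset.sum_const, Finset.card_range, nsmul_eq_mul]
    field_simp
  have hlim : Tendsto (fun n : ℕ => B + C * (1 / (n : ℝ))) atTop (𝓝 (B + C * 0)) :=
    (tendsto_one_div_atTop_nhds_zero_nat.const_mul C).const_add B
  rw [mul_zero, add_zero] at hlim
  refine ge_of_tendsto hlim ?_
  obtain ⟨m, hm⟩ := exists_nat_ge (1 / ρ)
  filter_upwards [eventually_ge_atTop (max m 1)] with n hn
  exact key n (hm.trans (by exact_mod_cast (le_max_left m 1).trans hn))
    (lt_of_lt_of_le one_pos ((le_max_right m 1).trans hn))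

/-! ### Shifts of the nodes -/

lemma node_shift {N : ℕ} (x : Config d) (η : Fibre d N) (w : Fin (N + 1) → Config d)
    (u : Fin N → Config d) (j : Fin (N + 1)) :
    node (x + w (Fin.last N)) (fun i => η i + pt (w i.castSucc) (u i)) j = node x η j + w j := by
  refine Fin.lastCases ?_ (fun i => ?_) j
  · rw [node_last, node_last]
  · rw [node_castSucc, node_castSucc, map_add, xPart_pt]

lemma famS_shift_le {N : ℕ} {F : Fin N → Config d → Config d → ℝ} {v : Config d → ℝ} {L : ℝ}
    {a : Fin N → ℝ} (hv : ∀ x x', v x - v x' ≤ L * ‖x - x'‖)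
    (hF : ∀ i X X' y, F i X y - F i X' y ≤ a i * ‖X - X'‖) (x : Config d) (η : Fibre d N)
    (w : Fin (N + 1) → Config d) :
    famS F v (x + w (Fin.last N)) (fun i => η i + pt (w i.castSucc) 0) ≤ famS F v x η
      + (L * ‖w 0‖ + ∑ i, a i * ‖w i.succ‖ + ∑ i, ⟪w i.succ - w i.castSucc, yPart (η i)⟫) := by
  have h0 : ∀ i, yPart (η i + pt (w i.castSucc) 0) = yPart (η i) := fun i => by simp
  simp only [famS, node_shift x η w (fun _ => 0), h0]
  have h1 := hv (node x η 0 + w 0) (node x η 0)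
  rw [add_sub_cancel_left] at h1
  have h2 : ∑ i, F i (node x η i.succ + w i.succ) (yPart (η i))
      ≤ ∑ i, F i (node x η i.succ) (yPart (η i)) + ∑ i, a i * ‖w i.succ‖ := by
    rw [← Finset.sum_add_distrib]
    refine Finset.sum_le_sum fun i _ => ?_
    have := hF i (node x η i.succ + w i.succ) (node x η i.succ) (yPart (η i))
    rw [add_sub_cancel_left] at this
    linarith
  have h3 : ∑ i, ⟪node x η i.succ + w i.succ - (node x η i.castSucc + w i.castSucc), yPart (η i)⟫
      = ∑ i, ⟪node x η i.succ - node x η i.castSucc, yPart (η i)⟫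
        + ∑ i, ⟪w i.succ - w i.castSucc, yPart (η i)⟫ := by
    rw [← Finset.sum_add_distrib]
    refine Finset.sum_congr rfl fun i _ => ?_
    rw [← inner_add_left]
    congr 1
    abel
  linarith

/-! ### Dependence on the base point -/

/-- All nodes are translated by the same vector `x - x'`: the pairings with the momenta do not
change, and only `v` and the `F i` contribute. -/
theorem isMinmax_famS_le_base {N : ℕ} {F : Fin N → Config d → Config d → ℝ} {v : Config d → ℝ}
    {L : ℝ} {a : Fin N → ℝ} (hv : ∀ x x', v x - v x' ≤ L * ‖x - x'‖)
    (hF : ∀ i X X' y, F i X y - F i X' y ≤ a i * ‖X - X'‖)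
    (hF' : ∀ i, IsLip fun q : Config d × Config d => F i q.1 q.2) (hv' : IsLip v)
    {x x' : Config d} {r r' : ℝ} (h : IsMinmax (quadForm d N) (famS F v x) r)
    (h' : IsMinmax (quadForm d N) (famS F v x') r') :
    r ≤ r' + (L + ∑ i, a i) * ‖x - x'‖ := by
  refine isMinmax_le_add h h' (isQuadLip_famS hF' hv' x) (isQuadLip_famS hF' hv' x')
    ‖(fun _ => pt (x - x') 0 : Fibre d N)‖ fun K B _ =>
      ⟨⟨fun q => q.1 + q.2 • (fun _ => pt (x - x') 0 : Fibre d N), by fun_prop⟩, ?_, ?_, ?_⟩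
  · simp
  · intro η _
    refine le_max_of_le_left ?_
    have := famS_shift_le hv hF x' η fun _ => x - x'
    simp only [add_sub_cancel, sub_self, inner_zero_left, Finset.sum_const_zero, add_zero,
      ← Finset.sum_mul, ← add_mul] at this
    simpa [Pi.add_def] using this
  · intro η r hr
    right
    simp only [ContinuousMap.coe_mk, add_sub_cancel_left, norm_smul, Real.norm_eq_abs,
      abs_of_nonneg hr.1]
    exact mul_le_of_le_one_left (norm_nonneg _) hr.2

/-! ### Concentration on bounded momenta and bounded displacements -/

/-- A vector field which is zero on the ball of radius `L` and points outwards outside it. -/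
def pushOut (L : ℝ) (y : Config d) : Config d := max 0 (‖y‖ - L) • y

@[fun_prop]
lemma continuous_pushOut (L : ℝ) : Continuous (pushOut L : Config d → Config d) := by
  unfold pushOut
  fun_prop

lemma pushOut_eq (L s : ℝ) (hs : 0 ≤ s) (y : Config d) :
    L * ‖s • pushOut L y‖ - ⟪s • pushOut L y, y⟫ = -(s * (max 0 (‖y‖ - L) * ‖y‖ * (‖y‖ - L))) := by
  rw [pushOut, norm_smul, norm_smul, real_inner_smul_left, real_inner_smul_left,
    real_inner_self_eq_norm_sq, Real.norm_of_nonneg hs, Real.norm_of_nonneg (le_max_left _ _)]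
  ring

lemma pushOut_nonpos (L s : ℝ) (hs : 0 ≤ s) (y : Config d) :
    L * ‖s • pushOut L y‖ - ⟪s • pushOut L y, y⟫ ≤ 0 := by
  rw [pushOut_eq L s hs, neg_nonpos]
  rcases le_total 0 (‖y‖ - L) with h | h
  · positivity
  · simp [max_eq_left h]

lemma pushOut_le {L s ε : ℝ} (hL : 0 ≤ L) (hs : 0 ≤ s) (hε : 0 ≤ ε) {y : Config d}
    (hy : L + ε ≤ ‖y‖) : L * ‖s • pushOut L y‖ - ⟪s • pushOut L y, y⟫ ≤ -(s * ε ^ 3) := by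
  rw [pushOut_eq L s hs, max_eq_right (by linarith), neg_le_neg_iff]
  refine mul_le_mul_of_nonneg_left ?_ hs
  have : ε ^ 3 = ε * ε * ε := by ring
  have h1 : 0 ≤ ‖y‖ - L := by linarith
  rw [this]
  gcongr <;> linarith

lemma pt_zero : pt (0 : Config d) 0 = 0 := by
  rw [← map_zero xPart]
  exact pt_parts 0

lemma IsQuadLip.continuous {N : ℕ} {f : Fibre d N → ℝ} (hf : IsQuadLip f) : Continuous f := by
  obtain ⟨C, hC⟩ := hf
  have h1 : Continuous (quadForm d N) := by
    have : (quadForm d N : Fibre d N → ℝ) = fun η =>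
      ∑ i : Fin N, ⟪node 0 η i.succ - node 0 η i.castSucc, yPart (η i)⟫ := funext quadForm_apply
    rw [this]
    fun_prop
  have h2 := hC.continuous.add h1
  have h3 : ((fun η => f η - quadForm d N η) + ⇑(quadForm d N)) = f := by
    funext η
    simp
  rwa [h3] at h2

/-- Minmax values may be compared outside a set where a deformation uniformly decreases the
function. -/
lemma isMinmax_le_add_of_decreasing {N : ℕ} {f₁ f₂ : Fibre d N → ℝ} {r r' δ κ : ℝ}
    (h : IsMinmax (quadForm d N) f₁ r) (h' : IsMinmax (quadForm d N) f₂ r') (hf₁ : IsQuadLip f₁)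
    (hf₂ : IsQuadLip f₂) (hκ : 0 < κ) (hδ : 0 ≤ δ) {G : ℝ → Fibre d N → Fibre d N}
    (hG : Continuous fun q : ℝ × Fibre d N => G q.1 q.2) (h0 : ∀ η, G 0 η = η)
    (hmono : ∀ s : ℝ, 0 ≤ s → ∀ η, f₁ (G s η) ≤ f₁ η)
    (hle : ∀ η, f₁ η ≤ f₂ η + δ ∨ ∀ s, 0 ≤ s → f₁ (G s η) ≤ f₁ η - s * κ) : r ≤ r' + δ := by
  refine isMinmax_le_add h h' hf₁ hf₂ 0 fun K B hK => ?_
  -- `Λ` bounds `f₁ - f₂` on the compact set, so flowing for time `max Λ 0 / κ` makes up for the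
  -- difference wherever the direct comparison is not available.
  obtain ⟨Λ, hΛ⟩ := (hK.image (hf₁.continuous.sub hf₂.continuous)).bddAbove
  have hs0 : 0 ≤ max Λ 0 / κ := by positivity
  refine ⟨⟨fun q => G (q.2 * (max Λ 0 / κ)) q.1, ?_⟩, fun η => ?_, fun η hη => ?_,
    fun η r hr => Or.inl (hmono _ (mul_nonneg hr.1 hs0) η)⟩
  · exact hG.comp (by fun_prop : Continuous fun q : Fibre d N × ℝ => (q.2 * (max Λ 0 / κ), q.1))
  · simp [h0]
  · refine le_max_of_le_left ?_
    simp only [ContinuousMap.coe_mk, one_mul]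
    rcases hle η with hg | hg
    · exact (hmono _ hs0 η).trans hg
    · have h1 := hg _ hs0
      rw [div_mul_cancel₀ _ hκ.ne'] at h1
      have h3 : f₁ η - f₂ η ≤ Λ := hΛ ⟨η, hη, rfl⟩
      have := le_max_left Λ 0
      linarith

/-- Minmax values may be compared on the set where the momenta are bounded. -/
theorem isMinmax_le_add_of_momenta {N : ℕ} {F : Fin N → Config d → Config d → ℝ} {v : Config d → ℝ}
    {L : ℝ} {a : Fin N → ℝ} (hL : 0 ≤ L) (ha : ∀ i, 0 ≤ a i)
    (hv : ∀ x x', v x - v x' ≤ L * ‖x - x'‖)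
    (hF : ∀ i X X' y, F i X y - F i X' y ≤ a i * ‖X - X'‖)
    (hF' : ∀ i, IsLip fun q : Config d × Config d => F i q.1 q.2) (hv' : IsLip v)
    {x : Config d} {f : Fibre d N → ℝ} (hf : IsQuadLip f) {r r' δ ε : ℝ} (hε : 0 < ε) (hδ : 0 ≤ δ)
    (h : IsMinmax (quadForm d N) (famS F v x) r) (h' : IsMinmax (quadForm d N) f r')
    (hle : ∀ η, (∀ j, ‖yPart (η j)‖ ≤ L + (∑ i, if i < j then a i else 0) + ε) →
      famS F v x η ≤ f η + δ) : r ≤ r' + δ := by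
  set R : Fin N → ℝ := fun j => L + ∑ i, if i < j then a i else 0 with hR
  have hR0 : ∀ j, 0 ≤ R j := fun j =>
    add_nonneg hL (Finset.sum_nonneg fun i _ => by split_ifs; exacts [ha i, le_rfl])
  -- A momentum `y_j` longer than `R j` displaces `x_0, …, x_j` by the same vector. Among the
  -- differences of nodes only `x_{j+1} - x_j` changes, which gains the inner product of that vector
  -- with `y_j`. The price per unit length is `L` for `v` and `a i` for each `i < j`, that is `R j`.
  -- The last node stays at `x`.
  set W : ℝ → Fibre d N → Fin (N + 1) → Config d := fun s η k =>
    ∑ j : Fin N, if k ≤ j.castSucc then s • pushOut (R j) (yPart (η j)) else 0 with hW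
  have hWl : ∀ s η, W s η (Fin.last N) = 0 := fun s η =>
    Finset.sum_eq_zero fun j _ => if_neg (not_le.2 (Fin.castSucc_lt_last j))
  have hWs : ∀ s η i, W s η (Fin.succ i) - W s η i.castSucc
      = -(s • pushOut (R i) (yPart (η i))) := by
    intro s η i
    rw [hW]
    simp only
    rw [← Finset.sum_sub_distrib, Finset.sum_eq_single i]
    · simp
    · intro j _ hj
      have : (i.succ ≤ j.castSucc) ↔ (i.castSucc ≤ j.castSucc) := by
        simp only [Fin.le_def, Fin.val_succ, Fin.val_castSucc]
        have := Fin.val_ne_of_ne hj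
        omega
      simp only [this, sub_self]
    · simp
  have hWn : ∀ s η k, ‖W s η k‖
      ≤ ∑ j : Fin N, if k ≤ j.castSucc then ‖s • pushOut (R j) (yPart (η j))‖ else 0 := by
    intro s η k
    refine (norm_sum_le _ _).trans (Finset.sum_le_sum fun j _ => ?_)
    split_ifs <;> simp
  have key : ∀ s : ℝ, 0 ≤ s → ∀ η, famS F v x (fun i => η i + pt (W s η i.castSucc) 0) ≤ famS F v x η
      + ∑ j, (R j * ‖s • pushOut (R j) (yPart (η j))‖
        - ⟪s • pushOut (R j) (yPart (η j)), yPart (η j)⟫) := by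
    intro s hs η
    have h1 := famS_shift_le hv hF x η (W s η)
    rw [hWl, add_zero] at h1
    refine h1.trans (add_le_add le_rfl ?_)
    simp only [hWs, inner_neg_left, Finset.sum_neg_distrib, Finset.sum_sub_distrib]
    rw [← sub_eq_add_neg]
    refine sub_le_sub_right ?_ _
    have e1 : ∑ j, R j * ‖s • pushOut (R j) (yPart (η j))‖
        = L * (∑ j, ‖s • pushOut (R j) (yPart (η j))‖)
          + ∑ i, a i * ∑ j : Fin N, if i.succ ≤ j.castSucc then ‖s • pushOut (R j) (yPart (η j))‖
            else 0 := by
      simp only [hR, add_mul, Finset.sum_add_distrib, Finset.mul_sum, Finset.sum_mul]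
      congr 1
      rw [Finset.sum_comm]
      refine Finset.sum_congr rfl fun i _ => Finset.sum_congr rfl fun j _ => ?_
      have : (i.succ ≤ j.castSucc) ↔ i < j := by
        simp only [Fin.le_def, Fin.val_succ, Fin.val_castSucc, Fin.lt_def]
        omega
      simp only [this]
      split_ifs <;> simp
    rw [e1]
    refine add_le_add (mul_le_mul_of_nonneg_left ?_ hL)
      (Finset.sum_le_sum fun i _ => mul_le_mul_of_nonneg_left (hWn s η _) (ha i))
    simpa using hWn s η 0
  have hsum : ∀ s : ℝ, 0 ≤ s → ∀ η : Fibre d N, ∀ t : Finset (Fin N),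
      ∑ j ∈ t, (R j * ‖s • pushOut (R j) (yPart (η j))‖
        - ⟪s • pushOut (R j) (yPart (η j)), yPart (η j)⟫) ≤ 0 := fun s hs η t =>
    Finset.sum_nonpos fun j _ => pushOut_nonpos (R j) _ hs (yPart (η j))
  refine isMinmax_le_add_of_decreasing h h' (isQuadLip_famS hF' hv' x) hf (pow_pos hε 3) hδ
    (G := fun s η i => η i + pt (W s η i.castSucc) 0) ?_ ?_ ?_ ?_
  · refine continuous_pi fun i => ((continuous_apply i).comp continuous_snd).add
      (continuous_pt (continuous_finsetSum _ fun j _ => ?_) continuous_const)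
    split_ifs <;> fun_prop
  · intro η
    funext i
    simp [hW, pt_zero]
  · intro s hs η
    linarith [key s hs η, hsum s hs η Finset.univ]
  · intro η
    by_cases hg : ∀ j, ‖yPart (η j)‖ ≤ R j + ε
    · exact Or.inl (hle η hg)
    · right
      push Not at hg
      obtain ⟨j, hj⟩ := hg
      intro s hs
      have h1 := pushOut_le (hR0 j) hs hε.le hj.le
      have h2 := key s hs η
      rw [← Finset.add_sum_erase _ _ (Finset.mem_univ j)] at h2
      linarith [hsum s hs η (Finset.univ.erase j)]

/-- Minmax values may be compared on the set where the differences of the nodes are bounded. -/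
theorem isMinmax_le_add_of_nodes {N : ℕ} {F : Fin N → Config d → Config d → ℝ} {v : Config d → ℝ}
    {b : Fin N → ℝ} (hb : ∀ i, 0 ≤ b i)
    (hF : ∀ i X y y', F i X y - F i X y' ≤ b i * ‖y - y'‖)
    (hF' : ∀ i, IsLip fun q : Config d × Config d => F i q.1 q.2) (hv' : IsLip v)
    {x : Config d} {f : Fibre d N → ℝ} (hf : IsQuadLip f) {r r' δ ε : ℝ} (hε : 0 < ε) (hδ : 0 ≤ δ)
    (h : IsMinmax (quadForm d N) (famS F v x) r) (h' : IsMinmax (quadForm d N) f r')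
    (hle : ∀ η, (∀ j : Fin N, ‖node x η j.succ - node x η j.castSucc‖ ≤ b j + ε) →
      famS F v x η ≤ f η + δ) : r ≤ r' + δ := by
  -- The dual deformation: the nodes stay fixed and each momentum moves against its displacement
  -- `x_{j+1} - x_j` when this is longer than `b j`, the Lipschitz price of moving `y_j`.
  set u : Fibre d N → Fin N → Config d := fun η j => node x η j.succ - node x η j.castSucc with hu
  have hnode : ∀ (s : ℝ) (η : Fibre d N) (k : Fin (N + 1)),
      node x (fun i => η i + pt 0 (-(s • pushOut (b i) (u η i)))) k = node x η k := by
    intro s η k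
    simpa using node_shift x η (fun _ => 0) (fun i => -(s • pushOut (b i) (u η i))) k
  have key : ∀ s : ℝ, 0 ≤ s → ∀ η, famS F v x (fun i => η i + pt 0 (-(s • pushOut (b i) (u η i))))
      ≤ famS F v x η + ∑ j, (b j * ‖s • pushOut (b j) (u η j)‖
        - ⟪s • pushOut (b j) (u η j), u η j⟫) := by
    intro s hs η
    simp only [famS, hnode, map_add, yPart_pt, inner_add_right, Finset.sum_add_distrib,
      Finset.sum_sub_distrib]
    have h1 : ∑ i, F i (node x η i.succ) (yPart (η i) + -(s • pushOut (b i) (u η i)))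
        ≤ ∑ i, F i (node x η i.succ) (yPart (η i)) + ∑ i, b i * ‖s • pushOut (b i) (u η i)‖ := by
      rw [← Finset.sum_add_distrib]
      refine Finset.sum_le_sum fun i _ => ?_
      have := hF i (node x η i.succ) (yPart (η i) + -(s • pushOut (b i) (u η i))) (yPart (η i))
      rw [add_sub_cancel_left, norm_neg] at this
      linarith
    have h2 : ∑ i, ⟪node x η i.succ - node x η i.castSucc, -(s • pushOut (b i) (u η i))⟫
        = -∑ i, ⟪s • pushOut (b i) (u η i), u η i⟫ := by
      rw [← Finset.sum_neg_distrib]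
      refine Finset.sum_congr rfl fun i _ => ?_
      rw [inner_neg_right, real_inner_comm]
    linarith
  have hsum : ∀ s : ℝ, 0 ≤ s → ∀ η : Fibre d N, ∀ t : Finset (Fin N),
      ∑ j ∈ t, (b j * ‖s • pushOut (b j) (u η j)‖
        - ⟪s • pushOut (b j) (u η j), u η j⟫) ≤ 0 := fun s hs η t =>
    Finset.sum_nonpos fun j _ => pushOut_nonpos (b j) _ hs (u η j)
  refine isMinmax_le_add_of_decreasing h h' (isQuadLip_famS hF' hv' x) hf (pow_pos hε 3) hδ
    (G := fun s η i => η i + pt 0 (-(s • pushOut (b i) (u η i)))) ?_ ?_ ?_ ?_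
  · refine continuous_pi fun i => ((continuous_apply i).comp continuous_snd).add
      (continuous_pt continuous_const ?_)
    have h1 : Continuous fun q : ℝ × Fibre d N => u q.2 i :=
      ((continuous_node x _).comp continuous_snd).sub ((continuous_node x _).comp continuous_snd)
    exact (continuous_fst.smul ((continuous_pushOut _).comp h1)).neg
  · intro η
    funext i
    simp [pt_zero]
  · intro s hs η
    linarith [key s hs η, hsum s hs η Finset.univ]
  · intro η
    by_cases hg : ∀ j, ‖u η j‖ ≤ b j + ε
    · exact Or.inl (hle η hg)
    · right
      push Not at hg
      obtain ⟨j, hj⟩ := hg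
      intro s hs
      have h1 := pushOut_le (hb j) hs hε.le hj.le
      have h2 := key s hs η
      rw [← Finset.add_sum_erase _ _ (Finset.mem_univ j)] at h2
      linarith [hsum s hs η (Finset.univ.erase j)]

end

end HamiltonJacobi

/-! ### Trajectories of Hamiltonians with bounded derivatives, and extremals. -/

namespace HamiltonJacobi

noncomputable section

variable {d : ℕ}

/-! ### Differential inequalities -/

/-- Grönwall is applied to `ρ - ρ s` rather than to `ρ`: the resulting factor `exp (c (t - s)) - 1`
is less than one as soon as `c (t - s) < log 2`, which is where `δ_H` comes from. -/
lemma norm_sub_le_of_norm_deriv_le {E : Type*} [NormedAddCommGroup E] [NormedSpace ℝ E]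
    {ρ ρ' : ℝ → E} {c ε s t : ℝ} (hc : 0 < c) (hε : 0 ≤ ε)
    (hρ : ∀ τ ∈ Icc s t, HasDerivWithinAt ρ (ρ' τ) (Icc s t) τ)
    (hb : ∀ τ ∈ Icc s t, ‖ρ' τ‖ ≤ c * ‖ρ τ‖ + ε) :
    ∀ τ ∈ Icc s t, ‖ρ τ - ρ s‖ ≤ (‖ρ s‖ + ε / c) * (Real.exp (c * (t - s)) - 1) := by
  intro τ hτ
  have h := norm_le_gronwallBound_of_norm_deriv_right_le (f := fun τ => ρ τ - ρ s) (f' := ρ')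
    (δ := 0) (K := c) (ε := c * ‖ρ s‖ + ε) (a := s) (b := t)
    (fun τ hτ => (hρ τ hτ).continuousWithinAt.sub continuousWithinAt_const)
    (fun τ hτ => ((hρ τ ⟨hτ.1, hτ.2.le⟩).sub_const (ρ s)).mono_of_mem_nhdsWithin
      (mem_of_superset (Icc_mem_nhdsGE hτ.2) (Icc_subset_Icc_left hτ.1)))
    (by simp) (fun τ hτ => (hb τ ⟨hτ.1, hτ.2.le⟩).trans ?_) τ hτ
  · refine h.trans ?_
    rw [gronwallBound_of_K_ne_0 hc.ne']
    simp only [zero_mul, zero_add]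
    rw [ add_div, mul_div_cancel_left₀ _ hc.ne']
    have h1 : Real.exp (c * (τ - s)) ≤ Real.exp (c * (t - s)) :=
      Real.exp_le_exp.2 (mul_le_mul_of_nonneg_left (by linarith [hτ.2]) hc.le)
    have : 0 ≤ ‖ρ s‖ + ε / c := by positivity
    gcongr
  · have := norm_sub_norm_le (ρ τ) (ρ s)
    nlinarith

/-! ### Hamiltonians with bounded derivatives -/

/-- Quantitative bounds for the first two derivatives of a time dependent Hamiltonian. -/
structure Tame (T : ℝ) (H : ℝ → Phase d → ℝ) (c m M : ℝ) : Prop where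
  c_pos : 0 < c
  m_nonneg : 0 ≤ m
  m_le : m ≤ M
  diff : ∀ τ ∈ Icc 0 T, Differentiable ℝ (H τ)
  lip : ∀ τ ∈ Icc 0 T, ∀ z z', ‖gradient (H τ) z - gradient (H τ) z'‖ ≤ c * ‖z - z'‖
  cont : ContinuousOn (fun q : ℝ × Phase d => gradient (H q.1) q.2) (Icc 0 T ×ˢ univ)
  boundX : ∀ τ ∈ Icc 0 T, ∀ z, ‖gradX H τ z‖ ≤ m
  bound : ∀ τ ∈ Icc 0 T, ∀ z, ‖gradient (H τ) z‖ ≤ M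
  time : ∀ τ ∈ Icc 0 T, ∀ τ' ∈ Icc 0 T, ∀ z, |H τ z - H τ' z| ≤ M * |τ - τ'|

/-- The symplectic rotation `(x, y) ↦ (y, -x)`. -/
def rot : Phase d →ₗ[ℝ] Phase d where
  toFun z := pt (yPart z) (-xPart z)
  map_add' z z' := by rw [map_add, map_add, neg_add, pt_add]
  map_smul' a z := by rw [map_smul, map_smul, ← smul_neg, pt_smul, RingHom.id_apply]

lemma norm_rot (z : Phase d) : ‖rot z‖ = ‖z‖ := by
  rw [← sq_eq_sq₀ (norm_nonneg _) (norm_nonneg _), norm_sq_phase, norm_sq_phase z]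
  change ‖yPart z‖ ^ 2 + ‖-xPart z‖ ^ 2 = _
  rw [norm_neg, add_comm]

lemma hamField_eq (H : ℝ → Phase d → ℝ) (τ : ℝ) (z : Phase d) :
    hamField H τ z = rot (gradient (H τ) z) := rfl

lemma inner_gradient (H : ℝ → Phase d → ℝ) (τ : ℝ) (z w : Phase d) :
    ⟪gradient (H τ) z, w⟫ = ⟪gradX H τ z, xPart w⟫ + ⟪gradY H τ z, yPart w⟫ :=
  inner_phase _ _

lemma abs_inner_le {E : Type*} [NormedAddCommGroup E] [InnerProductSpace ℝ E] {u v : E} {a b : ℝ}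
    (hu : ‖u‖ ≤ a) (hv : ‖v‖ ≤ b) : |⟪u, v⟫| ≤ a * b :=
  (abs_real_inner_le_norm u v).trans (mul_le_mul hu hv (norm_nonneg _) ((norm_nonneg _).trans hu))

namespace Tame

variable {T c m M : ℝ} {H : ℝ → Phase d → ℝ}

lemma M_nonneg (h : Tame T H c m M) : 0 ≤ M := h.m_nonneg.trans h.m_le

lemma norm_hamField (h : Tame T H c m M) {τ : ℝ} (hτ : τ ∈ Icc 0 T) (z : Phase d) :
    ‖hamField H τ z‖ ≤ M := by
  rw [hamField_eq, norm_rot]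
  exact h.bound τ hτ z

lemma norm_hamField_sub (h : Tame T H c m M) {τ : ℝ} (hτ : τ ∈ Icc 0 T) (z z' : Phase d) :
    ‖hamField H τ z - hamField H τ z'‖ ≤ c * ‖z - z'‖ := by
  rw [hamField_eq, hamField_eq, ← map_sub, norm_rot]
  exact h.lip τ hτ z z'

lemma norm_gradY (h : Tame T H c m M) {τ : ℝ} (hτ : τ ∈ Icc 0 T) (z : Phase d) :
    ‖gradY H τ z‖ ≤ M :=
  (norm_yPart_le _).trans (h.bound τ hτ z)

lemma hasGradientAt (h : Tame T H c m M) {τ : ℝ} (hτ : τ ∈ Icc 0 T) (z : Phase d) :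
    HasFDerivAt (H τ) (innerSL ℝ (gradient (H τ) z)) z :=
  (h.diff τ hτ z).hasGradientAt.hasFDerivAt

lemma abs_sub_le (h : Tame T H c m M) {τ : ℝ} (hτ : τ ∈ Icc 0 T) (z z' : Phase d) :
    |H τ z' - H τ z| ≤ M * ‖z' - z‖ :=
  convex_univ.norm_image_sub_le_of_norm_hasFDerivWithin_le (𝕜 := ℝ)
    (fun z _ => (h.hasGradientAt hτ z).hasFDerivWithinAt)
    (fun z _ => by rw [innerSL_apply_norm]; exact h.bound τ hτ z) (mem_univ z) (mem_univ z')

lemma abs_sub_sub_inner_le (h : Tame T H c m M) {τ : ℝ} (hτ : τ ∈ Icc 0 T) (z z' : Phase d) :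
    |H τ z' - H τ z - ⟪gradient (H τ) z, z' - z⟫| ≤ c * ‖z' - z‖ ^ 2 := by
  have h1 := (convex_segment z z').norm_image_sub_le_of_norm_hasFDerivWithin_le' (𝕜 := ℝ)
    (C := c * ‖z' - z‖) (φ := innerSL ℝ (gradient (H τ) z))
    (fun w _ => (h.hasGradientAt hτ w).hasFDerivWithinAt) (fun w hw => ?_)
    (left_mem_segment ℝ z z') (right_mem_segment ℝ z z')
  · simpa [pow_two, mul_assoc] using h1
  · rw [← map_sub, innerSL_apply_norm]
    refine (h.lip τ hτ w z).trans (mul_le_mul_of_nonneg_left ?_ h.c_pos.le)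
    rw [segment_eq_image'] at hw
    obtain ⟨θ, hθ, rfl⟩ := hw
    rw [add_sub_cancel_left, norm_smul, Real.norm_of_nonneg hθ.1]
    exact mul_le_of_le_one_left (norm_nonneg _) hθ.2

lemma time_space (h : Tame T H c m M) {τ τ' : ℝ} (hτ : τ ∈ Icc 0 T) (hτ' : τ' ∈ Icc 0 T)
    (z z' : Phase d) : |H τ z - H τ' z'| ≤ M * |τ - τ'| + M * ‖z - z'‖ := by
  have h1 := h.time τ hτ τ' hτ' z
  have h2 := h.abs_sub_le hτ' z' z
  exact (_root_.abs_sub_le _ (H τ' z) _).trans (add_le_add h1 h2)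

/-! ### Trajectories -/

lemma trajectory_lip (h : Tame T H c m M) {γ : ℝ → Phase d} (hγ : IsTrajectory T H γ) {τ τ' : ℝ}
    (hτ : τ ∈ Icc 0 T) (hτ' : τ' ∈ Icc 0 T) : ‖γ τ' - γ τ‖ ≤ M * |τ' - τ| :=
  (convex_Icc 0 T).norm_image_sub_le_of_norm_hasDerivWithin_le hγ
    (fun σ hσ => h.norm_hamField hσ (γ σ)) hτ hτ'

end Tame

lemma IsTrajectory.hasDerivWithinAt_xPart {T : ℝ} {H : ℝ → Phase d → ℝ} {γ : ℝ → Phase d}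
    (hγ : IsTrajectory T H γ) {τ : ℝ} (hτ : τ ∈ Icc 0 T) :
    HasDerivWithinAt (fun τ => xPart (γ τ)) (gradY H τ (γ τ)) (Icc 0 T) τ := by
  have := (LinearMap.toContinuousLinearMap (xPart (d := d))).hasFDerivAt.comp_hasDerivWithinAt τ
    (hγ τ hτ)
  exact this

lemma IsTrajectory.hasDerivWithinAt_yPart {T : ℝ} {H : ℝ → Phase d → ℝ} {γ : ℝ → Phase d}
    (hγ : IsTrajectory T H γ) {τ : ℝ} (hτ : τ ∈ Icc 0 T) :
    HasDerivWithinAt (fun τ => yPart (γ τ)) (-gradX H τ (γ τ)) (Icc 0 T) τ := by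
  have := (LinearMap.toContinuousLinearMap (yPart (d := d))).hasFDerivAt.comp_hasDerivWithinAt τ
    (hγ τ hτ)
  exact this

lemma IsTrajectory.continuousOn {T : ℝ} {H : ℝ → Phase d → ℝ} {γ : ℝ → Phase d}
    (hγ : IsTrajectory T H γ) : ContinuousOn γ (Icc 0 T) :=
  fun τ hτ => (hγ τ hτ).continuousWithinAt

namespace Tame

variable {T c m M : ℝ} {H : ℝ → Phase d → ℝ}

lemma trajectory_yPart_lip (h : Tame T H c m M) {γ : ℝ → Phase d} (hγ : IsTrajectory T H γ)
    {τ τ' : ℝ} (hτ : τ ∈ Icc 0 T) (hτ' : τ' ∈ Icc 0 T) :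
    ‖yPart (γ τ') - yPart (γ τ)‖ ≤ m * |τ' - τ| :=
  (convex_Icc 0 T).norm_image_sub_le_of_norm_hasDerivWithin_le
    (fun _ hσ => hγ.hasDerivWithinAt_yPart hσ)
    (fun σ hσ => by rw [norm_neg]; exact h.boundX σ hσ (γ σ)) hτ hτ'

lemma trajectory_xPart_lip (h : Tame T H c m M) {γ : ℝ → Phase d} (hγ : IsTrajectory T H γ)
    {τ τ' : ℝ} (hτ : τ ∈ Icc 0 T) (hτ' : τ' ∈ Icc 0 T) :
    ‖xPart (γ τ') - xPart (γ τ)‖ ≤ M * |τ' - τ| :=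
  (convex_Icc 0 T).norm_image_sub_le_of_norm_hasDerivWithin_le
    (fun _ hσ => hγ.hasDerivWithinAt_xPart hσ)
    (fun σ hσ => h.norm_gradY hσ (γ σ)) hτ hτ'

lemma continuousOn_hamField (h : Tame T H c m M) :
    ContinuousOn (fun q : ℝ × Phase d => hamField H q.1 q.2) (Icc 0 T ×ˢ univ) :=
  ((rot (d := d)).continuous_of_finiteDimensional).comp_continuousOn h.cont

lemma continuousOn_hamField_time (h : Tame T H c m M) (w : Phase d) :
    ContinuousOn (fun τ => hamField H τ w) (Icc 0 T) := by
  have h1 : ContinuousOn (fun τ : ℝ => (τ, w)) (Icc 0 T) :=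
    continuousOn_id.prodMk continuousOn_const
  have h2 : MapsTo (fun τ : ℝ => (τ, w)) (Icc 0 T) (Icc 0 T ×ˢ univ) :=
    fun _ hτ => ⟨hτ, mem_univ _⟩
  have h3 := h.continuousOn_hamField.comp h1 h2
  simpa only [Function.comp_def] using h3

lemma exists_trajectory (h : Tame T H c m M) {s : ℝ} (hs : s ∈ Icc 0 T) (z : Phase d) :
    ∃ γ, IsTrajectory T H γ ∧ γ s = z := by
  have hT : 0 ≤ T := hs.1.trans hs.2
  -- The field is bounded by `M`, so a curve cannot leave the ball of radius `M T` during `[0, T]`;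
  -- one application of Picard-Lindelöf covers the whole interval.
  have hp : IsPicardLindelof (hamField H) (⟨s, hs⟩ : Icc 0 T) z
      (M * T).toNNReal 0 M.toNNReal c.toNNReal := by
    refine ⟨fun τ hτ => ?_, fun w _ => ?_, fun τ hτ w _ => ?_, ?_⟩
    · exact LipschitzOnWith.of_dist_le_mul fun w _ w' _ => by
        rw [dist_eq_norm, dist_eq_norm, Real.coe_toNNReal _ h.c_pos.le]
        exact h.norm_hamField_sub hτ w w'
    · exact h.continuousOn_hamField_time w
    · rw [Real.coe_toNNReal _ h.M_nonneg]
      exact h.norm_hamField hτ w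
    · rw [Real.coe_toNNReal _ h.M_nonneg, Real.coe_toNNReal _ (mul_nonneg h.M_nonneg hT),
        NNReal.coe_zero]
      simp only [sub_zero]
      refine mul_le_mul_of_nonneg_left (max_le ?_ ?_) h.M_nonneg
      · linarith [hs.1]
      · exact hs.2
  obtain ⟨γ, h0, h1⟩ := hp.exists_eq_forall_mem_Icc_hasDerivWithinAt₀
  exact ⟨γ, h1, h0⟩

lemma isTrajectory_hamFlow (h : Tame T H c m M) {s : ℝ} (hs : s ∈ Icc 0 T) (z : Phase d) :
    IsTrajectory T H (fun τ => hamFlow T H s τ z) ∧ hamFlow T H s s z = z :=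
  Classical.epsilon_spec (p := fun γ : ℝ → Phase d => IsTrajectory T H γ ∧ γ s = z)
    (h.exists_trajectory hs z)

/-- Two trajectories, of the same or of nearby Hamiltonians, drift apart slowly. -/
lemma drift (h : Tame T H c m M) {H' : ℝ → Phase d → ℝ} {s t κ ε : ℝ} (hs : 0 ≤ s) (ht : t ≤ T)
    (hκ : c * (t - s) ≤ κ) (hε : 0 ≤ ε)
    (hH : ∀ τ ∈ Icc 0 T, ∀ z, ‖gradient (H' τ) z - gradient (H τ) z‖ ≤ ε) {γ γ' : ℝ → Phase d}
    (hγ : IsTrajectory T H γ) (hγ' : IsTrajectory T H' γ') {τ : ℝ} (hτ : τ ∈ Icc s t) :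
    ‖(γ' τ - γ τ) - (γ' s - γ s)‖ ≤ (‖γ' s - γ s‖ + ε / c) * (Real.exp κ - 1) := by
  have hsub : Icc s t ⊆ Icc 0 T := Icc_subset_Icc hs ht
  have h1 := norm_sub_le_of_norm_deriv_le (ρ := fun τ => γ' τ - γ τ)
    (ρ' := fun τ => hamField H' τ (γ' τ) - hamField H τ (γ τ)) h.c_pos hε
    (fun τ hτ => ((hγ' τ (hsub hτ)).mono hsub).sub ((hγ τ (hsub hτ)).mono hsub))
    (fun τ hτ => ?_) τ hτ
  · refine h1.trans (mul_le_mul_of_nonneg_left (sub_le_sub_right (Real.exp_le_exp.2 hκ) 1) ?_)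
    have := h.c_pos
    positivity
  · have h2 : ‖hamField H' τ (γ' τ) - hamField H τ (γ' τ)‖ ≤ ε := by
      rw [hamField_eq, hamField_eq, ← map_sub, norm_rot]
      exact hH τ (hsub hτ) _
    have h3 := h.norm_hamField_sub (hsub hτ) (γ' τ) (γ τ)
    have h4 := norm_sub_le_norm_sub_add_norm_sub (hamField H' τ (γ' τ)) (hamField H τ (γ' τ))
      (hamField H τ (γ τ))
    linarith

lemma exp_sub_one_lt {κ : ℝ} (hκ : κ < Real.log 2) : Real.exp κ - 1 < 1 := by
  have := Real.exp_lt_exp.2 hκ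
  rw [Real.exp_log two_pos] at this
  linarith

/-- For fixed `y`, the map `x ↦ X_s^t(x, y)` is the identity plus a map of Lipschitz constant `exp κ
- 1 < 1`, hence onto by the contraction principle. Surjectivity is enough for `Function.invFun` to
return a preimage in `genCurve`. -/
lemma exists_alphaMap_eq (h : Tame T H c m M) {s t κ : ℝ} (hs : 0 ≤ s) (hst : s ≤ t) (ht : t ≤ T)
    (hκ : c * (t - s) ≤ κ) (hκ2 : κ < Real.log 2) (X y : Config d) :
    ∃ z, alphaMap T H s t z = pt X y := by
  have hsm : s ∈ Icc 0 T := ⟨hs, hst.trans ht⟩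
  have hκ0 : 0 ≤ κ := (mul_nonneg h.c_pos.le (by linarith)).trans hκ
  set g : Config d → Config d := fun x => x + X - xPart (hamFlow T H s t (pt x y)) with hg
  have h0 : 0 ≤ Real.exp κ - 1 := by linarith [Real.one_le_exp hκ0]
  have hc : ContractingWith (Real.exp κ - 1).toNNReal g := by
    refine ⟨Real.toNNReal_lt_one.2 (exp_sub_one_lt hκ2),
      LipschitzWith.of_dist_le_mul fun x x' => ?_⟩
    rw [dist_eq_norm, dist_eq_norm, Real.coe_toNNReal _ h0]
    have h1 := h.drift (H' := H) hs ht hκ le_rfl (fun _ _ _ => by simp)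
      (h.isTrajectory_hamFlow hsm (pt x' y)).1 (h.isTrajectory_hamFlow hsm (pt x y)).1
      (right_mem_Icc.2 hst)
    simp only [(h.isTrajectory_hamFlow hsm _).2, zero_div, add_zero] at h1
    have h2 : ‖pt x y - pt x' y‖ ≤ ‖x - x'‖ := by
      refine (norm_le_add _).trans ?_
      simp
    have h3 := (norm_xPart_le _).trans h1
    rw [map_sub, map_sub, map_sub, xPart_pt, xPart_pt, ← norm_neg] at h3
    have e : g x - g x' = -(xPart (hamFlow T H s t (pt x y)) - xPart (hamFlow T H s t (pt x' y))
        - (x - x')) := by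
      simp only [hg]
      abel
    rw [e]
    refine h3.trans ?_
    rw [mul_comm]
    exact mul_le_mul_of_nonneg_left h2 h0
  refine ⟨pt (hc.fixedPoint g) y, phase_ext ?_ rfl⟩
  have := hc.fixedPoint_isFixedPt
  change g (hc.fixedPoint g) = hc.fixedPoint g at this
  change xPart (hamFlow T H s t (pt (hc.fixedPoint g) y)) = X
  simp only [hg] at this
  rw [add_sub_assoc, add_eq_left, sub_eq_zero] at this
  exact this.symm

end Tame

/-- `γ` is a trajectory with the boundary conditions defining the generating function and `a` is a
primitive of its Lagrangian action. -/
structure IsExtremal (T : ℝ) (H : ℝ → Phase d → ℝ) (s t : ℝ) (X y : Config d) (γ : ℝ → Phase d)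
    (a : ℝ → ℝ) : Prop where
  traj : IsTrajectory T H γ
  action : ∀ τ ∈ Icc 0 T,
    HasDerivWithinAt a (⟪yPart (γ τ), gradY H τ (γ τ)⟫ - H τ (γ τ)) (Icc 0 T) τ
  start : yPart (γ s) = y
  terminal : xPart (γ t) = X

namespace Tame

variable {T c m M : ℝ} {H : ℝ → Phase d → ℝ}

lemma continuousOn_trajectory (h : Tame T H c m M) {γ : ℝ → Phase d} (hγ : IsTrajectory T H γ) :
    ContinuousOn (fun τ => gradY H τ (γ τ)) (Icc 0 T) ∧
      ContinuousOn (fun τ => H τ (γ τ)) (Icc 0 T) := by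
  constructor
  · exact continuous_yPart.comp_continuousOn
      (h.cont.comp (continuousOn_id.prodMk hγ.continuousOn) fun τ hτ => ⟨hτ, mem_univ _⟩)
  · refine LipschitzOnWith.continuousOn (K := (M + M * M).toNNReal)
      (LipschitzOnWith.of_dist_le_mul fun τ hτ τ' hτ' => ?_)
    have hM := h.M_nonneg
    rw [Real.dist_eq, Real.dist_eq, Real.coe_toNNReal _ (by positivity)]
    have h1 := h.time_space hτ hτ' (γ τ) (γ τ')
    have h2 := mul_le_mul_of_nonneg_left (h.trajectory_lip hγ hτ' hτ) h.M_nonneg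
    linarith

/-- The term `y·Ẋ` integrates exactly, so the generating function is the action `∫ (Y·Ẋ - H)` minus
`y·(X - x_s)`. Primitives on all of `[0, T]` allow extremals with different end times to be
compared. -/
lemma exists_isExtremal (h : Tame T H c m M) {s t κ : ℝ} (hs : 0 ≤ s) (hst : s ≤ t) (ht : t ≤ T)
    (hκ : c * (t - s) ≤ κ) (hκ2 : κ < Real.log 2) (X y : Config d) :
    ∃ a, IsExtremal T H s t X y (genCurve T H s t X y) a ∧
      genFun T H s t X y = a t - a s - ⟪y, X - xPart (genCurve T H s t X y s)⟫ := by
  have hsm : s ∈ Icc 0 T := ⟨hs, hst.trans ht⟩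
  set z := Function.invFun (alphaMap T H s t) (pt X y) with hz
  have hα : alphaMap T H s t z = pt X y :=
    Function.invFun_eq (h.exists_alphaMap_eq hs hst ht hκ hκ2 X y)
  set γ := genCurve T H s t X y with hγd
  have hγ : IsTrajectory T H γ := (h.isTrajectory_hamFlow hsm z).1
  have hγs : γ s = z := (h.isTrajectory_hamFlow hsm z).2
  have hst' : xPart (γ t) = X := congrArg xPart hα
  have hT : 0 ≤ T := hs.trans (hst.trans ht)
  set ℓ : ℝ → ℝ := fun τ => ⟪yPart (γ τ), gradY H τ (γ τ)⟫ - H τ (γ τ) with hℓ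
  have hℓc : ContinuousOn ℓ (Icc 0 T) :=
    ((continuous_yPart.comp_continuousOn hγ.continuousOn).inner
      (h.continuousOn_trajectory hγ).1).sub (h.continuousOn_trajectory hγ).2
  -- Extended by its end values, the Lagrangian is continuous on the line and its primitive is
  -- differentiable also at `0` and `T`.
  set ℓ' : ℝ → ℝ := IccExtend hT ((Icc 0 T).domRestrict ℓ) with hℓ'
  have hc' : Continuous ℓ' := (continuousOn_iff_continuous_domRestrict.1 hℓc).Icc_extend'
  have ha : ∀ τ ∈ Icc 0 T, HasDerivWithinAt (fun τ => ∫ σ in (0 : ℝ)..τ, ℓ' σ) (ℓ τ) (Icc 0 T) τ := by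
    intro τ hτ
    have h1 : ℓ' τ = ℓ τ := IccExtend_of_mem hT _ hτ
    rw [← h1]
    exact (hc'.integral_hasStrictDerivAt 0 τ).hasDerivAt.hasDerivWithinAt
  refine ⟨fun τ => ∫ σ in (0 : ℝ)..τ, ℓ' σ, ⟨hγ, ha, ?_, hst'⟩, ?_⟩
  · rw [hγs]
    exact congrArg yPart hα
  · have hsub : Icc s t ⊆ Icc 0 T := Icc_subset_Icc hs ht
    have hd : ∀ τ ∈ Icc 0 T, HasDerivWithinAt
        (fun τ => (∫ σ in (0 : ℝ)..τ, ℓ' σ) - ⟪y, xPart (γ τ)⟫)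
        (⟪yPart (γ τ) - y, gradY H τ (γ τ)⟫ - H τ (γ τ)) (Icc 0 T) τ := by
      intro τ hτ
      have h1 := (ha τ hτ).sub
        ((innerSL ℝ y).hasFDerivAt.comp_hasDerivWithinAt τ (hγ.hasDerivWithinAt_xPart hτ))
      refine h1.congr_deriv ?_
      rw [innerSL_apply_apply, inner_sub_left]
      ring
    have h2 := intervalIntegral.integral_eq_sub_of_hasDerivAt_of_le hst
      (fun τ hτ => (hd τ (hsub hτ)).continuousWithinAt.mono hsub)
      (fun τ hτ => (hd τ (hsub ⟨hτ.1.le, hτ.2.le⟩)).hasDerivAt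
        (Icc_mem_nhds (hs.trans_lt hτ.1) (hτ.2.trans_le ht)))
      (ContinuousOn.intervalIntegrable_of_Icc hst
        ((((continuous_yPart.comp_continuousOn hγ.continuousOn).sub continuousOn_const).inner
          (h.continuousOn_trajectory hγ).1).sub (h.continuousOn_trajectory hγ).2 |>.mono hsub))
    change ∫ τ in s..t, (⟪yPart (γ τ) - y, gradY H τ (γ τ)⟫ - H τ (γ τ)) = _
    rw [h2, hst', inner_sub_right]
    ring

end Tame

end

end HamiltonJacobi

/-! ### Stability of extremals and expansion of the generating function. -/

namespace HamiltonJacobi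

noncomputable section

variable {d : ℕ}

/-- The constant in the stability estimate for extremals. -/
def driftConst (c M κ : ℝ) : ℝ := 2 * (1 + M + 1 / c) / (2 - Real.exp κ) + 1 / c

namespace Tame

variable {T c m M : ℝ} {H H' : ℝ → Phase d → ℝ}

lemma driftConst_nonneg (h : Tame T H c m M) {κ : ℝ} (hκ2 : κ < Real.log 2) :
    0 ≤ driftConst c M κ := by
  have h1 := exp_sub_one_lt hκ2
  have h2 := h.c_pos
  have h3 := h.M_nonneg
  have h4 : 0 < 2 - Real.exp κ := by linarith
  unfold driftConst
  positivity

/-- Stability of extremals with respect to the boundary data and the Hamiltonian. -/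
lemma extremal_drift (h : Tame T H c m M) (h' : Tame T H' c m M) {κ ε : ℝ} (hκ2 : κ < Real.log 2)
    (hε : 0 ≤ ε) (hH : ∀ τ ∈ Icc 0 T, ∀ z, ‖gradient (H' τ) z - gradient (H τ) z‖ ≤ ε)
    {s t s' t' : ℝ} (hs : 0 ≤ s) (hst : s ≤ t) (ht : t ≤ T) (hκ : c * (t - s) ≤ κ)
    (hs' : s' ∈ Icc 0 T) (ht' : t' ∈ Icc 0 T) {X y X' y' : Config d} {γ γ' : ℝ → Phase d}
    {a a' : ℝ → ℝ} (hγ : IsExtremal T H s t X y γ a) (hγ' : IsExtremal T H' s' t' X' y' γ' a')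
    {τ : ℝ} (hτ : τ ∈ Icc s t) :
    ‖γ' τ - γ τ‖ ≤ driftConst c M κ * (‖X' - X‖ + ‖y' - y‖ + |s' - s| + |t' - t| + ε) := by
  have hc := h.c_pos
  have hM := h.M_nonneg
  have hsT : s ∈ Icc 0 T := ⟨hs, hst.trans ht⟩
  have htT : t ∈ Icc 0 T := ⟨hs.trans hst, ht⟩
  set q := Real.exp κ - 1 with hq
  have hq1 : q < 1 := exp_sub_one_lt hκ2
  have hq0 : 0 ≤ q := by
    have : 0 ≤ κ := (mul_nonneg hc.le (by linarith)).trans hκ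
    linarith [Real.one_le_exp this]
  have e0 : 0 ≤ ε / c := by positivity
  have h1 : ‖yPart (γ' s) - yPart (γ s)‖ ≤ ‖y' - y‖ + M * |s' - s| := by
    have h2 := h'.trajectory_yPart_lip hγ'.traj hs' hsT
    rw [hγ'.start, abs_sub_comm] at h2
    have h3 := norm_sub_le_norm_sub_add_norm_sub (yPart (γ' s)) y' y
    have h4 := mul_le_mul_of_nonneg_right h.m_le (abs_nonneg (s' - s))
    rw [hγ.start]
    linarith
  have h2 : ‖xPart (γ' t) - xPart (γ t)‖ ≤ ‖X' - X‖ + M * |t' - t| := by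
    have h2 := h'.trajectory_xPart_lip hγ'.traj ht' htT
    rw [hγ'.terminal, abs_sub_comm] at h2
    have h3 := norm_sub_le_norm_sub_add_norm_sub (xPart (γ' t)) X' X
    rw [hγ.terminal]
    linarith
  have hd : ∀ τ ∈ Icc s t, ‖(γ' τ - γ τ) - (γ' s - γ s)‖ ≤ (‖γ' s - γ s‖ + ε / c) * q :=
    fun τ hτ => h.drift hs ht hκ hε hH hγ.traj hγ'.traj hτ
  -- The data are mixed, `y` at time `s` and `X` at time `t`. Carrying the condition on `X` back to
  -- `s` costs `q` times the unknown initial distance, which is absorbed because `q < 1`; hence the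
  -- denominator `1 - q = 2 - exp κ` in `driftConst`.
  have h3 : ‖xPart (γ' s) - xPart (γ s)‖
      ≤ ‖xPart (γ' t) - xPart (γ t)‖ + (‖γ' s - γ s‖ + ε / c) * q := by
    have h4 := (norm_xPart_le _).trans (hd t (right_mem_Icc.2 hst))
    rw [map_sub, map_sub, map_sub] at h4
    have h5 := norm_sub_norm_le (xPart (γ' s) - xPart (γ s)) (xPart (γ' t) - xPart (γ t))
    rw [norm_sub_rev (xPart (γ' t) - xPart (γ t))] at h4
    linarith
  have h4 : ‖γ' s - γ s‖ ≤ ‖xPart (γ' s) - xPart (γ s)‖ + ‖yPart (γ' s) - yPart (γ s)‖ := by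
    simpa only [map_sub] using norm_le_add (γ' s - γ s)
  set D := ‖X' - X‖ + ‖y' - y‖ + |s' - s| + |t' - t| + ε with hD
  have b1 := norm_nonneg (X' - X)
  have b2 := norm_nonneg (y' - y)
  have b3 := abs_nonneg (s' - s)
  have b4 := abs_nonneg (t' - t)
  have hεD : ε / c ≤ 1 / c * D := by
    rw [div_mul_eq_mul_div, one_mul]
    exact div_le_div_of_nonneg_right (by linarith) hc.le
  have h5 : ‖γ' s - γ s‖ * (2 - Real.exp κ) ≤ (1 + M + 1 / c) * D := by
    have e1 : ε / c * q ≤ ε / c := mul_le_of_le_one_right e0 hq1.le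
    have e2 : M * |s' - s| + M * |t' - t| ≤ M * D := by
      rw [← mul_add]
      exact mul_le_mul_of_nonneg_left (by linarith) hM
    have e3 : 2 - Real.exp κ = 1 - q := by rw [hq]; ring
    rw [e3]
    linarith
  have h6 : ‖γ' s - γ s‖ ≤ (1 + M + 1 / c) / (2 - Real.exp κ) * D := by
    rw [div_mul_eq_mul_div, le_div_iff₀ (by linarith)]
    exact h5
  have h7 := hd τ hτ
  have h8 := norm_sub_norm_le (γ' τ - γ τ) (γ' s - γ s)
  have h9 : (‖γ' s - γ s‖ + ε / c) * q ≤ ‖γ' s - γ s‖ + ε / c :=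
    mul_le_of_le_one_right (by positivity) hq1.le
  have h10 : driftConst c M κ * D
      = 2 * ((1 + M + 1 / c) / (2 - Real.exp κ) * D) + 1 / c * D := by
    rw [driftConst]
    ring
  rw [h10]
  linarith

/-- The action along a short piece of a trajectory. -/
lemma action_short (h : Tame T H c m M) {s t : ℝ} {X y : Config d} {γ : ℝ → Phase d}
    {a : ℝ → ℝ} (hγ : IsExtremal T H s t X y γ a) {σ σ' : ℝ} (hσ : σ ∈ Icc 0 T)
    (hσ' : σ' ∈ Icc 0 T) :
    |a σ' - a σ - ⟪yPart (γ σ), xPart (γ σ') - xPart (γ σ)⟫ + H σ (γ σ) * (σ' - σ)|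
      ≤ (2 * M ^ 2 + M) * |σ' - σ| ^ 2 := by
  have hM := h.M_nonneg
  have hsub : uIcc σ σ' ⊆ Icc 0 T := uIcc_subset_Icc hσ hσ'
  have h1 := (convex_uIcc σ σ').norm_image_sub_le_of_norm_hasDerivWithin_le
    (f := fun τ => a τ - ⟪yPart (γ σ), xPart (γ τ)⟫ + H σ (γ σ) * τ)
    (f' := fun τ => (⟪yPart (γ τ), gradY H τ (γ τ)⟫ - H τ (γ τ))
      - ⟪yPart (γ σ), gradY H τ (γ τ)⟫ + H σ (γ σ) * 1)
    (C := (2 * M ^ 2 + M) * |σ' - σ|) (fun τ hτ => ?_) (fun τ hτ => ?_) left_mem_uIcc right_mem_uIcc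
  · have e : a σ' - ⟪yPart (γ σ), xPart (γ σ')⟫ + H σ (γ σ) * σ'
        - (a σ - ⟪yPart (γ σ), xPart (γ σ)⟫ + H σ (γ σ) * σ)
        = a σ' - a σ - ⟪yPart (γ σ), xPart (γ σ') - xPart (γ σ)⟫ + H σ (γ σ) * (σ' - σ) := by
      rw [inner_sub_right]
      ring
    simp only [e, Real.norm_eq_abs] at h1
    refine h1.trans (le_of_eq ?_)
    ring
  · refine (((hγ.action τ (hsub hτ)).sub ?_).add
      ((hasDerivWithinAt_id τ _).const_mul (H σ (γ σ)))).mono hsub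
    have := (innerSL ℝ (yPart (γ σ))).hasFDerivAt.comp_hasDerivWithinAt τ
      (hγ.traj.hasDerivWithinAt_xPart (hsub hτ))
    exact this
  · have hτT := hsub hτ
    have e : (⟪yPart (γ τ), gradY H τ (γ τ)⟫ - H τ (γ τ))
        - ⟪yPart (γ σ), gradY H τ (γ τ)⟫ + H σ (γ σ) * 1
        = ⟪yPart (γ τ) - yPart (γ σ), gradY H τ (γ τ)⟫ - (H τ (γ τ) - H σ (γ σ)) := by
      rw [inner_sub_left]
      ring
    have hτσ : |τ - σ| ≤ |σ' - σ| := abs_sub_left_of_mem_uIcc hτ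
    have h2 : |⟪yPart (γ τ) - yPart (γ σ), gradY H τ (γ τ)⟫| ≤ (m * |τ - σ|) * M :=
      abs_inner_le (h.trajectory_yPart_lip hγ.traj hσ hτT) (h.norm_gradY hτT _)
    have h3 := h.time_space hτT hσ (γ τ) (γ σ)
    have h4 := mul_le_mul_of_nonneg_left (h.trajectory_lip hγ.traj hσ hτT) hM
    have h5 : m * |τ - σ| * M ≤ M * |τ - σ| * M := by
      gcongr
      exact h.m_le
    have h6 : (2 * M ^ 2 + M) * |τ - σ| ≤ (2 * M ^ 2 + M) * |σ' - σ| := by gcongr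
    rw [e, Real.norm_eq_abs]
    refine (abs_sub _ _).trans ?_
    nlinarith

/-- The difference of the actions of two nearby trajectories of two nearby Hamiltonians. -/
lemma action_sub (h : Tame T H c m M) {s t s₁ t₁ s₂ t₂ : ℝ} (hs : 0 ≤ s) (hst : s ≤ t)
    (ht : t ≤ T) {X y X' y' : Config d} {γ γ' : ℝ → Phase d} {a a' : ℝ → ℝ}
    (hγ : IsExtremal T H s₁ t₁ X y γ a) (hγ' : IsExtremal T H' s₂ t₂ X' y' γ' a') {ε B R : ℝ}
    (hH : ∀ τ ∈ Icc 0 T, ∀ z, ‖gradient (H' τ) z - gradient (H τ) z‖ ≤ ε)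
    (hB : ∀ τ ∈ Icc s t, |H' τ (γ' τ) - H τ (γ' τ)| ≤ B)
    (hR : ∀ τ ∈ Icc s t, ‖γ' τ - γ τ‖ ≤ R) :
    |(a' t - a' s) - (a t - a s) - (⟪yPart (γ t), xPart (γ' t) - xPart (γ t)⟫
        - ⟪yPart (γ s), xPart (γ' s) - xPart (γ s)⟫)|
      ≤ (B + R * (c * R + ε) + c * R ^ 2) * (t - s) := by
  have hc := h.c_pos
  have hsub : Icc s t ⊆ Icc 0 T := Icc_subset_Icc hs ht
  -- Subtracting `Y·(X' - X)` is an integration by parts which cancels the first order terms by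
  -- Hamilton's equations. What remains is `H' - H` along the second curve and products of two small
  -- quantities.
  have h1 := (convex_Icc s t).norm_image_sub_le_of_norm_hasDerivWithin_le
    (f := fun τ => a' τ - a τ - ⟪yPart (γ τ), xPart (γ' τ) - xPart (γ τ)⟫)
    (f' := fun τ => (⟪yPart (γ' τ), gradY H' τ (γ' τ)⟫ - H' τ (γ' τ))
      - (⟪yPart (γ τ), gradY H τ (γ τ)⟫ - H τ (γ τ))
      - (⟪yPart (γ τ), gradY H' τ (γ' τ) - gradY H τ (γ τ)⟫
        + ⟪-gradX H τ (γ τ), xPart (γ' τ) - xPart (γ τ)⟫))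
    (C := B + R * (c * R + ε) + c * R ^ 2) (fun τ hτ => ?_) (fun τ hτ => ?_)
    (left_mem_Icc.2 hst) (right_mem_Icc.2 hst)
  · rw [Real.norm_eq_abs, Real.norm_of_nonneg (by linarith : 0 ≤ t - s)] at h1
    refine le_trans (le_of_eq ?_) h1
    congr 1
    ring
  · have hτT := hsub hτ
    exact ((((hγ'.action τ hτT).sub (hγ.action τ hτT)).sub
      ((hγ.traj.hasDerivWithinAt_yPart hτT).inner ℝ ((hγ'.traj.hasDerivWithinAt_xPart hτT).sub
        (hγ.traj.hasDerivWithinAt_xPart hτT)))).mono hsub)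
  · have hτT := hsub hτ
    have e : (⟪yPart (γ' τ), gradY H' τ (γ' τ)⟫ - H' τ (γ' τ))
      - (⟪yPart (γ τ), gradY H τ (γ τ)⟫ - H τ (γ τ))
      - (⟪yPart (γ τ), gradY H' τ (γ' τ) - gradY H τ (γ τ)⟫
        + ⟪-gradX H τ (γ τ), xPart (γ' τ) - xPart (γ τ)⟫)
      = ⟪yPart (γ' τ) - yPart (γ τ), gradY H' τ (γ' τ) - gradY H τ (γ τ)⟫
        - (H τ (γ' τ) - H τ (γ τ) - ⟪gradient (H τ) (γ τ), γ' τ - γ τ⟫)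
        - (H' τ (γ' τ) - H τ (γ' τ)) := by
      rw [inner_gradient, map_sub, map_sub]
      simp only [inner_sub_left, inner_sub_right, inner_neg_left]
      rw [real_inner_comm (yPart (γ' τ)) (gradY H τ (γ τ)),
        real_inner_comm (yPart (γ τ)) (gradY H τ (γ τ))]
      ring
    have hRτ := hR τ hτ
    have h2 : ‖gradY H' τ (γ' τ) - gradY H τ (γ τ)‖ ≤ c * R + ε := by
      have h3 : ‖gradient (H' τ) (γ' τ) - gradient (H τ) (γ τ)‖ ≤ c * R + ε := by
        have h4 := norm_sub_le_norm_sub_add_norm_sub (gradient (H' τ) (γ' τ))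
          (gradient (H τ) (γ' τ)) (gradient (H τ) (γ τ))
        have h5 := h.lip τ hτT (γ' τ) (γ τ)
        have h6 := mul_le_mul_of_nonneg_left hRτ hc.le
        linarith [hH τ hτT (γ' τ)]
      refine le_trans ?_ h3
      rw [gradY, gradY, ← map_sub]
      exact norm_yPart_le _
    have h3 : ‖yPart (γ' τ) - yPart (γ τ)‖ ≤ R := by
      rw [← map_sub]
      exact (norm_yPart_le _).trans hRτ
    have h4 := abs_inner_le h3 h2
    have h5 := h.abs_sub_sub_inner_le hτT (γ τ) (γ' τ)
    have h6 : c * ‖γ' τ - γ τ‖ ^ 2 ≤ c * R ^ 2 := by gcongr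
    have h7 := hB τ hτ
    rw [e, Real.norm_eq_abs]
    rw [abs_le] at h4 h5 h7 ⊢
    constructor <;> linarith [h4.1, h4.2, h5.1, h5.2, h7.1, h7.2]

/-- The first order expansion of the generating function with respect to all its arguments. -/
theorem exists_genFun_expansion (h : Tame T H c m M) {κ : ℝ} (hκ2 : κ < Real.log 2) :
    ∃ C, 0 ≤ C ∧ ∀ s t s' t', 0 ≤ s → s ≤ t → t ≤ T → c * (t - s) ≤ κ → 0 ≤ s' → s' ≤ t' →
      t' ≤ T → c * (t' - s') ≤ κ → ∀ X y X' y' : Config d,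
      |genFun T H s' t' X' y' - genFun T H s t X y
        - (⟪yPart (genCurve T H s t X y t) - y, X' - X⟫
          + ⟪y' - y, xPart (genCurve T H s t X y s) - X⟫
          - H t (genCurve T H s t X y t) * (t' - t) + H s (genCurve T H s t X y s) * (s' - s))|
      ≤ C * (‖X' - X‖ + ‖y' - y‖ + |s' - s| + |t' - t|) ^ 2 := by
  have hc := h.c_pos
  have hM := h.M_nonneg
  set K := driftConst c M κ with hK
  have hK0 : 0 ≤ K := h.driftConst_nonneg hκ2
  -- The four summands collect the errors `E1`, then `E2` and `E3`, then `F1` to `F4`, then `F5`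
  -- below.
  refine ⟨2 * |κ| * K ^ 2 + 2 * (2 * M ^ 2 + M) + 4 * (K * M) + (M + K + 1), by positivity, ?_⟩
  intro s t s' t' hs hst ht hκ hs' hst' ht' hκ' X y X' y'
  have hsT : s ∈ Icc 0 T := ⟨hs, hst.trans ht⟩
  have htT : t ∈ Icc 0 T := ⟨hs.trans hst, ht⟩
  have hsT' : s' ∈ Icc 0 T := ⟨hs', hst'.trans ht'⟩
  have htT' : t' ∈ Icc 0 T := ⟨hs'.trans hst', ht'⟩
  obtain ⟨a, hγ, e⟩ := h.exists_isExtremal hs hst ht hκ hκ2 X y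
  obtain ⟨a', hγ', e'⟩ := h.exists_isExtremal hs' hst' ht' hκ' hκ2 X' y'
  set γ := genCurve T H s t X y
  set γ' := genCurve T H s' t' X' y'
  set D := ‖X' - X‖ + ‖y' - y‖ + |s' - s| + |t' - t| with hD
  have b1 := norm_nonneg (X' - X)
  have b2 := norm_nonneg (y' - y)
  have b3 := abs_nonneg (s' - s)
  have b4 := abs_nonneg (t' - t)
  have hD0 : 0 ≤ D := by positivity
  have hdr : ∀ τ ∈ Icc s t, ‖γ' τ - γ τ‖ ≤ K * D := fun τ hτ => by
    simpa using h.extremal_drift h hκ2 le_rfl (fun _ _ _ => by simp) hs hst ht hκ hsT' htT' hγ hγ' hτ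
  have hds := hdr s (left_mem_Icc.2 hst)
  have hdt := hdr t (right_mem_Icc.2 hst)
  have E1 := h.action_sub hs hst ht hγ hγ' (ε := 0) (B := 0) (fun _ _ _ => by simp)
    (fun _ _ => by simp) hdr
  have E1' : (0 + K * D * (c * (K * D) + 0) + c * (K * D) ^ 2) * (t - s)
      ≤ 2 * |κ| * K ^ 2 * D ^ 2 := by
    have e1 : (0 + K * D * (c * (K * D) + 0) + c * (K * D) ^ 2) * (t - s)
      = 2 * (c * (t - s)) * K ^ 2 * D ^ 2 := by ring
    rw [e1]
    have := hκ.trans (le_abs_self κ)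
    gcongr
  have E2 := h.action_short hγ' htT htT'
  have E3 := h.action_short hγ' hsT hsT'
  rw [hγ'.terminal] at E2
  rw [hγ.start, hγ.terminal] at E1
  have sq1 : (2 * M ^ 2 + M) * |t' - t| ^ 2 ≤ (2 * M ^ 2 + M) * D ^ 2 := by
    gcongr
    linarith
  have sq2 : (2 * M ^ 2 + M) * |s' - s| ^ 2 ≤ (2 * M ^ 2 + M) * D ^ 2 := by
    gcongr
    linarith
  have F1 : |⟪yPart (γ' t) - yPart (γ t), X' - xPart (γ' t)⟫| ≤ K * D * (M * D) := by
    refine abs_inner_le (by rw [← map_sub]; exact (norm_yPart_le _).trans hdt) ?_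
    have := h.trajectory_xPart_lip hγ'.traj htT htT'
    rw [hγ'.terminal] at this
    exact this.trans (mul_le_mul_of_nonneg_left (by linarith) hM)
  have lx := h.trajectory_xPart_lip hγ'.traj hsT hsT'
  have lx' : ‖xPart (γ' s') - xPart (γ' s)‖ ≤ M * D :=
    lx.trans (mul_le_mul_of_nonneg_left (by linarith) hM)
  have F2 : |⟪yPart (γ' s) - y, xPart (γ' s') - xPart (γ' s)⟫| ≤ K * D * (M * D) := by
    refine abs_inner_le ?_ lx'
    rw [← hγ.start, ← map_sub]
    exact (norm_yPart_le _).trans hds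
  have F3 : |(H t (γ' t) - H t (γ t)) * (t' - t)| ≤ M * (K * D) * D := by
    rw [abs_mul]
    exact mul_le_mul ((h.abs_sub_le htT _ _).trans (mul_le_mul_of_nonneg_left hdt hM))
      (by linarith) b4 (by positivity)
  have F4 : |(H s (γ' s) - H s (γ s)) * (s' - s)| ≤ M * (K * D) * D := by
    rw [abs_mul]
    exact mul_le_mul ((h.abs_sub_le hsT _ _).trans (mul_le_mul_of_nonneg_left hds hM))
      (by linarith) b3 (by positivity)
  have F5 : |⟪y' - y, (xPart (γ' s') - xPart (γ s)) - (X' - X)⟫| ≤ D * ((M + K + 1) * D) := by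
    refine abs_inner_le (by linarith) ((norm_sub_le _ _).trans ?_)
    have h1 := norm_sub_le_norm_sub_add_norm_sub (xPart (γ' s')) (xPart (γ' s)) (xPart (γ s))
    have h2 : ‖xPart (γ' s) - xPart (γ s)‖ ≤ K * D := by
      rw [← map_sub]
      exact (norm_xPart_le _).trans hds
    have : ‖X' - X‖ ≤ D := by linarith
    linarith
  -- Both actions are compared over the common interval `[s, t]`, the second extremal being defined
  -- on all of `[0, T]`; its ends are then adjusted from `s, t` to `s', t'` by `action_short`. Each
  -- remaining term is a product of two quantities of order `D`.
  have ident : genFun T H s' t' X' y' - genFun T H s t X y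
        - (⟪yPart (γ t) - y, X' - X⟫ + ⟪y' - y, xPart (γ s) - X⟫
          - H t (γ t) * (t' - t) + H s (γ s) * (s' - s))
      = ((a' t - a' s) - (a t - a s) - (⟪yPart (γ t), xPart (γ' t) - X⟫
          - ⟪y, xPart (γ' s) - xPart (γ s)⟫))
        + (a' t' - a' t - ⟪yPart (γ' t), X' - xPart (γ' t)⟫ + H t (γ' t) * (t' - t))
        - (a' s' - a' s - ⟪yPart (γ' s), xPart (γ' s') - xPart (γ' s)⟫ + H s (γ' s) * (s' - s))
        + ⟪yPart (γ' t) - yPart (γ t), X' - xPart (γ' t)⟫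
        - ⟪yPart (γ' s) - y, xPart (γ' s') - xPart (γ' s)⟫
        - (H t (γ' t) - H t (γ t)) * (t' - t) + (H s (γ' s) - H s (γ s)) * (s' - s)
        + ⟪y' - y, (xPart (γ' s') - xPart (γ s)) - (X' - X)⟫ := by
    rw [e, e']
    simp only [inner_sub_left, inner_sub_right]
    ring
  rw [ident]
  rw [abs_le] at E1 E2 E3 F1 F2 F3 F4 F5 ⊢
  constructor <;> linarith [E1.1, E1.2, E2.1, E2.2, E3.1, E3.2, F1.1, F1.2, F2.1, F2.2, F3.1, F3.2,
    F4.1, F4.2, F5.1, F5.2]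

end Tame

end

end HamiltonJacobi

/-! ### Estimates for generating functions, and moving the points of a subdivision. -/

namespace HamiltonJacobi

noncomputable section

variable {d : ℕ}

namespace Tame

variable {T c m M : ℝ} {H H' : ℝ → Phase d → ℝ}

/-! ### Properties of generating functions -/

lemma genCurve_spec (h : Tame T H c m M) {s t κ : ℝ} (hs : 0 ≤ s) (hst : s ≤ t) (ht : t ≤ T)
    (hκ : c * (t - s) ≤ κ) (hκ2 : κ < Real.log 2) (X y : Config d) :
    IsTrajectory T H (genCurve T H s t X y) ∧ yPart (genCurve T H s t X y s) = y ∧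
      xPart (genCurve T H s t X y t) = X :=
  let ⟨_, ha, _⟩ := h.exists_isExtremal hs hst ht hκ hκ2 X y
  ⟨ha.traj, ha.start, ha.terminal⟩

lemma norm_yPart_genCurve_sub_le (h : Tame T H c m M) {s t κ : ℝ} (hs : 0 ≤ s) (hst : s ≤ t)
    (ht : t ≤ T) (hκ : c * (t - s) ≤ κ) (hκ2 : κ < Real.log 2) (X y : Config d) {τ : ℝ}
    (hτ : τ ∈ Icc s t) : ‖yPart (genCurve T H s t X y τ) - y‖ ≤ m * (t - s) := by
  obtain ⟨h1, h2, -⟩ := h.genCurve_spec hs hst ht hκ hκ2 X y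
  have h3 := h.trajectory_yPart_lip h1 (τ := s) (τ' := τ) ⟨hs, hst.trans ht⟩
    ⟨hs.trans hτ.1, hτ.2.trans ht⟩
  rw [h2, abs_of_nonneg (by linarith [hτ.1])] at h3
  exact h3.trans (mul_le_mul_of_nonneg_left (by linarith [hτ.2]) h.m_nonneg)

lemma norm_xPart_genCurve_sub_le (h : Tame T H c m M) {s t κ : ℝ} (hs : 0 ≤ s) (hst : s ≤ t)
    (ht : t ≤ T) (hκ : c * (t - s) ≤ κ) (hκ2 : κ < Real.log 2) (X y : Config d) :
    ‖xPart (genCurve T H s t X y s) - X‖ ≤ M * (t - s) := by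
  obtain ⟨h1, -, h2⟩ := h.genCurve_spec hs hst ht hκ hκ2 X y
  have h3 := h.trajectory_xPart_lip h1 (τ := t) (τ' := s) ⟨hs.trans hst, ht⟩ ⟨hs, hst.trans ht⟩
  rwa [h2, abs_sub_comm, abs_of_nonneg (by linarith)] at h3

/-- The derivative in `X` is `Y_t - y`, and momentum drifts at speed at most `m` because `Ẏ =
-∂_xH`. Using `m` here, and not the cruder `M`, produces the constants of the final estimates. -/
lemma abs_genFun_sub_le_left (h : Tame T H c m M) {s t κ : ℝ} (hs : 0 ≤ s) (hst : s ≤ t)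
    (ht : t ≤ T) (hκ : c * (t - s) ≤ κ) (hκ2 : κ < Real.log 2) (X X' y : Config d) :
    |genFun T H s t X' y - genFun T H s t X y| ≤ m * (t - s) * ‖X' - X‖ := by
  obtain ⟨C, -, hC⟩ := h.exists_genFun_expansion hκ2
  have key := abs_sub_le_of_forall_local (g := fun r => genFun T H s t (X + r • (X' - X)) y)
    (B := m * (t - s) * ‖X' - X‖) (C := C * ‖X' - X‖ ^ 2) one_pos fun a _ b _ hab _ => ?_
  · simpa using key
  · have h1 := hC s t s t hs hst ht hκ hs hst ht hκ (X + a • (X' - X)) y (X + b • (X' - X)) y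
    have e : X + b • (X' - X) - (X + a • (X' - X)) = (b - a) • (X' - X) := by
      rw [sub_smul]
      abel
    rw [e, norm_smul, Real.norm_of_nonneg (by linarith : 0 ≤ b - a)] at h1
    simp only [sub_self, inner_zero_left, norm_zero, abs_zero, mul_zero, add_zero, sub_zero] at h1
    have h2 : |⟪yPart (genCurve T H s t (X + a • (X' - X)) y t) - y, (b - a) • (X' - X)⟫|
        ≤ m * (t - s) * ((b - a) * ‖X' - X‖) :=
      abs_inner_le (h.norm_yPart_genCurve_sub_le hs hst ht hκ hκ2 _ _ (right_mem_Icc.2 hst))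
        (by rw [norm_smul, Real.norm_of_nonneg (by linarith : 0 ≤ b - a)])
    have h3 : C * ((b - a) * ‖X' - X‖) ^ 2 = C * ‖X' - X‖ ^ 2 * (b - a) ^ 2 := by ring
    rw [abs_le] at h1 h2 ⊢
    constructor <;> linarith [h1.1, h1.2, h2.1, h2.2]

/-- The derivative in `y` is `x_s - X`, the displacement of the extremal, whose speed is at most
`M`. -/
lemma abs_genFun_sub_le_right (h : Tame T H c m M) {s t κ : ℝ} (hs : 0 ≤ s) (hst : s ≤ t)
    (ht : t ≤ T) (hκ : c * (t - s) ≤ κ) (hκ2 : κ < Real.log 2) (X y y' : Config d) :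
    |genFun T H s t X y' - genFun T H s t X y| ≤ M * (t - s) * ‖y' - y‖ := by
  obtain ⟨C, -, hC⟩ := h.exists_genFun_expansion hκ2
  have key := abs_sub_le_of_forall_local (g := fun r => genFun T H s t X (y + r • (y' - y)))
    (B := M * (t - s) * ‖y' - y‖) (C := C * ‖y' - y‖ ^ 2) one_pos fun a _ b _ hab _ => ?_
  · simpa using key
  · have h1 := hC s t s t hs hst ht hκ hs hst ht hκ X (y + a • (y' - y)) X (y + b • (y' - y))
    have e : y + b • (y' - y) - (y + a • (y' - y)) = (b - a) • (y' - y) := by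
      rw [sub_smul]
      abel
    rw [e, norm_smul, Real.norm_of_nonneg (by linarith : 0 ≤ b - a)] at h1
    simp only [sub_self, inner_zero_right, norm_zero, abs_zero, mul_zero, add_zero, sub_zero,
      zero_add] at h1
    have h2 : |⟪(b - a) • (y' - y), xPart (genCurve T H s t X (y + a • (y' - y)) s) - X⟫|
        ≤ ((b - a) * ‖y' - y‖) * (M * (t - s)) :=
      abs_inner_le (by rw [norm_smul, Real.norm_of_nonneg (by linarith : 0 ≤ b - a)])
        (h.norm_xPart_genCurve_sub_le hs hst ht hκ hκ2 _ _)
    have h3 : C * ((b - a) * ‖y' - y‖) ^ 2 = C * ‖y' - y‖ ^ 2 * (b - a) ^ 2 := by ring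
    rw [abs_le] at h1 h2 ⊢
    constructor <;> linarith [h1.1, h1.2, h2.1, h2.2]

lemma isLip_genFun (h : Tame T H c m M) {s t κ : ℝ} (hs : 0 ≤ s) (hst : s ≤ t)
    (ht : t ≤ T) (hκ : c * (t - s) ≤ κ) (hκ2 : κ < Real.log 2) :
    IsLip fun q : Config d × Config d => genFun T H s t q.1 q.2 := by
  refine isLip_iff.2 ⟨m * (t - s) + M * (t - s), fun q q' => ?_⟩
  have h1 := h.abs_genFun_sub_le_left hs hst ht hκ hκ2 q'.1 q.1 q.2
  have h2 := h.abs_genFun_sub_le_right hs hst ht hκ hκ2 q'.1 q'.2 q.2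
  have h3 : m * (t - s) * ‖q.1 - q'.1‖ ≤ m * (t - s) * ‖q - q'‖ :=
    mul_le_mul_of_nonneg_left (norm_fst_le (q - q')) (mul_nonneg h.m_nonneg (by linarith))
  have h4 : M * (t - s) * ‖q.2 - q'.2‖ ≤ M * (t - s) * ‖q - q'‖ :=
    mul_le_mul_of_nonneg_left (norm_snd_le (q - q')) (mul_nonneg h.M_nonneg (by linarith))
  have h5 := _root_.abs_sub_le (genFun T H s t q.1 q.2) (genFun T H s t q'.1 q.2)
    (genFun T H s t q'.1 q'.2)
  linarith

lemma continuous_genCurve (h : Tame T H c m M) {s t κ : ℝ} (hs : 0 ≤ s) (hst : s ≤ t)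
    (ht : t ≤ T) (hκ : c * (t - s) ≤ κ) (hκ2 : κ < Real.log 2) {τ : ℝ} (hτ : τ ∈ Icc s t) :
    Continuous fun q : Config d × Config d => genCurve T H s t q.1 q.2 τ := by
  have hK := h.driftConst_nonneg hκ2
  refine (LipschitzWith.of_dist_le_mul (K := (driftConst c M κ * 2).toNNReal)
    fun q q' => ?_).continuous
  rw [dist_eq_norm, dist_eq_norm, Real.coe_toNNReal _ (by positivity)]
  obtain ⟨a, ha, -⟩ := h.exists_isExtremal hs hst ht hκ hκ2 q.1 q.2
  obtain ⟨a', ha', -⟩ := h.exists_isExtremal hs hst ht hκ hκ2 q'.1 q'.2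
  have h1 := h.extremal_drift h hκ2 le_rfl (fun _ _ _ => by simp) hs hst ht hκ
    ⟨hs, hst.trans ht⟩ ⟨hs.trans hst, ht⟩ ha' ha hτ
  refine h1.trans ?_
  rw [mul_assoc]
  refine mul_le_mul_of_nonneg_left ?_ hK
  simp only [sub_self, abs_zero, add_zero]
  have h3 : ‖q.1 - q'.1‖ ≤ ‖q - q'‖ := norm_fst_le (q - q')
  have h4 : ‖q.2 - q'.2‖ ≤ ‖q - q'‖ := norm_snd_le (q - q')
  linarith

/-- The variation of the generating function with the Hamiltonian. -/
lemma abs_genFun_sub_le_of_hamiltonian (h : Tame T H c m M) (h' : Tame T H' c m M) {s t κ : ℝ}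
    (hs : 0 ≤ s) (hst : s ≤ t) (ht : t ≤ T) (hκ : c * (t - s) ≤ κ) (hκ2 : κ < Real.log 2)
    {ε B : ℝ} (hε : 0 ≤ ε) (hH : ∀ τ ∈ Icc 0 T, ∀ z, ‖gradient (H' τ) z - gradient (H τ) z‖ ≤ ε)
    {X y : Config d} (hB : ∀ τ ∈ Icc s t,
      |H' τ (genCurve T H' s t X y τ) - H τ (genCurve T H' s t X y τ)| ≤ B) :
    |genFun T H' s t X y - genFun T H s t X y| ≤ (B + (driftConst c M κ
      * (c * driftConst c M κ + 1) + c * driftConst c M κ ^ 2) * ε ^ 2) * (t - s) := by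
  obtain ⟨a, ha, e⟩ := h.exists_isExtremal hs hst ht hκ hκ2 X y
  obtain ⟨a', ha', e'⟩ := h'.exists_isExtremal hs hst ht hκ hκ2 X y
  have h1 := h.action_sub hs hst ht ha ha' hH hB (R := driftConst c M κ * ε) fun τ hτ => by
    have := h.extremal_drift h' hκ2 hε hH hs hst ht hκ ⟨hs, hst.trans ht⟩ ⟨hs.trans hst, ht⟩ ha ha'
      hτ
    simpa using this
  rw [ha.terminal, ha'.terminal, ha.start, sub_self X, inner_zero_right] at h1
  rw [e, e']
  refine le_trans (le_of_eq ?_) (h1.trans (le_of_eq ?_))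
  · congr 1
    simp only [inner_sub_right]
    ring
  · ring

end Tame

/-! ### Fine subdivisions -/

/-- Subdivisions, possibly with trivial steps, whose steps are at most `κ / c`. -/
structure IsFine (c κ s t : ℝ) {N : ℕ} (p : Fin (N + 1) → ℝ) : Prop where
  mono : Monotone p
  first : p 0 = s
  last : p (Fin.last N) = t
  step : ∀ i : Fin N, c * (p i.succ - p i.castSucc) ≤ κ

namespace IsFine

variable {c κ s t T : ℝ} {N : ℕ} {p p' : Fin (N + 1) → ℝ}

lemma mem (hp : IsFine c κ s t p) (k : Fin (N + 1)) : p k ∈ Icc s t :=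
  ⟨hp.first ▸ hp.mono (Fin.zero_le k), hp.last ▸ hp.mono (Fin.le_last k)⟩

lemma le (hp : IsFine c κ s t p) : s ≤ t := (hp.mem 0).1.trans (hp.mem 0).2

lemma le_succ (hp : IsFine c κ s t p) (i : Fin N) : p i.castSucc ≤ p i.succ :=
  hp.mono (Fin.castSucc_le_succ i)

lemma nonneg (hp : IsFine c κ s t p) (hs : 0 ≤ s) (k : Fin (N + 1)) : 0 ≤ p k :=
  hs.trans (hp.mem k).1

lemma le_of_le (hp : IsFine c κ s t p) (ht : t ≤ T) (k : Fin (N + 1)) : p k ≤ T :=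
  (hp.mem k).2.trans ht

/-- All the conditions are affine in the points, so the segment between two fine subdivisions of
equal length stays fine. Repeated points are allowed because `cons` creates them. -/
lemma convex (hp : IsFine c κ s t p) (hp' : IsFine c κ s t p') {r : ℝ} (hr : r ∈ Icc (0 : ℝ) 1) :
    IsFine c κ s t fun k => p k + r * (p' k - p k) := by
  have h1 : 0 ≤ 1 - r := by linarith [hr.2]
  refine ⟨fun k l hkl => ?_, by simp [hp.first, hp'.first], by simp [hp.last, hp'.last],
    fun i => ?_⟩
  · have := mul_le_mul_of_nonneg_left (hp.mono hkl) h1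
    have := mul_le_mul_of_nonneg_left (hp'.mono hkl) hr.1
    change p k + r * (p' k - p k) ≤ p l + r * (p' l - p l)
    linarith
  · have := mul_le_mul_of_nonneg_left (hp.step i) h1
    have := mul_le_mul_of_nonneg_left (hp'.step i) hr.1
    linarith

lemma cons (hp : IsFine c κ s t p) (hκ : 0 ≤ κ) :
    IsFine c κ s t (Fin.cons s p : Fin (N + 2) → ℝ) := by
  refine ⟨?_, by simp, ?_, fun i => ?_⟩
  · rw [Fin.monotone_iff_le_succ]
    intro i
    refine Fin.cases ?_ (fun j => ?_) i
    · simp [hp.first]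
    · rw [← Fin.succ_castSucc, Fin.cons_succ, Fin.cons_succ]
      exact hp.le_succ j
  · rw [← Fin.succ_last, Fin.cons_succ, hp.last]
  · refine Fin.cases ?_ (fun j => ?_) i
    · simp [hp.first, hκ]
    · rw [← Fin.succ_castSucc, Fin.cons_succ, Fin.cons_succ]
      exact hp.step j

end IsFine

lemma genFamily_eq_famS {T : ℝ} {H : ℝ → Phase d → ℝ} {N : ℕ} (p : Fin (N + 1) → ℝ)
    (v : Config d → ℝ) (x : Config d) : genFamily T H p v x
      = famS (fun i => genFun T H (p i.castSucc) (p i.succ)) v x := rfl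

namespace Tame

variable {T c m M : ℝ} {H : ℝ → Phase d → ℝ}

lemma isLip_genFun_step (h : Tame T H c m M) {κ s t : ℝ} (hκ2 : κ < Real.log 2) (hs : 0 ≤ s)
    (ht : t ≤ T) {N : ℕ} {p : Fin (N + 1) → ℝ} (hp : IsFine c κ s t p) (i : Fin N) :
    IsLip fun q : Config d × Config d => genFun T H (p i.castSucc) (p i.succ) q.1 q.2 :=
  h.isLip_genFun (hp.nonneg hs _) (hp.le_succ i) (hp.le_of_le ht _) (hp.step i) hκ2

lemma isQuadLip_genFamily (h : Tame T H c m M) {κ s t : ℝ} (hκ2 : κ < Real.log 2) (hs : 0 ≤ s)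
    (ht : t ≤ T) {N : ℕ} {p : Fin (N + 1) → ℝ} (hp : IsFine c κ s t p) {v : Config d → ℝ}
    (hv : IsLip v) (x : Config d) : IsQuadLip (genFamily T H p v x) :=
  isQuadLip_famS (h.isLip_genFun_step hκ2 hs ht hp) hv x

end Tame

/-! ### Independence of the subdivision -/

/-- A continuous substitute for the multiple `w'` of `w` with `⟪w, w'⟫ = u`. -/
def soften (ε u : ℝ) (w : Config d) : Config d := (u / (‖w‖ ^ 2 + ε ^ 2)) • w

lemma norm_soften_le {ε u M : ℝ} {w : Config d} (hε : 0 < ε) (hM : 0 ≤ M) (hu : |u| ≤ M * ‖w‖) :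
    ‖soften ε u w‖ ≤ M := by
  have h0 : 0 < ‖w‖ ^ 2 + ε ^ 2 := by positivity
  rw [soften, norm_smul, Real.norm_eq_abs, abs_div, abs_of_pos h0, div_mul_eq_mul_div,
    div_le_iff₀ h0]
  have := mul_le_mul_of_nonneg_right hu (norm_nonneg w)
  nlinarith [mul_nonneg hM (sq_nonneg ε)]

lemma abs_inner_soften_sub_le {ε u M : ℝ} {w : Config d} (hε : 0 < ε) (hM : 0 ≤ M)
    (hu : |u| ≤ M * ‖w‖) : |⟪w, soften ε u w⟫ - u| ≤ M * ε := by
  have h0 : 0 < ‖w‖ ^ 2 + ε ^ 2 := by positivity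
  have e : ⟪w, soften ε u w⟫ - u = -(u * ε ^ 2 / (‖w‖ ^ 2 + ε ^ 2)) := by
    rw [soften, real_inner_smul_right, real_inner_self_eq_norm_sq]
    field_simp
    ring
  rw [e, abs_neg, abs_div, abs_of_pos h0, abs_mul, abs_of_pos (pow_pos hε 2), div_le_iff₀ h0]
  have h1 := mul_le_mul_of_nonneg_right hu (sq_nonneg ε)
  have h2 : ‖w‖ * ε ≤ ‖w‖ ^ 2 + ε ^ 2 := by nlinarith [sq_nonneg (‖w‖ - ε), norm_nonneg w]
  have h3 := mul_le_mul_of_nonneg_left h2 (mul_nonneg hM hε.le)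
  nlinarith

lemma continuous_soften {α : Type*} [TopologicalSpace α] {ε : ℝ} (hε : 0 < ε) {u : α → ℝ}
    {w : α → Config d} (hu : Continuous u) (hw : Continuous w) :
    Continuous fun a => soften ε (u a) (w a) :=
  (hu.div (by fun_prop) fun a => by positivity).smul hw

lemma node_add {N : ℕ} (x : Config d) (η ξ : Fibre d N) (k : Fin (N + 1)) :
    node x (η + ξ) k = node x η k + node 0 ξ k := by
  rw [node_eq, node_eq x η, node_eq 0 ξ, map_add]
  split_ifs <;> abel

namespace Tame

variable {T c m M : ℝ} {H : ℝ → Phase d → ℝ}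

/-- At a critical point adjacent extremals match, so the value is stationary in the interior times.
Elsewhere the time derivative at a node is `-(u₁ + u₂)`, split through the point `(x_j, y_j)`: the
incoming extremal shares its `x`, the outgoing one its `y`, so `|u₁| ≤ M‖w₁‖` and `|u₂| ≤ M‖w₂‖`.
Here `w₁` and `w₂` are the derivatives of the family in `x_j` and `y_j`, so a displacement of size
`O(β)` cancels the first order change. Softening with parameter `β` makes this displacement
continuous at an error `O(β²)`. -/
theorem exists_subdivision_estimate (h : Tame T H c m M) {κ : ℝ} (hκ2 : κ < Real.log 2) (N : ℕ) :
    ∃ C, 0 ≤ C ∧ ∀ (s t β : ℝ) (p p' : Fin (N + 2) → ℝ) (v : Config d → ℝ) (x : Config d)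
      (r r' : ℝ), 0 < β → 0 ≤ s → t ≤ T → IsFine c κ s t p → IsFine c κ s t p' →
      (∀ k, |p' k - p k| ≤ β) → IsLip v →
      IsMinmax (quadForm d (N + 1)) (genFamily T H p v x) r →
      IsMinmax (quadForm d (N + 1)) (genFamily T H p' v x) r' → r' ≤ r + C * β ^ 2 := by
  obtain ⟨C, hC0, hC⟩ := h.exists_genFun_expansion hκ2
  have hM := h.M_nonneg
  refine ⟨∑ _i : Fin (N + 1), (C * (2 * M + 2) ^ 2 + 2 * M ^ 2) + ∑ _j : Fin N, 2 * M,
    by positivity, ?_⟩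
  intro s t β p p' v x r r' hβ hs ht hp hp' hpp hv hr hr'
  have g0 := hp.nonneg hs
  have gT := hp.le_of_le ht
  have g0' := hp'.nonneg hs
  have gT' := hp'.le_of_le ht
  set γ : Fibre d (N + 1) → Fin (N + 1) → ℝ → Phase d := fun η i =>
    genCurve T H (p i.castSucc) (p i.succ) (node x η i.succ) (yPart (η i)) with hγ
  have hspec : ∀ η i, IsTrajectory T H (γ η i) ∧ yPart (γ η i (p i.castSucc)) = yPart (η i) ∧
      xPart (γ η i (p i.succ)) = node x η i.succ := fun η i =>
    h.genCurve_spec (g0 _) (hp.le_succ i) (gT _) (hp.step i) hκ2 _ _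
  have hγc : ∀ i, ∀ τ ∈ Icc (p i.castSucc) (p i.succ), Continuous fun η => γ η i τ :=
    fun i τ hτ => (h.continuous_genCurve (g0 _) (hp.le_succ i) (gT _) (hp.step i) hκ2 hτ).comp
      ((continuous_node x _).prodMk (continuous_yPart.comp (continuous_apply i)))
  -- the time of an interior node
  set θ : Fin N → ℝ := fun j => p j.castSucc.succ with hθ
  have hθm : ∀ j, θ j ∈ Icc 0 T := fun j => ⟨g0 _, gT _⟩
  set w₁ : Fibre d (N + 1) → Fin N → Config d := fun η j =>
    yPart (γ η j.castSucc (θ j)) - yPart (η j.succ) with hw₁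
  set w₂ : Fibre d (N + 1) → Fin N → Config d := fun η j =>
    xPart (γ η j.succ (θ j)) - xPart (η j.succ) with hw₂
  set u₁ : Fibre d (N + 1) → Fin N → ℝ := fun η j =>
    H (θ j) (γ η j.castSucc (θ j)) - H (θ j) (η j.succ) with hu₁
  set u₂ : Fibre d (N + 1) → Fin N → ℝ := fun η j =>
    H (θ j) (η j.succ) - H (θ j) (γ η j.succ (θ j)) with hu₂
  have hnode : ∀ (η : Fibre d (N + 1)) (j : Fin N), node x η j.castSucc.succ = xPart (η j.succ) :=
    fun η j => node_castSucc x η j.succ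
  have hu₁' : ∀ η j, |u₁ η j| ≤ M * ‖w₁ η j‖ := by
    intro η j
    refine (h.abs_sub_le (hθm j) _ _).trans (mul_le_mul_of_nonneg_left ?_ hM)
    refine (norm_le_add _).trans (le_of_eq ?_)
    have e : xPart (γ η j.castSucc (θ j)) = xPart (η j.succ) :=
      (hspec η j.castSucc).2.2.trans (hnode η j)
    rw [map_sub, map_sub, e, sub_self, norm_zero, zero_add]
  have hu₂' : ∀ η j, |u₂ η j| ≤ M * ‖w₂ η j‖ := by
    intro η j
    refine (h.abs_sub_le (hθm j) _ _).trans (mul_le_mul_of_nonneg_left ?_ hM)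
    rw [norm_sub_rev]
    refine (norm_le_add _).trans (le_of_eq ?_)
    have e : yPart (γ η j.succ (θ j)) = yPart (η j.succ) := (hspec η j.succ).2.1
    rw [map_sub, map_sub, e, sub_self, norm_zero, add_zero]
  set Δ : Fin (N + 2) → ℝ := fun k => p' k - p k with hΔ
  -- The node `x_0` and its momentum do not move, since the initial time is fixed; in particular `v`
  -- is not affected.
  set ξ : Fibre d (N + 1) → Fibre d (N + 1) := fun η => Fin.cons 0 fun j =>
    Δ j.castSucc.succ • pt (soften β (u₁ η j) (w₁ η j)) (soften β (u₂ η j) (w₂ η j)) with hξ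
  have hξx : ∀ η i, ‖xPart (ξ η i)‖ ≤ M * β := by
    intro η i
    refine Fin.cases ?_ (fun j => ?_) i
    · simp only [hξ, Fin.cons_zero, map_zero, norm_zero]
      positivity
    · simp only [hξ, Fin.cons_succ, map_smul, xPart_pt, norm_smul, Real.norm_eq_abs]
      rw [mul_comm]
      exact mul_le_mul (norm_soften_le hβ hM (hu₁' η j)) (hpp _) (abs_nonneg _) hM
  have hξy : ∀ η i, ‖yPart (ξ η i)‖ ≤ M * β := by
    intro η i
    refine Fin.cases ?_ (fun j => ?_) i
    · simp only [hξ, Fin.cons_zero, map_zero, norm_zero]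
      positivity
    · simp only [hξ, Fin.cons_succ, map_smul, yPart_pt, norm_smul, Real.norm_eq_abs]
      rw [mul_comm]
      exact mul_le_mul (norm_soften_le hβ hM (hu₂' η j)) (hpp _) (abs_nonneg _) hM
  have hξn : ∀ η k, ‖node 0 (ξ η) k‖ ≤ M * β := by
    intro η k
    refine Fin.lastCases ?_ (fun i => ?_) k
    · rw [node_last, norm_zero]
      positivity
    · rw [node_castSucc]
      exact hξx η i
  have hξc : Continuous ξ := by
    refine continuous_pi fun i => ?_
    refine Fin.cases ?_ (fun j => ?_) i
    · simp only [hξ, Fin.cons_zero]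
      exact continuous_const
    · simp only [hξ, Fin.cons_succ]
      have hH : Continuous (H (θ j)) := (h.diff _ (hθm j)).continuous
      have c1 : Continuous fun η => γ η j.castSucc (θ j) :=
        hγc j.castSucc _ (right_mem_Icc.2 (hp.le_succ _))
      have c2 : Continuous fun η => γ η j.succ (θ j) :=
        hγc j.succ _ (left_mem_Icc.2 (hp.le_succ _))
      have c3 : Continuous fun η : Fibre d (N + 1) => η j.succ := continuous_apply _
      have c4 := (continuous_pt (continuous_soften hβ ((hH.comp c1).sub (hH.comp c3))
        ((continuous_yPart.comp c1).sub (continuous_yPart.comp c3)))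
        (continuous_soften hβ ((hH.comp c3).sub (hH.comp c2))
        ((continuous_xPart.comp c2).sub (continuous_xPart.comp c3))))
      exact (continuous_const_smul (Δ j.castSucc.succ)).comp c4
  refine isMinmax_le_add hr' hr (h.isQuadLip_genFamily hκ2 hs ht hp' hv x)
    (h.isQuadLip_genFamily hκ2 hs ht hp hv x) (M * β + M * β) fun K B _ =>
    ⟨⟨fun q => q.1 + q.2 • ξ q.1, by fun_prop⟩, ?_, ?_, ?_⟩
  · simp
  · intro η _
    refine le_max_of_le_left ?_
    simp only [ContinuousMap.coe_mk, one_smul]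
    have step : ∀ i : Fin (N + 1),
        genFun T H (p' i.castSucc) (p' i.succ) (node x (η + ξ η) i.succ) (yPart ((η + ξ η) i))
          + ⟪node x (η + ξ η) i.succ - node x (η + ξ η) i.castSucc, yPart ((η + ξ η) i)⟫
        ≤ genFun T H (p i.castSucc) (p i.succ) (node x η i.succ) (yPart (η i))
          + ⟪node x η i.succ - node x η i.castSucc, yPart (η i)⟫
          + (⟪yPart (γ η i (p i.succ)), node 0 (ξ η) i.succ⟫ - H (p i.succ) (γ η i (p i.succ)) * Δ i.succ)
          + (H (p i.castSucc) (γ η i (p i.castSucc)) * Δ i.castSucc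
            - ⟪yPart (η i), node 0 (ξ η) i.castSucc⟫
            + ⟪yPart (ξ η i), xPart (γ η i (p i.castSucc)) - node x η i.castSucc⟫)
          + (C * (2 * M + 2) ^ 2 + 2 * M ^ 2) * β ^ 2 := by
      intro i
      have h1 := hC _ _ _ _ (g0 i.castSucc) (hp.le_succ i) (gT i.succ) (hp.step i) (g0' i.castSucc)
        (hp'.le_succ i) (gT' i.succ) (hp'.step i) (node x η i.succ) (yPart (η i))
        (node x (η + ξ η) i.succ) (yPart ((η + ξ η) i))
      rw [node_add, node_add, Pi.add_apply, map_add] at *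
      rw [add_sub_cancel_left, add_sub_cancel_left] at h1
      have h2 : C * (‖node 0 (ξ η) i.succ‖ + ‖yPart (ξ η i)‖ + |p' i.castSucc - p i.castSucc|
          + |p' i.succ - p i.succ|) ^ 2 ≤ C * ((2 * M + 2) * β) ^ 2 := by
        have := hξn η i.succ
        have := hξy η i
        have := hpp i.castSucc
        have := hpp i.succ
        gcongr
        linarith
      have h3 : |⟪node 0 (ξ η) i.succ - node 0 (ξ η) i.castSucc, yPart (ξ η i)⟫|
          ≤ (M * β + M * β) * (M * β) :=
        abs_inner_le ((norm_sub_le _ _).trans (add_le_add (hξn η _) (hξn η _))) (hξy η i)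
      have e : ⟪node x η i.succ + node 0 (ξ η) i.succ
            - (node x η i.castSucc + node 0 (ξ η) i.castSucc), yPart (η i) + yPart (ξ η i)⟫
          = ⟪node x η i.succ - node x η i.castSucc, yPart (η i)⟫
            + ⟪yPart (η i), node 0 (ξ η) i.succ⟫ - ⟪yPart (η i), node 0 (ξ η) i.castSucc⟫
            + ⟪yPart (ξ η i), node x η i.succ⟫ - ⟪yPart (ξ η i), node x η i.castSucc⟫
            + ⟪node 0 (ξ η) i.succ - node 0 (ξ η) i.castSucc, yPart (ξ η i)⟫ := by
        simp only [inner_sub_left, inner_add_left, inner_add_right]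
        rw [real_inner_comm (yPart (η i)) (node 0 (ξ η) i.succ),
          real_inner_comm (yPart (η i)) (node 0 (ξ η) i.castSucc),
          real_inner_comm (yPart (ξ η i)) (node x η i.succ),
          real_inner_comm (yPart (ξ η i)) (node x η i.castSucc)]
        ring
      rw [e]
      simp only [inner_sub_left, inner_sub_right] at h1 h3 ⊢
      have h4 := (abs_le.1 h1).2
      have h5 := (abs_le.1 h3).2
      simp only [hγ, hΔ]
      nlinarith
    -- The terms are regrouped by interior nodes: terminal contributions here and initial ones in
    -- `hB`. The ends drop out because `Δ` vanishes there and neither `x_N` nor `(x_0, y_0)` moves.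
    have hA : ∑ i : Fin (N + 1), (⟪yPart (γ η i (p i.succ)), node 0 (ξ η) i.succ⟫
          - H (p i.succ) (γ η i (p i.succ)) * Δ i.succ)
        = ∑ j : Fin N, (⟪yPart (γ η j.castSucc (θ j)), xPart (ξ η j.succ)⟫
          - H (θ j) (γ η j.castSucc (θ j)) * Δ j.castSucc.succ) := by
      rw [Fin.sum_univ_castSucc]
      have e1 : Δ (Fin.last N).succ = 0 := by
        rw [Fin.succ_last, hΔ]
        simp only [hp.last, hp'.last, sub_self]
      rw [e1, Fin.succ_last, node_last, inner_zero_right, mul_zero, sub_zero, add_zero]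
      refine Finset.sum_congr rfl fun j _ => ?_
      have e2 : node 0 (ξ η) j.castSucc.succ = xPart (ξ η j.succ) := node_castSucc 0 (ξ η) j.succ
      rw [e2]
    have hB : ∑ i : Fin (N + 1), (H (p i.castSucc) (γ η i (p i.castSucc)) * Δ i.castSucc
          - ⟪yPart (η i), node 0 (ξ η) i.castSucc⟫
          + ⟪yPart (ξ η i), xPart (γ η i (p i.castSucc)) - node x η i.castSucc⟫)
        = ∑ j : Fin N, (H (θ j) (γ η j.succ (θ j)) * Δ j.castSucc.succ
          - ⟪yPart (η j.succ), xPart (ξ η j.succ)⟫ + ⟪yPart (ξ η j.succ), w₂ η j⟫) := by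
      rw [Fin.sum_univ_succ]
      have e1 : Δ (0 : Fin (N + 1)).castSucc = 0 := by
        rw [Fin.castSucc_zero, hΔ]
        simp only [hp.first, hp'.first, sub_self]
      have e2 : ξ η 0 = 0 := rfl
      rw [e1, node_castSucc, e2, map_zero, map_zero, inner_zero_right, inner_zero_left, mul_zero,
        sub_zero, add_zero, zero_add]
      refine Finset.sum_congr rfl fun j _ => ?_
      rw [node_castSucc, node_castSucc]
      rfl
    have hAB : ∀ j : Fin N, (⟪yPart (γ η j.castSucc (θ j)), xPart (ξ η j.succ)⟫
          - H (θ j) (γ η j.castSucc (θ j)) * Δ j.castSucc.succ)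
        + (H (θ j) (γ η j.succ (θ j)) * Δ j.castSucc.succ
          - ⟪yPart (η j.succ), xPart (ξ η j.succ)⟫ + ⟪yPart (ξ η j.succ), w₂ η j⟫)
        ≤ 2 * M * β ^ 2 := by
      intro j
      have e1 : xPart (ξ η j.succ) = Δ j.castSucc.succ • soften β (u₁ η j) (w₁ η j) := by
        simp only [hξ, Fin.cons_succ, map_smul, xPart_pt]
      have e2 : yPart (ξ η j.succ) = Δ j.castSucc.succ • soften β (u₂ η j) (w₂ η j) := by
        simp only [hξ, Fin.cons_succ, map_smul, yPart_pt]
      have h1 := abs_inner_soften_sub_le hβ hM (hu₁' η j)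
      have h2 := abs_inner_soften_sub_le hβ hM (hu₂' η j)
      have h3 : |Δ j.castSucc.succ * (⟪w₁ η j, soften β (u₁ η j) (w₁ η j)⟫ - u₁ η j
          + (⟪w₂ η j, soften β (u₂ η j) (w₂ η j)⟫ - u₂ η j))| ≤ β * (M * β + M * β) := by
        rw [abs_mul]
        exact mul_le_mul (hpp _) ((abs_add_le _ _).trans (add_le_add h1 h2)) (abs_nonneg _) hβ.le
      have ew : ∀ z, ⟪w₁ η j, z⟫ = ⟪yPart (γ η j.castSucc (θ j)), z⟫ - ⟪yPart (η j.succ), z⟫ :=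
        fun z => inner_sub_left _ _ _
      refine le_trans (le_of_eq ?_) ((le_abs_self _).trans (h3.trans (le_of_eq (by ring))))
      rw [e1, e2, real_inner_smul_right, real_inner_smul_right, real_inner_smul_left,
        real_inner_comm (w₂ η j), ew]
      simp only [hu₁, hu₂]
      ring
    have hsum := Finset.sum_le_sum fun i (_ : i ∈ Finset.univ) => step i
    have hsum' := Finset.sum_le_sum fun j (_ : j ∈ Finset.univ) => hAB j
    simp only [Finset.sum_add_distrib, Finset.sum_sub_distrib] at hsum hsum' hA hB
    have e0 : node x (η + ξ η) 0 = node x η 0 := by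
      have e2 : ξ η 0 = 0 := rfl
      rw [node_zero, node_zero, Pi.add_apply, e2, add_zero]
    simp only [genFamily, e0, add_mul, Finset.sum_mul, Finset.sum_add_distrib] at hsum ⊢
    linarith
  · intro η σ hσ
    right
    simp only [ContinuousMap.coe_mk, add_sub_cancel_left, norm_smul, Real.norm_eq_abs,
      abs_of_nonneg hσ.1]
    refine (mul_le_of_le_one_left (norm_nonneg _) hσ.2).trans ?_
    refine (pi_norm_le_iff_of_nonneg (by positivity)).2 fun i => ?_
    exact (norm_le_add _).trans (add_le_add (hξx η i) (hξy η i))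

end Tame

end

end HamiltonJacobi

/-! ### Bounds for compactly supported Hamiltonians; the minmax operator is well defined. -/

namespace HamiltonJacobi

noncomputable section

variable {d : ℕ}

/-! ### Sup norms and Lipschitz constants -/

lemma supNorm_nonneg {α F : Type*} [SeminormedAddGroup F] (A : Set α) (f : α → F) :
    0 ≤ supNorm A f := by
  refine Real.sSup_nonneg ?_
  rintro _ ⟨a, -, rfl⟩
  exact norm_nonneg _

lemma le_supNorm {α F : Type*} [Norm F] {A : Set α} {f : α → F} {B : ℝ} (hB : ∀ a ∈ A, ‖f a‖ ≤ B)
    {a : α} (ha : a ∈ A) : ‖f a‖ ≤ supNorm A f :=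
  le_csSup ⟨B, by rintro _ ⟨a, ha, rfl⟩; exact hB a ha⟩ ⟨a, ha, rfl⟩

lemma IsLip.lipschitzWith {X : Type*} [PseudoMetricSpace X] {f : X → ℝ} (hf : IsLip f) :
    LipschitzWith (lipConst f) f := by
  refine LipschitzWith.of_dist_le_mul fun x y => ?_
  obtain ⟨C, hC⟩ := hf
  rcases (dist_nonneg (x := x) (y := y)).eq_or_lt with h | h
  · have := hC.dist_le_mul x y
    rw [← h, mul_zero] at this ⊢
    exact this
  · rw [← div_le_iff₀ h]
    have : Real.toNNReal (dist (f x) (f y) / dist x y) ≤ lipConst f := by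
      refine le_csInf ⟨C, hC⟩ fun K hK => ?_
      rw [Real.toNNReal_le_iff_le_coe, div_le_iff₀ h]
      exact LipschitzWith.dist_le_mul hK x y
    exact Real.toNNReal_le_iff_le_coe.1 this

lemma IsLip.sub_le {E : Type*} [NormedAddCommGroup E] {f : E → ℝ} (hf : IsLip f) (x y : E) :
    f x - f y ≤ lipConst f * ‖x - y‖ := by
  have := hf.lipschitzWith.dist_le_mul x y
  rw [Real.dist_eq, dist_eq_norm] at this
  exact (le_abs_self _).trans this

/-! ### Bounds for compactly supported Hamiltonians -/

section Bounds

variable {T : ℝ}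

lemma exists_bound_of_vanishing {E : Type*} [NormedAddCommGroup E] {A : ℝ × Phase d → E} {R : ℝ}
    (hA : ContinuousOn A (Icc 0 T ×ˢ univ))
    (h0 : ∀ q ∈ Icc 0 T ×ˢ univ, R < ‖q.2‖ → A q = 0) :
    ∃ B, ∀ q ∈ Icc 0 T ×ˢ univ, ‖A q‖ ≤ B := by
  obtain ⟨B, hB⟩ := (isCompact_Icc.prod (isCompact_closedBall (0 : Phase d) R)).exists_bound_of_continuousOn
    (hA.mono (prod_mono le_rfl (subset_univ _)))
  refine ⟨max B 0, fun q hq => ?_⟩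
  by_cases h : R < ‖q.2‖
  · rw [h0 q hq h, norm_zero]
    exact le_max_right _ _
  · exact (hB q ⟨hq.1, mem_closedBall_zero_iff.2 (not_lt.1 h)⟩).trans (le_max_left _ _)

lemma fderivWithin_eq_zero_of_vanishing {E : Type*} [NormedAddCommGroup E] [NormedSpace ℝ E]
    {A : ℝ × Phase d → E} {R : ℝ}
    (h0 : ∀ q ∈ Icc 0 T ×ˢ (univ : Set (Phase d)), R < ‖q.2‖ → A q = 0) :
    ∀ q ∈ Icc 0 T ×ˢ (univ : Set (Phase d)), R < ‖q.2‖ →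
      fderivWithin ℝ A (Icc 0 T ×ˢ univ) q = 0 := by
  intro q hq hR
  have hev : A =ᶠ[𝓝[Icc 0 T ×ˢ univ] q] fun _ => 0 := by
    have ho : IsOpen {q : ℝ × Phase d | R < ‖q.2‖} := isOpen_lt continuous_const (by fun_prop)
    filter_upwards [self_mem_nhdsWithin, mem_nhdsWithin_of_mem_nhds (ho.mem_nhds hR)] with p hp hp'
    exact h0 p hp hp'
  rw [hev.fderivWithin_eq (h0 q hq hR), fderivWithin_const_apply]

end Bounds

lemma uniqueDiffOn_strip {T : ℝ} (hT : 0 < T) :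
    UniqueDiffOn ℝ (Icc 0 T ×ˢ (univ : Set (Phase d))) :=
  (uniqueDiffOn_Icc hT).prod uniqueDiffOn_univ

lemma hasFDerivAt_slice {T : ℝ} {E : Type*} [NormedAddCommGroup E] [NormedSpace ℝ E]
    {A : ℝ × Phase d → E} {τ : ℝ} (hτ : τ ∈ Icc 0 T) {z : Phase d}
    (hA : DifferentiableWithinAt ℝ A (Icc 0 T ×ˢ univ) (τ, z)) :
    HasFDerivAt (fun z => A (τ, z)) ((fderivWithin ℝ A (Icc 0 T ×ˢ univ) (τ, z)).comp
      (ContinuousLinearMap.inr ℝ ℝ (Phase d))) z := by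
  rw [← hasFDerivWithinAt_univ]
  exact hA.hasFDerivWithinAt.comp (t := Icc 0 T ×ˢ univ) z
    (hasFDerivAt_prodMk_right τ z).hasFDerivWithinAt fun w _ => ⟨hτ, mem_univ w⟩

lemma hasDerivWithinAt_slice {T : ℝ} {E : Type*} [NormedAddCommGroup E] [NormedSpace ℝ E]
    {A : ℝ × Phase d → E} {τ : ℝ} {z : Phase d}
    (hA : DifferentiableWithinAt ℝ A (Icc 0 T ×ˢ univ) (τ, z)) :
    HasDerivWithinAt (fun τ => A (τ, z)) (fderivWithin ℝ A (Icc 0 T ×ˢ univ) (τ, z) (1, 0))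
      (Icc 0 T) τ :=
  hA.hasFDerivWithinAt.comp_hasDerivWithinAt (t := Icc 0 T ×ˢ univ) τ
    ((hasDerivWithinAt_id τ _).prodMk (hasDerivWithinAt_const τ _ z)) fun _ hσ => ⟨hσ, mem_univ z⟩

lemma gradient_apply {f : Phase d → ℝ} {f' : Phase d →L[ℝ] ℝ} {z : Phase d}
    (hf : HasFDerivAt f f' z) (i : Fin d ⊕ Fin d) :
    gradient f z i = f' (EuclideanSpace.single i 1) := by
  have h1 : ⟪gradient f z, EuclideanSpace.single i (1 : ℝ)⟫ = f' (EuclideanSpace.single i 1) := by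
    rw [gradient, hf.fderiv, InnerProductSpace.toDual_symm_apply]
  rw [← h1, real_inner_comm, EuclideanSpace.inner_single_left]
  simp only [map_one, one_mul]

lemma exists_radius {T : ℝ} {H : ℝ → Phase d → ℝ}
    (hK : HasCompactSupport (fun q : Icc (0 : ℝ) T × Phase d => H q.1 q.2)) :
    ∃ R, ∀ q ∈ Icc 0 T ×ˢ (univ : Set (Phase d)), R < ‖q.2‖ → H q.1 q.2 = 0 := by
  obtain ⟨R, hR⟩ := IsCompact.exists_bound_of_continuousOn hK
    (f := fun q : Icc (0 : ℝ) T × Phase d => q.2) continuous_snd.continuousOn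
  refine ⟨R, fun q hq hRq => ?_⟩
  have h1 : ((⟨q.1, hq.1⟩, q.2) : Icc (0 : ℝ) T × Phase d)
      ∉ tsupport fun q : Icc (0 : ℝ) T × Phase d => H q.1 q.2 := fun hmem =>
    absurd (hR _ hmem) (not_le.2 hRq)
  have h2 := image_eq_zero_of_notMem_tsupport h1
  exact h2

lemma IsC2c.exists_bound {T : ℝ} {H : ℝ → Phase d → ℝ} (hH : IsC2c T H) :
    ∃ B, ∀ τ ∈ Icc 0 T, ∀ z, |H τ z| ≤ B := by
  obtain ⟨R, hR⟩ := exists_radius hH.2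
  obtain ⟨B, hB⟩ := exists_bound_of_vanishing hH.1.continuousOn hR
  exact ⟨B, fun τ hτ z => hB (τ, z) ⟨hτ, mem_univ z⟩⟩

/-- Derivatives relative to the closed strip vanish outside a ball, so compactness bounds them. The
constants are left free above the sharp ones, to cover `c_H = 0` and to share them between two
Hamiltonians. -/
theorem IsC2c.exists_tame {T : ℝ} {H : ℝ → Phase d → ℝ} (hH : IsC2c T H) (hT : 0 < T) :
    ∃ M, ∀ c m M', hessBound T H ≤ c → 0 < c → normGradX T H ≤ m → m ≤ M' → M ≤ M' →
      Tame T H c m M' := by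
  have hS := uniqueDiffOn_strip (d := d) hT
  obtain ⟨hF, hK⟩ := hH
  set S : Set (ℝ × Phase d) := Icc 0 T ×ˢ univ with hSd
  set F : ℝ × Phase d → ℝ := fun q => H q.1 q.2 with hFd
  obtain ⟨R, hR⟩ := exists_radius hK
  set DF := fderivWithin ℝ F S with hDF
  have hDF1 : ContDiffOn ℝ 1 DF S := hF.fderivWithin hS (by norm_num)
  have hDF0 : ∀ q ∈ S, R < ‖q.2‖ → DF q = 0 := fderivWithin_eq_zero_of_vanishing hR
  set G : ℝ × Phase d → Phase d := fun q =>
    WithLp.toLp 2 fun i => DF q (0, EuclideanSpace.single i 1) with hG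
  have hG1 : ContDiffOn ℝ 1 G S := by
    rw [contDiffOn_euclidean]
    intro i
    exact hDF1.clm_apply contDiffOn_const
  have hG0 : ∀ q ∈ S, R < ‖q.2‖ → G q = 0 := by
    intro q hq hRq
    ext i
    simp [hG, hDF0 q hq hRq]
  have hd : ∀ τ ∈ Icc 0 T, ∀ z, HasFDerivAt (H τ)
      ((DF (τ, z)).comp (ContinuousLinearMap.inr ℝ ℝ (Phase d))) z := fun τ hτ z =>
    hasFDerivAt_slice hτ (hF.differentiableOn (by norm_num) _ ⟨hτ, mem_univ z⟩)
  have hgrad : ∀ τ ∈ Icc 0 T, ∀ z, gradient (H τ) z = G (τ, z) := by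
    intro τ hτ z
    ext i
    rw [gradient_apply (hd τ hτ z)]
    simp [hG]
  have hgrad' : ∀ τ ∈ Icc 0 T, gradient (H τ) = fun z => G (τ, z) := fun τ hτ =>
    funext (hgrad τ hτ)
  obtain ⟨B₁, hB₁⟩ := exists_bound_of_vanishing hDF1.continuousOn hDF0
  obtain ⟨B₂, hB₂⟩ := exists_bound_of_vanishing hG1.continuousOn hG0
  obtain ⟨B₃, hB₃⟩ := exists_bound_of_vanishing (hG1.continuousOn_fderivWithin hS le_rfl)
    (fderivWithin_eq_zero_of_vanishing hG0)
  have hGd : ∀ τ ∈ Icc 0 T, ∀ z, HasFDerivAt (gradient (H τ)) ((fderivWithin ℝ G S (τ, z)).comp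
      (ContinuousLinearMap.inr ℝ ℝ (Phase d))) z := fun τ hτ z => by
    rw [hgrad' τ hτ]
    exact hasFDerivAt_slice hτ (hG1.differentiableOn (by norm_num) _ ⟨hτ, mem_univ z⟩)
  have hhess : ∀ τ ∈ Icc 0 T, ∀ z, ‖fderiv ℝ (gradient (H τ)) z‖ ≤ hessBound T H := by
    intro τ hτ z
    refine le_supNorm (f := fun q : ℝ × Phase d => fderiv ℝ (gradient (H q.1)) q.2) (B := B₃)
      (fun q hq => ?_) (a := (τ, z)) ⟨hτ, mem_univ z⟩
    rw [(hGd q.1 hq.1 q.2).fderiv]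
    refine (ContinuousLinearMap.opNorm_comp_le _ _).trans ?_
    refine (mul_le_of_le_one_right (norm_nonneg _) ?_).trans (hB₃ q hq)
    exact ContinuousLinearMap.norm_inr_le_one ℝ ℝ (Phase d)
  have hgx : ∀ τ ∈ Icc 0 T, ∀ z, ‖gradX H τ z‖ ≤ normGradX T H := by
    intro τ hτ z
    refine le_supNorm (f := fun q : ℝ × Phase d => gradX H q.1 q.2) (B := B₂)
      (fun q hq => ?_) (a := (τ, z)) ⟨hτ, mem_univ z⟩
    rw [gradX, hgrad q.1 hq.1]
    exact (norm_xPart_le _).trans (hB₂ q hq)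
  refine ⟨max B₁ B₂, fun c m M' hc hc0 hm hmM hM => ?_⟩
  refine ⟨hc0, (supNorm_nonneg _ _).trans hm, hmM, fun τ hτ z => (hd τ hτ z).differentiableAt,
    fun τ hτ z z' => ?_, ?_, fun τ hτ z => (hgx τ hτ z).trans hm, fun τ hτ z => ?_,
    fun τ hτ τ' hτ' z => ?_⟩
  · exact convex_univ.norm_image_sub_le_of_norm_fderiv_le (𝕜 := ℝ)
      (fun z _ => (hGd τ hτ z).differentiableAt) (fun z _ => (hhess τ hτ z).trans hc)
      (mem_univ z') (mem_univ z)
  · exact hG1.continuousOn.congr fun q hq => hgrad q.1 hq.1 q.2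
  · rw [hgrad τ hτ]
    exact (hB₂ (τ, z) ⟨hτ, mem_univ z⟩).trans ((le_max_right _ _).trans hM)
  · have h1 := (convex_Icc 0 T).norm_image_sub_le_of_norm_hasDerivWithin_le
      (f := fun τ => F (τ, z)) (f' := fun τ => DF (τ, z) (1, 0)) (C := M')
      (fun σ hσ => hasDerivWithinAt_slice
        (hF.differentiableOn (by norm_num) _ ⟨hσ, mem_univ z⟩)) (fun σ hσ => ?_) hτ' hτ
    · exact h1
    · refine ((DF (σ, z)).le_opNorm _).trans ?_
      have : ‖((1 : ℝ), (0 : Phase d))‖ = 1 := by simp [Prod.norm_def]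
      rw [this, mul_one]
      exact (hB₁ (σ, z) ⟨hσ, mem_univ z⟩).trans ((le_max_left _ _).trans hM)

/-! ### The minmax value -/

namespace Tame

variable {T c m M : ℝ} {H : ℝ → Phase d → ℝ}

/-- Along the segment from `p` to `p'` the value changes by `O((b - a)²)`; the local estimate with
`B = 0` makes it constant. -/
lemma minmax_eq_of_length_eq (h : Tame T H c m M) {κ s t : ℝ} (hκ2 : κ < Real.log 2) (hs : 0 ≤ s)
    (ht : t ≤ T) {N : ℕ} {p p' : Fin (N + 2) → ℝ} (hp : IsFine c κ s t p)
    (hp' : IsFine c κ s t p') {v : Config d → ℝ} (hv : IsLip v) {x : Config d} {r r' : ℝ}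
    (hr : IsMinmax (quadForm d (N + 1)) (genFamily T H p v x) r)
    (hr' : IsMinmax (quadForm d (N + 1)) (genFamily T H p' v x) r') : r = r' := by
  obtain ⟨C, hC0, hC⟩ := h.exists_subdivision_estimate (d := d) hκ2 N
  have hpath := fun a (ha : a ∈ Icc (0 : ℝ) 1) => hp.convex hp' ha
  have hex : ∀ a ∈ Icc (0 : ℝ) 1, ∃ r, IsMinmax (quadForm d (N + 1))
      (genFamily T H (fun k => p k + a * (p' k - p k)) v x) r := fun a ha =>
    (h.isQuadLip_genFamily hκ2 hs ht (hpath a ha) hv x).exists_isMinmax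
  choose! g hg using hex
  have key := abs_sub_le_of_forall_local (g := g) (B := 0) (C := C * (t - s + 1) ^ 2) one_pos
    fun a ha b hb hab _ => ?_
  · have h0 := hg 0 (left_mem_Icc.2 zero_le_one)
    have h1 := hg 1 (right_mem_Icc.2 zero_le_one)
    simp only [zero_mul, add_zero] at h0
    simp only [one_mul, add_sub_cancel] at h1
    rw [isMinmax_unique hr h0, isMinmax_unique hr' h1]
    linarith [abs_nonpos_iff.1 key]
  · rcases hab.eq_or_lt with rfl | hab
    · simp
    have hst := hp.le
    -- The summand `1` keeps `β` positive even when `s = t`.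
    have hβ : 0 < (b - a) * (t - s + 1) := mul_pos (by linarith) (by linarith)
    have hd : ∀ k, |p' k - p k| ≤ t - s + 1 := fun k => by
      have h1 := hp.mem k
      have h2 := hp'.mem k
      rw [abs_le]
      constructor <;> linarith [h1.1, h1.2, h2.1, h2.2]
    have e : ∀ k, |p k + b * (p' k - p k) - (p k + a * (p' k - p k))| ≤ (b - a) * (t - s + 1) := by
      intro k
      rw [show p k + b * (p' k - p k) - (p k + a * (p' k - p k)) = (b - a) * (p' k - p k) by ring,
        abs_mul, abs_of_pos (by linarith : 0 < b - a)]
      exact mul_le_mul_of_nonneg_left (hd k) (by linarith)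
    have h1 := hC s t _ _ _ v x _ _ hβ hs ht (hpath a ha) (hpath b hb) e hv (hg a ha) (hg b hb)
    have h2 := hC s t _ _ _ v x _ _ hβ hs ht (hpath b hb) (hpath a ha)
      (fun k => by rw [abs_sub_comm]; exact e k) hv (hg b hb) (hg a ha)
    rw [abs_le]
    constructor <;> nlinarith

lemma isMinmax_cons (h : Tame T H c m M) {κ s t : ℝ} (hκ2 : κ < Real.log 2) (hs : 0 ≤ s)
    (ht : t ≤ T) {N : ℕ} {p : Fin (N + 2) → ℝ} (hp : IsFine c κ s t p)
    {v : Config d → ℝ} (hv : IsLip v) {x : Config d} {r : ℝ}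
    (hr : IsMinmax (quadForm d (N + 1)) (genFamily T H p v x) r) :
    IsMinmax (quadForm d (N + 2)) (genFamily T H (Fin.cons s p : Fin (N + 3) → ℝ) v x) r := by
  have h1 := isMinmax_famS_cons (h.isLip_genFun_step hκ2 hs ht hp) hv hr
  rw [genFamily_eq_famS]
  convert h1 using 2
  funext i
  refine Fin.cases ?_ (fun j => ?_) i
  · funext X y
    simp [hp.first, genFun]
  · rw [← Fin.succ_castSucc, Fin.cons_succ, Fin.cons_succ, Fin.cons_succ]

theorem minmax_eq (h : Tame T H c m M) {κ s t : ℝ} (hκ0 : 0 ≤ κ) (hκ2 : κ < Real.log 2)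
    (hs : 0 ≤ s) (ht : t ≤ T) {N N' : ℕ} {p : Fin (N + 2) → ℝ} {p' : Fin (N' + 2) → ℝ}
    (hp : IsFine c κ s t p) (hp' : IsFine c κ s t p') {v : Config d → ℝ} (hv : IsLip v)
    {x : Config d} {r r' : ℝ} (hr : IsMinmax (quadForm d (N + 1)) (genFamily T H p v x) r)
    (hr' : IsMinmax (quadForm d (N' + 1)) (genFamily T H p' v x) r') : r = r' := by
  have key : ∀ {N : ℕ} {p : Fin (N + 2) → ℝ} {r : ℝ}, IsFine c κ s t p →
      IsMinmax (quadForm d (N + 1)) (genFamily T H p v x) r → ∀ n, N ≤ n →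
      ∃ q : Fin (n + 2) → ℝ, IsFine c κ s t q ∧
        IsMinmax (quadForm d (n + 1)) (genFamily T H q v x) r := by
    intro N p r hp hr n hn
    induction n, hn using Nat.le_induction with
    | base => exact ⟨p, hp, hr⟩
    | succ n _ ih =>
      obtain ⟨q, hq, hqr⟩ := ih
      exact ⟨Fin.cons s q, hq.cons hκ0, h.isMinmax_cons hκ2 hs ht hq hv hqr⟩
  obtain ⟨q, hq, hqr⟩ := key hp hr _ (le_max_left N N')
  obtain ⟨q', hq', hqr'⟩ := key hp' hr' _ (le_max_right N N')
  exact h.minmax_eq_of_length_eq hκ2 hs ht hq hq' hv hqr hqr'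

end Tame

/-- The uniform subdivision. -/
def uniformSub (s t : ℝ) (N : ℕ) (k : Fin (N + 2)) : ℝ := s + (k : ℕ) / (N + 1) * (t - s)

lemma uniformSub_step (s t : ℝ) (N : ℕ) (i : Fin (N + 1)) :
    uniformSub s t N i.succ - uniformSub s t N i.castSucc = (t - s) / (N + 1) := by
  simp only [uniformSub, Fin.val_succ, Fin.val_castSucc]
  push_cast
  ring

lemma uniformSub_strictMono {s t : ℝ} (hst : s < t) (N : ℕ) : StrictMono (uniformSub s t N) := by
  rw [Fin.strictMono_iff_lt_succ]
  intro i
  rw [← sub_pos, uniformSub_step]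
  have : 0 < t - s := by linarith
  positivity

lemma uniformSub_zero (s t : ℝ) (N : ℕ) : uniformSub s t N 0 = s := by simp [uniformSub]

lemma uniformSub_last (s t : ℝ) (N : ℕ) : uniformSub s t N (Fin.last (N + 1)) = t := by
  have : (N : ℝ) + 1 ≠ 0 := by positivity
  simp [uniformSub, this]

lemma isFine_uniformSub {c κ s t : ℝ} (hst : s < t) {N : ℕ} (hN : c * ((t - s) / (N + 1)) ≤ κ) :
    IsFine c κ s t (uniformSub s t N) :=
  ⟨(uniformSub_strictMono hst N).monotone, uniformSub_zero s t N, uniformSub_last s t N,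
    fun i => by rw [uniformSub_step]; exact hN⟩

lemma exists_uniform {c κ T : ℝ} (hc : 0 < c) (hκ : 0 < κ) :
    ∃ N : ℕ, ∀ s t, 0 ≤ s → t ≤ T → c * ((t - s) / (N + 1)) ≤ κ := by
  obtain ⟨N, hN⟩ := exists_nat_ge (c * T / κ)
  refine ⟨N, fun s t hs ht => ?_⟩
  have h0 : (0 : ℝ) < N + 1 := by positivity
  rw [div_le_iff₀ hκ] at hN
  rw [← mul_div_assoc, div_le_iff₀ h0]
  have := mul_le_mul_of_nonneg_left (by linarith : t - s ≤ T) hc.le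
  nlinarith

/-- Finitely many strict inequalities leave room to enlarge `b` and to lower `ℓ`. This passes from
the condition `c_H δ < log 2` to a positive `c` and a uniform `κ < log 2`. -/
lemma exists_const_of_forall_lt {b ℓ : ℝ} {ι : Type*} [Fintype ι] (δ : ι → ℝ)
    (hδ : ∀ i, b * δ i < ℓ) (b₀ : ℝ) (hb₀ : b₀ < ℓ) :
    ∃ c, b < c ∧ ∃ κ, b₀ < κ ∧ κ < ℓ ∧ ∀ i, c * δ i ≤ κ := by
  have h1 : ∀ᶠ c in 𝓝[>] b, ∀ i, c * δ i < ℓ := by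
    rw [eventually_all]
    intro i
    have : Tendsto (fun c => c * δ i) (𝓝[>] b) (𝓝 (b * δ i)) :=
      ((continuous_id.mul continuous_const).tendsto b).mono_left nhdsWithin_le_nhds
    exact this.eventually_lt_const (hδ i)
  obtain ⟨c, hc, hbc⟩ := (h1.and self_mem_nhdsWithin).exists
  have h2 : ∀ᶠ κ in 𝓝[<] ℓ, ∀ i, c * δ i ≤ κ := by
    rw [eventually_all]
    intro i
    filter_upwards [Ioo_mem_nhdsLT (hc i)] with κ hκ using hκ.1.le
  obtain ⟨κ, ⟨h3, h4⟩, h5⟩ := ((h2.and (Ioo_mem_nhdsLT hb₀)).and self_mem_nhdsWithin).exists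
  exact ⟨c, hbc, κ, h4.1, h5, h3⟩

theorem isMinmaxValue_minmaxOp {T : ℝ} {H : ℝ → Phase d → ℝ} (hH : IsC2c T H) {v : Config d → ℝ}
    (hv : IsLip v) {s t : ℝ} (hs : 0 ≤ s) (hst : s < t) (ht : t ≤ T) (x : Config d) :
    IsMinmaxValue T H s t v x (minmaxOp T H s t v x) := by
  have hT : 0 < T := hs.trans_lt (hst.trans_le ht)
  have hlog : 0 < Real.log 2 := Real.log_pos one_lt_two
  have hh0 : 0 ≤ hessBound T H := supNorm_nonneg _ _
  obtain ⟨M, hM⟩ := hH.exists_tame hT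
  obtain ⟨N, hN⟩ := exists_uniform (T := T) (c := hessBound T H + 1) (κ := Real.log 2 / 2)
    (by linarith) (by linarith)
  have hN' := hN s t hs ht
  have hfine := isFine_uniformSub hst hN'
  have htame : ∀ c, hessBound T H < c →
      Tame T H c (normGradX T H) (max M (normGradX T H)) := fun c hc =>
    hM c _ _ hc.le (hh0.trans_lt hc) le_rfl (le_max_right _ _) (le_max_left _ _)
  obtain ⟨r, hr⟩ := ((htame _ (lt_add_one _)).isQuadLip_genFamily (by linarith) hs ht hfine hv
    x).exists_isMinmax
  refine Classical.epsilon_spec (p := IsMinmaxValue T H s t v x) ⟨r, fun N' p hp => ?_⟩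
  obtain - | n := N'
  · exact absurd (hp.first.symm.trans hp.last) hst.ne
  · have hpos : 0 ≤ (t - s) / ((N : ℝ) + 1) := by
      have : 0 < t - s := by linarith
      positivity
    -- The index `none` stands for the step of the uniform reference subdivision, so that one pair
    -- `c, κ` serves both subdivisions.
    obtain ⟨c, hc, κ, hκ0, hκ, hcκ⟩ := exists_const_of_forall_lt (ι := Option (Fin (n + 1)))
      (fun o => o.elim ((t - s) / ((N : ℝ) + 1)) fun i => p i.succ - p i.castSucc) (b := hessBound T H)
      (ℓ := Real.log 2) (fun o => by
        cases o with
        | none => simp only [Option.elim]; nlinarith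
        | some i => exact hp.step i) 0 hlog
    have hfine' : IsFine c κ s t p :=
      ⟨hp.strictMono.monotone, hp.first, hp.last, fun i => hcκ (some i)⟩
    obtain ⟨r', hr'⟩ := ((htame c hc).isQuadLip_genFamily hκ hs ht hfine' hv x).exists_isMinmax
    rwa [(htame c hc).minmax_eq hκ0.le hκ hs ht (isFine_uniformSub hst (hcκ none)) hfine' hv hr hr']

/-- The minmax operator is computed by all fine subdivisions. -/
theorem isMinmax_minmaxOp {T c m M κ : ℝ} {H : ℝ → Phase d → ℝ} (hH : IsC2c T H)
    (h : Tame T H c m M) (hc : hessBound T H ≤ c) (hκ0 : 0 < κ) (hκ2 : κ < Real.log 2)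
    {v : Config d → ℝ} (hv : IsLip v) {s t : ℝ} (hs : 0 ≤ s) (hst : s < t) (ht : t ≤ T)
    (x : Config d) {N : ℕ} {p : Fin (N + 2) → ℝ} (hp : IsFine c κ s t p) :
    IsMinmax (quadForm d (N + 1)) (genFamily T H p v x) (minmaxOp T H s t v x) := by
  obtain ⟨n, hn⟩ := exists_uniform (T := T) h.c_pos hκ0
  have hfine := isFine_uniformSub hst (hn s t hs ht)
  have hadm : IsAdmissible T H s t (uniformSub s t n) := by
    refine ⟨uniformSub_strictMono hst n, hfine.first, hfine.last, fun i => ?_⟩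
    refine lt_of_le_of_lt ?_ ((hfine.step i).trans_lt hκ2)
    exact mul_le_mul_of_nonneg_right hc (sub_nonneg.2 (hfine.le_succ i))
  have h1 := isMinmaxValue_minmaxOp hH hv hs hst ht x _ _ hadm
  obtain ⟨r, hr⟩ := (h.isQuadLip_genFamily hκ2 hs ht hp hv x).exists_isMinmax
  rwa [h.minmax_eq hκ0.le hκ2 hs ht hfine hp hv h1 hr]

end

end HamiltonJacobi

/-! ### The four estimates, on fine subdivisions. -/

namespace HamiltonJacobi

noncomputable section

variable {d : ℕ}

lemma sum_steps {N : ℕ} (p : Fin (N + 1) → ℝ) :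
    ∑ i : Fin N, (p i.succ - p i.castSucc) = p (Fin.last N) - p 0 := by
  have h1 := Fin.sum_univ_succ p
  rw [Fin.sum_univ_castSucc] at h1
  rw [Finset.sum_sub_distrib]
  linarith

/-- A bound on a ball extends to a slightly larger ball. -/
lemma abs_le_add_of_norm_le {f : Config d → ℝ} {A M R ε : ℝ} (hR : 0 ≤ R)
    (hf : ∀ y y', |f y - f y'| ≤ M * ‖y - y'‖) (hM : 0 ≤ M) (hA : ∀ y, ‖y‖ ≤ R → |f y| ≤ A)
    (hε : 0 ≤ ε) {y : Config d} (hy : ‖y‖ ≤ R + ε) : |f y| ≤ A + M * ε := by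
  rcases le_or_gt ‖y‖ R with h | h
  · have := hA y h
    have := mul_nonneg hM hε
    linarith
  · have hy0 : 0 < ‖y‖ := hR.trans_lt h
    have e : y - (R / ‖y‖) • y = (1 - R / ‖y‖) • y := by rw [sub_smul, one_smul]
    have h1 : ‖(R / ‖y‖) • y‖ ≤ R := by
      rw [norm_smul, Real.norm_of_nonneg (by positivity), div_mul_cancel₀ _ hy0.ne']
    have h2 : ‖y - (R / ‖y‖) • y‖ ≤ ε := by
      have h0 : 0 ≤ 1 - R / ‖y‖ := by
        rw [sub_nonneg, div_le_one hy0]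
        exact h.le
      rw [e, norm_smul, Real.norm_of_nonneg h0, sub_mul, div_mul_cancel₀ _ hy0.ne']
      linarith
    have h3 := hf y ((R / ‖y‖) • y)
    have h4 := hA _ h1
    have h5 := mul_le_mul_of_nonneg_left h2 hM
    have h6 := abs_sub_abs_le_abs_sub (f y) (f ((R / ‖y‖) • y))
    linarith

namespace Tame

variable {T c m M κ s t : ℝ} {H : ℝ → Phase d → ℝ}

lemma genFun_step_left (h : Tame T H c m M) (hκ2 : κ < Real.log 2) (hs : 0 ≤ s)
    (ht : t ≤ T) {N : ℕ} {p : Fin (N + 1) → ℝ} (hp : IsFine c κ s t p) (i : Fin N)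
    (X X' y : Config d) : genFun T H (p i.castSucc) (p i.succ) X y
      - genFun T H (p i.castSucc) (p i.succ) X' y ≤ m * (p i.succ - p i.castSucc) * ‖X - X'‖ :=
  (le_abs_self _).trans (h.abs_genFun_sub_le_left (hp.nonneg hs _) (hp.le_succ i)
    (hp.le_of_le ht _) (hp.step i) hκ2 X' X y)

lemma genFun_step_right (h : Tame T H c m M) (hκ2 : κ < Real.log 2) (hs : 0 ≤ s)
    (ht : t ≤ T) {N : ℕ} {p : Fin (N + 1) → ℝ} (hp : IsFine c κ s t p) (i : Fin N)
    (X y y' : Config d) : genFun T H (p i.castSucc) (p i.succ) X y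
      - genFun T H (p i.castSucc) (p i.succ) X y' ≤ M * (p i.succ - p i.castSucc) * ‖y - y'‖ :=
  (le_abs_self _).trans (h.abs_genFun_sub_le_right (hp.nonneg hs _) (hp.le_succ i)
    (hp.le_of_le ht _) (hp.step i) hκ2 X y' y)

lemma step_nonneg (h : Tame T H c m M) {N : ℕ} {p : Fin (N + 1) → ℝ} (hp : IsFine c κ s t p)
    (i : Fin N) : 0 ≤ m * (p i.succ - p i.castSucc) :=
  mul_nonneg h.m_nonneg (sub_nonneg.2 (hp.le_succ i))

/-- The sum over `i < j` is the excess over `‖∂v‖` allowed for `y_j`; the last term is what the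
momentum may gain during step `j`. Together they stay within the total `m (t - s)`. -/
lemma momentum_le (h : Tame T H c m M) {N : ℕ} {p : Fin (N + 1) → ℝ} (hp : IsFine c κ s t p)
    (j : Fin N) : (∑ i, if i < j then m * (p i.succ - p i.castSucc) else 0)
      + m * (p j.succ - p j.castSucc) ≤ m * (t - s) := by
  have e : m * (t - s) = ∑ i : Fin N, m * (p i.succ - p i.castSucc) := by
    rw [← Finset.mul_sum, sum_steps, hp.first, hp.last]
  rw [e, ← Finset.sum_filter, ← Finset.sum_singleton (fun i => m * (p i.succ - p i.castSucc)) j,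
    ← Finset.sum_union (by simp)]
  exact Finset.sum_le_sum_of_subset_of_nonneg (Finset.subset_univ _) fun i _ _ =>
    h.step_nonneg hp i

/-- Comparison of the minmax values of a generating family on bounded momenta. -/
lemma genFamily_le_add (h : Tame T H c m M) (hκ2 : κ < Real.log 2) (hs : 0 ≤ s) (ht : t ≤ T)
    {N : ℕ} {p : Fin (N + 1) → ℝ} (hp : IsFine c κ s t p) {v : Config d → ℝ} (hv : IsLip v)
    {x : Config d} {f : Fibre d N → ℝ} (hf : IsQuadLip f) {r r' δ ε : ℝ} (hε : 0 < ε) (hδ : 0 ≤ δ)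
    (hr : IsMinmax (quadForm d N) (genFamily T H p v x) r) (hr' : IsMinmax (quadForm d N) f r')
    (hle : ∀ η, (∀ j, ‖yPart (η j)‖ + m * (p j.succ - p j.castSucc)
      ≤ lipConst v + m * (t - s) + ε) → genFamily T H p v x η ≤ f η + δ) : r ≤ r' + δ :=
  isMinmax_le_add_of_momenta (NNReal.coe_nonneg _) (h.step_nonneg hp) hv.sub_le
    (h.genFun_step_left hκ2 hs ht hp) (h.isLip_genFun_step hκ2 hs ht hp) hv hf hε hδ hr hr'
    fun η hη => hle η fun j => by
      have h1 := hη j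
      have h2 := h.momentum_le hp j
      linarith

/-! ### Lipschitz bounds -/

lemma minmax_le_base (h : Tame T H c m M) (hκ2 : κ < Real.log 2) (hs : 0 ≤ s) (ht : t ≤ T)
    {N : ℕ} {p : Fin (N + 1) → ℝ} (hp : IsFine c κ s t p) {v : Config d → ℝ} (hv : IsLip v)
    {x x' : Config d} {r r' : ℝ} (hr : IsMinmax (quadForm d N) (genFamily T H p v x) r)
    (hr' : IsMinmax (quadForm d N) (genFamily T H p v x') r') :
    r ≤ r' + (lipConst v + m * (t - s)) * ‖x - x'‖ := by
  have h1 := isMinmax_famS_le_base hv.sub_le (h.genFun_step_left hκ2 hs ht hp)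
    (h.isLip_genFun_step hκ2 hs ht hp) hv hr hr'
  rwa [← Finset.mul_sum, sum_steps, hp.first, hp.last] at h1

/-! ### Dependence on the final time -/

lemma exists_minmaxOp_time_estimate (h : Tame T H c m M) (hH : IsC2c T H) (hc : hessBound T H ≤ c)
    {v : Config d → ℝ} (hv : IsLip v) (x : Config d) (hs : 0 ≤ s) :
    ∃ C ρ, 0 < ρ ∧ ∀ u u', s < u → u ≤ u' → u' ≤ T → u' - u ≤ ρ → ∀ A R : ℝ, 0 ≤ A →
      lipConst v + m * (u' - s) ≤ R → (∀ y, ‖y‖ ≤ R → |H u (pt x y)| ≤ A) →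
      |minmaxOp T H s u' v x - minmaxOp T H s u v x| ≤ A * (u' - u) + C * (u' - u) ^ 2 := by
  have hlog : 0 < Real.log 2 := Real.log_pos one_lt_two
  set κ : ℝ := Real.log 2 / 2 with hκ
  have hκ0 : 0 < κ := by positivity
  have hκ2 : κ < Real.log 2 := by linarith
  have hM := h.M_nonneg
  obtain ⟨C, hC0, hC⟩ := h.exists_genFun_expansion hκ2
  -- Half of `κ` is kept in reserve, so that lengthening the last step by at most `κ / (2c)` keeps
  -- the subdivision fine.
  obtain ⟨N, hN⟩ := exists_uniform (T := T) h.c_pos (half_pos hκ0)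
  refine ⟨C + M, κ / 2 / c, div_pos (half_pos hκ0) h.c_pos, ?_⟩
  intro u u' hsu huu hu hρ A R hA hR hAR
  rcases huu.eq_or_lt with rfl | huu'
  · simp
  rw [le_div_iff₀ h.c_pos] at hρ
  have hNu := hN s u hs (huu.trans hu)
  have huT : u ∈ Icc 0 T := ⟨hs.trans hsu.le, huu.trans hu⟩
  set p := uniformSub s u N with hpd
  set p' : Fin (N + 2) → ℝ := Fin.snoc (α := fun _ => ℝ) (fun i : Fin (N + 1) => p i.castSucc) u'
    with hpd'
  have hp : IsFine c κ s u p := isFine_uniformSub hsu (by linarith)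
  have e1 : ∀ i : Fin (N + 1), p' i.castSucc = p i.castSucc := fun i => by simp [hpd']
  have e2 : p' (Fin.last (N + 1)) = u' := by simp [hpd']
  have e3 : ∀ i : Fin N, p' i.castSucc.succ = p i.castSucc.succ := fun i => e1 i.succ
  have hp' : IsFine c κ s u' p' := by
    refine ⟨?_, (e1 0).trans hp.first, e2, fun i => ?_⟩
    · rw [Fin.monotone_iff_le_succ]
      intro i
      refine Fin.lastCases ?_ (fun j => ?_) i
      · rw [e1, Fin.succ_last, e2]
        exact (hp.mem _).2.trans huu
      · rw [e1, e3]
        exact hp.le_succ _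
    · refine Fin.lastCases ?_ (fun j => ?_) i
      · have h1 := uniformSub_step s u N (Fin.last N)
        rw [← hpd, Fin.succ_last, hp.last] at h1
        rw [e1, Fin.succ_last, e2]
        rw [← h1] at hNu
        have : c * (u' - p (Fin.last N).castSucc)
          = c * (u - p (Fin.last N).castSucc) + (u' - u) * c := by ring
        linarith
      · rw [e1, e3]
        exact hp.step _
  have hm := isMinmax_minmaxOp hH h hc hκ0 hκ2 hv hs hsu (huu.trans hu) x hp
  have hm' := isMinmax_minmaxOp hH h hc hκ0 hκ2 hv hs (hsu.trans huu') hu x hp'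
  have hδ : 0 ≤ A * (u' - u) + (C + M) * (u' - u) ^ 2 := by
    have : 0 ≤ u' - u := by linarith
    positivity
  set q := p (Fin.last N).castSucc with hq
  have hqs : s ≤ q := (hp.mem _).1
  have hqu : q ≤ u := (hp.mem _).2
  have hdiff : ∀ η : Fibre d (N + 1), genFamily T H p' v x η - genFamily T H p v x η
      = genFun T H q u' x (yPart (η (Fin.last N))) - genFun T H q u x (yPart (η (Fin.last N))) := by
    intro η
    simp only [genFamily, Fin.sum_univ_castSucc (n := N), e1, e3, Fin.succ_last, e2, hp.last,
      node_last, hq]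
    ring
  -- The derivative of the last generating function in its final time is `-H` at the endpoint, whose
  -- position is `x` and whose momentum is at most `R + (u' - u)`. Enlarging the ball from `R` costs
  -- `M (u' - u)`, a second order contribution.
  have hbound : ∀ y : Config d, ‖y‖ + m * (u - q) ≤ R + (u' - u) →
      |genFun T H q u' x y - genFun T H q u x y| ≤ A * (u' - u) + (C + M) * (u' - u) ^ 2 := by
    intro y hy
    have hstep : c * (u - q) ≤ κ := by
      have := hp.step (Fin.last N)
      rwa [Fin.succ_last, hp.last] at this
    have hstep' : c * (u' - q) ≤ κ := by
      have := hp'.step (Fin.last N)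
      rwa [Fin.succ_last, e2, e1] at this
    have h1 := hC q u q u' (hs.trans hqs) hqu (huu.trans hu) hstep (hs.trans hqs) (hqu.trans huu)
      hu hstep' x y x y
    simp only [sub_self, inner_zero_left, inner_zero_right, mul_zero, norm_zero, abs_zero, zero_add,
      add_zero, zero_sub, sub_neg_eq_add] at h1
    rw [abs_of_pos (by linarith : 0 < u' - u)] at h1
    have hspec := h.genCurve_spec (hs.trans hqs) hqu (huu.trans hu) hstep hκ2 x y
    have hY := h.norm_yPart_genCurve_sub_le (hs.trans hqs) hqu (huu.trans hu) hstep hκ2 x y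
      (right_mem_Icc.2 hqu)
    set z := genCurve T H q u x y u with hz
    have hzx : z = pt x (yPart z) := phase_ext (by rw [hspec.2.2, xPart_pt]) rfl
    have hyz : ‖yPart z‖ ≤ R + (u' - u) := by
      have := norm_sub_norm_le (yPart z) y
      linarith
    have h2 : |H u z| ≤ A + M * (u' - u) := by
      rw [hzx]
      refine abs_le_add_of_norm_le (f := fun y => H u (pt x y)) (R := R)
        (le_trans (add_nonneg (lipConst v).coe_nonneg (mul_nonneg h.m_nonneg (by linarith))) hR)
        (fun y y' => ?_) hM hAR (by linarith) hyz
      refine (h.abs_sub_le huT _ _).trans (mul_le_mul_of_nonneg_left ?_ hM)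
      refine (norm_le_add _).trans (le_of_eq ?_)
      simp
    have h3 : |H u z * (u' - u)| ≤ (A + M * (u' - u)) * (u' - u) := by
      rw [abs_mul, abs_of_pos (by linarith : 0 < u' - u)]
      exact mul_le_mul_of_nonneg_right h2 (by linarith)
    rw [abs_le] at h1 h3 ⊢
    constructor <;> linarith [h1.1, h1.2, h3.1, h3.2]
  have hε : 0 < u' - u := by linarith
  have k1 : minmaxOp T H s u' v x
      ≤ minmaxOp T H s u v x + (A * (u' - u) + (C + M) * (u' - u) ^ 2) := by
    refine h.genFamily_le_add hκ2 hs hu hp' hv (h.isQuadLip_genFamily hκ2 hs (huu.trans hu) hp hv x)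
      hε hδ hm' hm fun η hη => ?_
    have h1 := hη (Fin.last N)
    rw [e1, Fin.succ_last, e2] at h1
    have h2 : m * (u - q) ≤ m * (u' - q) := mul_le_mul_of_nonneg_left (by linarith) h.m_nonneg
    have h3 := (abs_le.1 (hbound (yPart (η (Fin.last N))) (by linarith))).2
    linarith [hdiff η]
  have k2 : minmaxOp T H s u v x
      ≤ minmaxOp T H s u' v x + (A * (u' - u) + (C + M) * (u' - u) ^ 2) := by
    refine h.genFamily_le_add hκ2 hs (huu.trans hu) hp hv (h.isQuadLip_genFamily hκ2 hs hu hp' hv x)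
      hε hδ hm hm' fun η hη => ?_
    have h1 := hη (Fin.last N)
    rw [Fin.succ_last, hp.last] at h1
    have h2 : m * (u - s) ≤ m * (u' - s) := mul_le_mul_of_nonneg_left (by linarith) h.m_nonneg
    have h3 := (abs_le.1 (hbound (yPart (η (Fin.last N))) (by linarith))).1
    linarith [hdiff η]
  rw [abs_le]
  constructor <;> linarith

/-! ### Dependence on the Hamiltonian -/

lemma gradient_mix {H' : ℝ → Phase d → ℝ} (h : Tame T H c m M) (h' : Tame T H' c m M) (r : ℝ)
    {τ : ℝ} (hτ : τ ∈ Icc 0 T) (z : Phase d) :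
    HasGradientAt (fun z => H τ z + r * (H' τ z - H τ z))
      (gradient (H τ) z + r • (gradient (H' τ) z - gradient (H τ) z)) z := by
  have h1 := (h.hasGradientAt hτ z).add
    (((h'.hasGradientAt hτ z).sub (h.hasGradientAt hτ z)).const_mul r)
  rw [← map_sub, ← map_smul, ← map_add] at h1
  exact h1

lemma norm_mix_le {E : Type*} [NormedAddCommGroup E] [NormedSpace ℝ E] {a b : E} {r B : ℝ}
    (hr : r ∈ Icc (0 : ℝ) 1) (ha : ‖a‖ ≤ B) (hb : ‖b‖ ≤ B) : ‖a + r • (b - a)‖ ≤ B := by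
  have e : a + r • (b - a) = (1 - r) • a + r • b := by
    rw [smul_sub, sub_smul, one_smul]
    abel
  have h0 : 0 ≤ 1 - r := by linarith [hr.2]
  have h1 := norm_add_le ((1 - r) • a) (r • b)
  rw [norm_smul, norm_smul, Real.norm_of_nonneg h0, Real.norm_of_nonneg hr.1] at h1
  rw [e]
  have h2 := mul_le_mul_of_nonneg_left ha h0
  have h3 := mul_le_mul_of_nonneg_left hb hr.1
  linarith

/-- Every bound in `Tame` is convex in the Hamiltonian, so the whole segment shares the same
constants. -/
lemma mix {H' : ℝ → Phase d → ℝ} (h : Tame T H c m M) (h' : Tame T H' c m M) {r : ℝ}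
    (hr : r ∈ Icc (0 : ℝ) 1) : Tame T (fun τ z => H τ z + r * (H' τ z - H τ z)) c m M := by
  have hg := fun τ (hτ : τ ∈ Icc 0 T) z => (h.gradient_mix h' r hτ z).gradient
  refine ⟨h.c_pos, h.m_nonneg, h.m_le, fun τ hτ z => (h.gradient_mix h' r hτ z).differentiableAt,
    fun τ hτ z z' => ?_, ?_, fun τ hτ z => ?_, fun τ hτ z => ?_, fun τ hτ τ' hτ' z => ?_⟩
  · rw [hg τ hτ, hg τ hτ]
    have e : gradient (H τ) z + r • (gradient (H' τ) z - gradient (H τ) z)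
        - (gradient (H τ) z' + r • (gradient (H' τ) z' - gradient (H τ) z'))
        = (gradient (H τ) z - gradient (H τ) z') + r • ((gradient (H' τ) z - gradient (H' τ) z')
          - (gradient (H τ) z - gradient (H τ) z')) := by
      simp only [smul_sub]
      abel
    rw [e]
    exact norm_mix_le hr (h.lip τ hτ z z') (h'.lip τ hτ z z')
  · have h1 : ContinuousOn (fun q : ℝ × Phase d => gradient (H q.1) q.2
        + r • (gradient (H' q.1) q.2 - gradient (H q.1) q.2)) (Icc 0 T ×ˢ univ) :=
      h.cont.add ((h'.cont.sub h.cont).const_smul r)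
    exact h1.congr fun q hq => hg q.1 hq.1 q.2
  · rw [gradX, hg τ hτ, map_add, map_smul, map_sub]
    exact norm_mix_le hr (h.boundX τ hτ z) (h'.boundX τ hτ z)
  · rw [hg τ hτ]
    exact norm_mix_le hr (h.bound τ hτ z) (h'.bound τ hτ z)
  · have h1 := norm_mix_le (a := H τ z - H τ' z) (b := H' τ z - H' τ' z) hr
      (h.time τ hτ τ' hτ' z) (h'.time τ hτ τ' hτ' z)
    rw [smul_eq_mul] at h1
    refine le_trans (le_of_eq ?_) h1
    rw [Real.norm_eq_abs]
    congr 1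
    ring

/-- Along the segment from `H` to `H'`, each generating function changes by at most `|a - b| A` per
unit of time up to second order, on the momenta that matter; summing along the path gives `(t - s)
A`. -/
lemma minmax_sub_le_of_hamiltonian {H' : ℝ → Phase d → ℝ} (h : Tame T H c m M)
    (h' : Tame T H' c m M) (hκ2 : κ < Real.log 2) (hs : 0 ≤ s) (ht : t ≤ T)
    {N : ℕ} {p : Fin (N + 1) → ℝ} (hp : IsFine c κ s t p) {v : Config d → ℝ} (hv : IsLip v)
    {x : Config d} {r r' A : ℝ} (hA : 0 ≤ A)
    (hHA : ∀ τ ∈ Icc s t, ∀ x y, ‖y‖ ≤ lipConst v + m * (t - s) →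
      |H τ (pt x y) - H' τ (pt x y)| ≤ A)
    (hr : IsMinmax (quadForm d N) (genFamily T H p v x) r)
    (hr' : IsMinmax (quadForm d N) (genFamily T H' p v x) r') : |r - r'| ≤ (t - s) * A := by
  have hM := h.M_nonneg
  have hst : 0 ≤ t - s := sub_nonneg.2 hp.le
  set K := driftConst c M κ * (c * driftConst c M κ + 1) + c * driftConst c M κ ^ 2 with hK
  have hK0 : 0 ≤ K := by
    have := h.driftConst_nonneg hκ2
    have := h.c_pos
    positivity
  set Hm : ℝ → ℝ → Phase d → ℝ := fun a τ z => H τ z + a * (H' τ z - H τ z) with hHm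
  have htm : ∀ a ∈ Icc (0 : ℝ) 1, Tame T (Hm a) c m M := fun a ha => h.mix h' ha
  have hex : ∀ a ∈ Icc (0 : ℝ) 1, ∃ r, IsMinmax (quadForm d N) (genFamily T (Hm a) p v x) r :=
    fun a ha => ((htm a ha).isQuadLip_genFamily hκ2 hs ht hp hv x).exists_isMinmax
  choose! g hg using hex
  -- The same `e` bounds `|a - b|` and serves as the slack in the momenta, so the cost of enlarging
  -- the ball is of second order.
  have one_side : ∀ a ∈ Icc (0 : ℝ) 1, ∀ b ∈ Icc (0 : ℝ) 1, ∀ e, 0 < e → |a - b| ≤ e →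
      g a ≤ g b + (e * (A + 2 * M * e) + K * (2 * M * e) ^ 2) * (t - s) := by
    intro a ha b hb e he hab
    refine (htm a ha).genFamily_le_add hκ2 hs ht hp hv
      ((htm b hb).isQuadLip_genFamily hκ2 hs ht hp hv x) he (by positivity) (hg a ha) (hg b hb)
      fun η hη => ?_
    have hstep : ∀ i : Fin N, genFun T (Hm a) (p i.castSucc) (p i.succ) (node x η i.succ)
        (yPart (η i)) ≤ genFun T (Hm b) (p i.castSucc) (p i.succ) (node x η i.succ) (yPart (η i))
          + (e * (A + 2 * M * e) + K * (2 * M * e) ^ 2) * (p i.succ - p i.castSucc) := by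
      intro i
      have h1 := (htm b hb).abs_genFun_sub_le_of_hamiltonian (htm a ha) (hp.nonneg hs _)
        (hp.le_succ i) (hp.le_of_le ht _) (hp.step i) hκ2 (ε := 2 * M * e) (by positivity)
        (B := e * (A + 2 * M * e)) (fun τ hτ z => ?_) (X := node x η i.succ) (y := yPart (η i))
        fun τ hτ => ?_
      · linarith [(abs_le.1 h1).2]
      · have h2 : gradient (Hm a τ) z - gradient (Hm b τ) z
            = (a - b) • (gradient (H' τ) z - gradient (H τ) z) := by
          rw [(h.gradient_mix h' a hτ z).gradient, (h.gradient_mix h' b hτ z).gradient, sub_smul]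
          abel
        have h3 := (norm_sub_le (gradient (H' τ) z) (gradient (H τ) z)).trans
          (add_le_add (h'.bound τ hτ z) (h.bound τ hτ z))
        rw [h2, norm_smul, Real.norm_eq_abs]
        refine (mul_le_mul hab h3 (norm_nonneg _) he.le).trans (le_of_eq (by ring))
      · have hY := (htm a ha).norm_yPart_genCurve_sub_le (hp.nonneg hs _) (hp.le_succ i)
          (hp.le_of_le ht _) (hp.step i) hκ2 (node x η i.succ) (yPart (η i)) hτ
        set z := genCurve T (Hm a) (p i.castSucc) (p i.succ) (node x η i.succ) (yPart (η i)) τ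
        have hτst : τ ∈ Icc s t := ⟨(hp.mem _).1.trans hτ.1, hτ.2.trans (hp.mem _).2⟩
        have hτT : τ ∈ Icc 0 T := ⟨hs.trans hτst.1, hτst.2.trans ht⟩
        have e1 : Hm a τ z - Hm b τ z = -((a - b) * (H τ z - H' τ z)) := by
          simp only [hHm]
          ring
        have hyz : ‖yPart z‖ ≤ lipConst v + m * (t - s) + e := by
          have h4 := norm_sub_norm_le (yPart z) (yPart (η i))
          have h5 := hη i
          linarith
        have h2 : |H τ z - H' τ z| ≤ A + 2 * M * e := by
          rw [← pt_parts z]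
          refine abs_le_add_of_norm_le
            (f := fun y => H τ (pt (xPart z) y) - H' τ (pt (xPart z) y))
            (add_nonneg (lipConst v).coe_nonneg (mul_nonneg h.m_nonneg hst))
            (fun y y' => ?_) (by positivity) (hHA τ hτst _) he.le hyz
          have h6 := h.abs_sub_le hτT (pt (xPart z) y') (pt (xPart z) y)
          have h7 := h'.abs_sub_le hτT (pt (xPart z) y') (pt (xPart z) y)
          have h8 : ‖pt (xPart z) y - pt (xPart z) y'‖ ≤ ‖y - y'‖ := by
            refine (norm_le_add _).trans (le_of_eq ?_)
            simp
          have h9 := mul_le_mul_of_nonneg_left h8 hM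
          rw [abs_le] at h6 h7 ⊢
          constructor <;> linarith [h6.1, h6.2, h7.1, h7.2]
        rw [e1, abs_neg, abs_mul]
        exact mul_le_mul hab h2 (abs_nonneg _) he.le
    have hsum := Finset.sum_le_sum fun i (_ : i ∈ Finset.univ) => hstep i
    rw [Finset.sum_add_distrib, ← Finset.mul_sum, sum_steps, hp.first, hp.last] at hsum
    simp only [genFamily]
    linarith
  have key := abs_sub_le_of_forall_local (g := g) (B := (t - s) * A)
    (C := (2 * M + K * (2 * M) ^ 2) * (t - s)) one_pos fun a ha b hb hab _ => ?_
  · have h0 := hg 0 (left_mem_Icc.2 zero_le_one)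
    have h1 := hg 1 (right_mem_Icc.2 zero_le_one)
    simp only [hHm, zero_mul, add_zero, one_mul, add_sub_cancel] at h0 h1
    rw [isMinmax_unique hr h0, isMinmax_unique hr' h1, abs_sub_comm]
    exact key
  · rcases hab.eq_or_lt with rfl | hab
    · simp
    · have he : 0 < b - a := by linarith
      have h1 := one_side a ha b hb (b - a) he (by rw [abs_sub_comm, abs_of_pos he])
      have h2 := one_side b hb a ha (b - a) he (by rw [abs_of_pos he])
      have e : ((b - a) * (A + 2 * M * (b - a)) + K * (2 * M * (b - a)) ^ 2) * (t - s)
        = (t - s) * A * (b - a) + (2 * M + K * (2 * M) ^ 2) * (t - s) * (b - a) ^ 2 := by ring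
      rw [e] at h1 h2
      rw [abs_le]
      constructor <;> linarith

/-! ### Dependence on the initial function -/

/-- Only nodes with `‖x_{i+1} - x_i‖ ≤ M (t_{i+1} - t_i) + 1/(N+1)` matter; then `x_0` is within `M
(t - s) + 1` of `x`, whatever the Lipschitz constants of `v` and `v'`. -/
lemma minmax_le_of_initial (h : Tame T H c m M) (hκ2 : κ < Real.log 2) (hs : 0 ≤ s) (ht : t ≤ T)
    {N : ℕ} {p : Fin (N + 1) → ℝ} (hp : IsFine c κ s t p) {v v' : Config d → ℝ} (hv : IsLip v)
    (hv' : IsLip v') {x : Config d} {r r' δ : ℝ} (hδ : 0 ≤ δ)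
    (hle : ∀ x₀, ‖x₀ - x‖ ≤ M * (t - s) + 1 → v x₀ - v' x₀ ≤ δ)
    (hr : IsMinmax (quadForm d N) (genFamily T H p v x) r)
    (hr' : IsMinmax (quadForm d N) (genFamily T H p v' x) r') : r ≤ r' + δ := by
  refine isMinmax_le_add_of_nodes (b := fun i => M * (p i.succ - p i.castSucc))
    (fun i => mul_nonneg h.M_nonneg (sub_nonneg.2 (hp.le_succ i)))
    (h.genFun_step_right hκ2 hs ht hp) (h.isLip_genFun_step hκ2 hs ht hp) hv
    (h.isQuadLip_genFamily hκ2 hs ht hp hv' x) (ε := 1 / (N + 1)) (by positivity) hδ hr hr'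
    fun η hη => ?_
  have h1 : ‖node x η 0 - x‖ ≤ M * (t - s) + 1 := by
    have e : x - node x η 0 = ∑ i : Fin N, (node x η i.succ - node x η i.castSucc) := by
      have h1 := Fin.sum_univ_succ (node x η)
      rw [Fin.sum_univ_castSucc, node_last] at h1
      rw [Finset.sum_sub_distrib, sub_eq_sub_iff_add_eq_add, add_comm x, h1, add_comm]
    rw [norm_sub_rev, e]
    refine (norm_sum_le _ _).trans ((Finset.sum_le_sum fun i _ => hη i).trans ?_)
    rw [Finset.sum_add_distrib, ← Finset.mul_sum, sum_steps, hp.first, hp.last, Finset.sum_const,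
      Finset.card_univ, Fintype.card_fin, nsmul_eq_mul, mul_one_div]
    have : (N : ℝ) / (N + 1) ≤ 1 := by
      rw [div_le_one (by positivity)]
      linarith
    linarith
  have h2 := hle _ h1
  change genFamily T H p v x η ≤ genFamily T H p v' x η + δ
  simp only [genFamily]
  linarith

end Tame

end

end HamiltonJacobi

/-! ### The proposition. -/

open HamiltonJacobi
theorem proposition3p9 {d : ℕ} {T : ℝ} (H : ℝ → Phase d → ℝ) (hH : IsC2c T H) :
    -- 1) the operator is well defined, preserves Lipschitz functions, and bound on the constant
    (∀ v : Config d → ℝ, IsLip v → ∀ s t : ℝ, 0 ≤ s → s < t → t ≤ T →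
      (∀ x : Config d, IsMinmaxValue T H s t v x (minmaxOp T H s t v x)) ∧
      IsLip (minmaxOp T H s t v) ∧
      (lipConst (minmaxOp T H s t v) : ℝ) ≤ lipConst v + normGradX T H * |t - s|) ∧
    -- 2) dependence on the final time
    (∀ v : Config d → ℝ, IsLip v → ∀ s t₁ t₂ : ℝ, 0 ≤ s → s < t₁ → t₁ ≤ T → s < t₂ → t₂ ≤ T →
      ∀ x : Config d,
        |minmaxOp T H s t₁ v x - minmaxOp T H s t₂ v x| ≤
          |t₁ - t₂| * supNorm
            (uIcc t₁ t₂ ×ˢ Metric.closedBall (0 : Config d)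
              (lipConst v + normGradX T H * max |t₁ - s| |t₂ - s|))
            (fun q : ℝ × Config d => H q.1 (pt x q.2))) ∧
    -- 3) dependence on the Hamiltonian
    (∀ H' : ℝ → Phase d → ℝ, IsC2c T H' → ∀ v : Config d → ℝ, IsLip v →
      ∀ s t : ℝ, 0 ≤ s → s < t → t ≤ T → ∀ x : Config d,
        |minmaxOp T H s t v x - minmaxOp T H' s t v x| ≤
          |t - s| * supNorm
            (Icc s t ×ˢ (univ : Set (Config d)) ×ˢ Metric.closedBall (0 : Config d)
              (lipConst v + max (normGradX T H) (normGradX T H') * |t - s|))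
            (fun q : ℝ × Config d × Config d =>
              H q.1 (pt q.2.1 q.2.2) - H' q.1 (pt q.2.1 q.2.2))) ∧
    -- 4) dependence on the initial function
    (∀ K : Set (Config d), IsCompact K → ∀ L₀ L₁ : ℝ≥0,
      ∃ K' : Set (Config d), Bornology.IsBounded K' ∧
        ∀ v₀ v₁ : Config d → ℝ, IsLip v₀ → IsLip v₁ → lipConst v₀ = L₀ → lipConst v₁ = L₁ →
          ∀ s t : ℝ, 0 ≤ s → s < t → t ≤ T → ∀ x ∈ K,
            |minmaxOp T H s t v₀ x - minmaxOp T H s t v₁ x| ≤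
              supNorm K' (fun x₀ => v₀ x₀ - v₁ x₀)) := by
  rcases le_or_gt T 0 with hT | hT
  · have hno : ∀ {s t : ℝ}, 0 ≤ s → s < t → t ≤ T → False := fun h1 h2 h3 => by linarith
    exact ⟨fun v _ s t h1 h2 h3 => (hno h1 h2 h3).elim,
      fun v _ s t₁ t₂ h1 h2 h3 => (hno h1 h2 h3).elim,
      fun H' _ v _ s t h1 h2 h3 => (hno h1 h2 h3).elim,
      fun K _ L₀ L₁ => ⟨∅, Bornology.isBounded_empty,
        fun v₀ v₁ _ _ _ _ s t h1 h2 h3 => (hno h1 h2 h3).elim⟩⟩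
  have hlog : 0 < Real.log 2 := Real.log_pos one_lt_two
  have hκ0 : 0 < Real.log 2 / 2 := by positivity
  have hκ2 : Real.log 2 / 2 < Real.log 2 := by linarith
  have hh0 : 0 ≤ hessBound T H := supNorm_nonneg _ _
  obtain ⟨M₀, hM₀⟩ := hH.exists_tame hT
  have h : Tame T H (hessBound T H + 1) (normGradX T H) (max M₀ (normGradX T H)) :=
    hM₀ _ _ _ (by linarith) (by linarith) le_rfl (le_max_right _ _) (le_max_left _ _)
  obtain ⟨N, hN⟩ := exists_uniform (T := T) h.c_pos hκ0
  have hval : ∀ {v : Config d → ℝ}, IsLip v → ∀ {s t : ℝ}, 0 ≤ s → s < t → t ≤ T → ∀ x,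
      IsMinmax (quadForm d (N + 1)) (genFamily T H (uniformSub s t N) v x)
        (minmaxOp T H s t v x) := fun hv s t hs hst ht x =>
    isMinmax_minmaxOp hH h (by linarith) hκ0 hκ2 hv hs hst ht x
      (isFine_uniformSub hst (hN s t hs ht))
  refine ⟨fun v hv s t hs hst ht => ⟨isMinmaxValue_minmaxOp hH hv hs hst ht, ?_⟩, ?_, ?_, ?_⟩
  · have hst0 : 0 < t - s := by linarith
    have hL : LipschitzWith (lipConst v + (normGradX T H * |t - s|).toNNReal)
        (minmaxOp T H s t v) := by
      have hpos : 0 ≤ normGradX T H * |t - s| := mul_nonneg h.m_nonneg (abs_nonneg _)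
      have h1 : ∀ x x', minmaxOp T H s t v x ≤ minmaxOp T H s t v x'
          + (lipConst v + normGradX T H * (t - s)) * ‖x - x'‖ := fun x x' =>
        h.minmax_le_base hκ2 hs ht (isFine_uniformSub hst (hN s t hs ht)) hv (hval hv hs hst ht x)
          (hval hv hs hst ht x')
      refine LipschitzWith.of_dist_le_mul fun x x' => ?_
      rw [NNReal.coe_add, Real.coe_toNNReal _ hpos, abs_of_pos hst0, Real.dist_eq, dist_eq_norm,
        abs_le]
      have h2 := h1 x x'
      have h3 := h1 x' x
      rw [norm_sub_rev] at h3
      constructor <;> linarith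
    refine ⟨⟨_, hL⟩, ?_⟩
    have h2 : lipConst (minmaxOp T H s t v) ≤ lipConst v + (normGradX T H * |t - s|).toNNReal :=
      csInf_le (OrderBot.bddBelow _) hL
    have h3 := NNReal.coe_le_coe.2 h2
    rwa [NNReal.coe_add, Real.coe_toNNReal _ (mul_nonneg h.m_nonneg (abs_nonneg _))] at h3
  · intro v hv s t₁ t₂ hs h1 h1T h2 h2T x
    wlog h12 : t₁ ≤ t₂ generalizing t₁ t₂
    · have := this t₂ t₁ h2 h2T h1 h1T (le_of_not_ge h12)
      rwa [abs_sub_comm, abs_sub_comm t₂, uIcc_comm, max_comm] at this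
    -- Boundedness must be supplied: `sSup` of a set unbounded above has the default value `0`.
    obtain ⟨B, hB⟩ := hH.exists_bound
    obtain ⟨C, ρ, hρ, hC⟩ := h.exists_minmaxOp_time_estimate hH (by linarith) hv x hs
    set R : ℝ := lipConst v + normGradX T H * max |t₁ - s| |t₂ - s| with hR
    set A := supNorm (uIcc t₁ t₂ ×ˢ Metric.closedBall (0 : Config d) R)
      (fun q : ℝ × Config d => H q.1 (pt x q.2)) with hA
    have hAle : ∀ u ∈ Icc t₁ t₂, ∀ y : Config d, ‖y‖ ≤ R → |H u (pt x y)| ≤ A := fun u hu y hy =>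
      le_supNorm (f := fun q : ℝ × Config d => H q.1 (pt x q.2)) (B := B) (a := (u, y))
        (fun q hq => by
          have hq1 := hq.1
          rw [uIcc_of_le h12] at hq1
          exact hB _ ⟨by linarith [hq1.1], hq1.2.trans h2T⟩ _)
        ⟨by rw [uIcc_of_le h12]; exact hu, mem_closedBall_zero_iff.2 hy⟩
    have hd0 : 0 ≤ t₂ - t₁ := by linarith
    -- The denominator `t₂ - t₁ + 1` makes parameter steps correspond to time steps at most `ρ`,
    -- including the case `t₁ = t₂`.
    have key := abs_sub_le_of_forall_local (g := fun a => minmaxOp T H s (t₁ + a * (t₂ - t₁)) v x)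
      (B := (t₂ - t₁) * A) (C := C * (t₂ - t₁) ^ 2) (ρ := ρ / (t₂ - t₁ + 1)) (by positivity)
      fun a ha b hb hab habρ => ?_
    · simp only [one_mul, zero_mul, add_zero, add_sub_cancel] at key
      rwa [abs_sub_comm, abs_sub_comm t₁, abs_of_nonneg hd0]
    · have e : t₁ + b * (t₂ - t₁) - (t₁ + a * (t₂ - t₁)) = (b - a) * (t₂ - t₁) := by ring
      have p1 := mul_nonneg ha.1 hd0
      have p2 := mul_le_mul_of_nonneg_right hb.2 hd0
      have p3 := mul_le_mul_of_nonneg_right hab hd0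
      have p4 : (b - a) * (t₂ - t₁) ≤ ρ := by
        rw [le_div_iff₀ (by linarith)] at habρ
        nlinarith
      have h3 := hC (t₁ + a * (t₂ - t₁)) (t₁ + b * (t₂ - t₁)) (by linarith) (by linarith)
        (by linarith) (by rw [e]; exact p4) A R (supNorm_nonneg _ _) ?_
        (hAle _ ⟨by linarith, by linarith⟩)
      · rw [e] at h3
        refine h3.trans (le_of_eq ?_)
        ring
      · refine add_le_add le_rfl (mul_le_mul_of_nonneg_left ?_ h.m_nonneg)
        refine le_trans ?_ (le_max_right _ _)
        refine le_trans ?_ (le_abs_self _)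
        linarith
  · intro H' hH' v hv s t hs hst ht x
    have hst0 : 0 < t - s := by linarith
    have hh0' : 0 ≤ hessBound T H' := supNorm_nonneg _ _
    obtain ⟨M₁, hM₁⟩ := hH'.exists_tame hT
    -- Mixing requires common constants for both Hamiltonians; this maximum is the one in the radius
    -- of the ball `Y'`.
    set m := max (normGradX T H) (normGradX T H') with hm
    set c := max (hessBound T H) (hessBound T H') + 1 with hc
    have hc1 : hessBound T H ≤ c := (le_max_left _ (hessBound T H')).trans (by linarith)
    have hc2 : hessBound T H' ≤ c := (le_max_right (hessBound T H) _).trans (by linarith)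
    have hc0 : 0 < c := by
      have := le_max_left (hessBound T H) (hessBound T H')
      linarith
    have k : Tame T H c m (max (max M₀ M₁) m) := hM₀ _ _ _ hc1 hc0 (le_max_left _ _)
      (le_max_right _ _) ((le_max_left _ _).trans (le_max_left _ _))
    have k' : Tame T H' c m (max (max M₀ M₁) m) := hM₁ _ _ _ hc2 hc0 (le_max_right _ _)
      (le_max_right _ _) ((le_max_right _ _).trans (le_max_left _ _))
    obtain ⟨n, hn⟩ := exists_uniform (T := T) hc0 hκ0
    have hp := isFine_uniformSub hst (hn s t hs ht)
    obtain ⟨B, hB⟩ := hH.exists_bound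
    obtain ⟨B', hB'⟩ := hH'.exists_bound
    rw [abs_of_pos hst0]
    refine k.minmax_sub_le_of_hamiltonian k' hκ2 hs ht hp hv (supNorm_nonneg _ _) ?_
      (isMinmax_minmaxOp hH k hc1 hκ0 hκ2 hv hs hst ht x hp)
      (isMinmax_minmaxOp hH' k' hc2 hκ0 hκ2 hv hs hst ht x hp)
    intro τ hτ x y hy
    refine le_supNorm (f := fun q : ℝ × Config d × Config d =>
      H q.1 (pt q.2.1 q.2.2) - H' q.1 (pt q.2.1 q.2.2)) (B := B + B') (a := (τ, x, y))
      (fun q hq => ?_) ⟨hτ, mem_univ _, mem_closedBall_zero_iff.2 hy⟩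
    have hq1 : q.1 ∈ Icc 0 T := ⟨hs.trans hq.1.1, hq.1.2.trans ht⟩
    exact (norm_sub_le _ _).trans (add_le_add (hB _ hq1 _) (hB' _ hq1 _))
  · intro K hK L₀ L₁
    set M := max M₀ (normGradX T H) with hM
    obtain ⟨R, hR⟩ := hK.isBounded.exists_norm_le
    -- `R` bounds `K`, and `M T + 1` bounds the distance from `x` to the values of `x_0` that
    -- matter.
    refine ⟨Metric.closedBall 0 (R + (M * T + 1)), Metric.isBounded_closedBall, ?_⟩
    intro v₀ v₁ hv₀ hv₁ _ _ s t hs hst ht x hx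
    have hp := isFine_uniformSub hst (hN s t hs ht)
    obtain ⟨B, hB⟩ := (isCompact_closedBall (0 : Config d)
      (R + (M * T + 1))).exists_bound_of_continuousOn
      (f := fun x₀ => v₀ x₀ - v₁ x₀)
      (hv₀.lipschitzWith.continuous.sub hv₁.lipschitzWith.continuous).continuousOn
    have hle : ∀ x₀, ‖x₀ - x‖ ≤ M * (t - s) + 1 → |v₀ x₀ - v₁ x₀|
        ≤ supNorm (Metric.closedBall 0 (R + (M * T + 1))) (fun x₀ => v₀ x₀ - v₁ x₀) := by
      intro x₀ hx₀
      refine le_supNorm (f := fun x₀ => v₀ x₀ - v₁ x₀) hB (mem_closedBall_zero_iff.2 ?_)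
      have h1 := norm_sub_norm_le x₀ x
      have h2 := hR x hx
      have h3 := mul_le_mul_of_nonneg_left (by linarith : t - s ≤ T) h.M_nonneg
      linarith
    have h1 := h.minmax_le_of_initial hκ2 hs ht hp hv₀ hv₁ (supNorm_nonneg _ _)
      (fun x₀ hx₀ => (le_abs_self _).trans (hle x₀ hx₀)) (hval hv₀ hs hst ht x)
      (hval hv₁ hs hst ht x)
    have h2 := h.minmax_le_of_initial hκ2 hs ht hp hv₁ hv₀ (supNorm_nonneg _ _)
      (fun x₀ hx₀ => (neg_sub (v₀ x₀) (v₁ x₀) ▸ neg_le_abs _ : v₁ x₀ - v₀ x₀ ≤ _).trans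
        (hle x₀ hx₀)) (hval hv₁ hs hst ht x) (hval hv₀ hs hst ht x)
    rw [abs_le]
    constructor <;> linarith
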